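/- Throughout, $I$ is a nonempty finite set. A forest on $I$ is a set of rooted binary (non-planar) trees whose leaves are bijectively labelled by $I$; $V(F)$ is the set of inner vertices of $F$. At each inner vertex there are three half-edges, two incoming and one outgoing (towards the root). An orientation of a finite set $X$ is a generator of $\Lambda^{|X|}\mathbb{Z}X$. An inner-oriented forest $o\otimes F$ consists of a forest $F$, a global orientation $o$, i.e. an orientation of $V(F)\sqcup\{R\}$ with $R$ an auxiliary element, and, implicitly in the notation, a local orientation at each inner vertex, i.e. an orientation of its three half-edges. $\mathrm{Bess}(I)$ is the $\mathbb{Q}$-vector space spanned by the inner-oriented forests on $I$, multilinear in the orientations (so that it has a basis indexed by the forests on $I$), graded by the number of inner vertices. These spaces form an operad $\mathrm{Bess}$ in graded vector spaces with Koszul signs. The composition $(o_1\otimes F_1)\circ_\star(o_2\otimes F_2)$ is the sum, over all maps $s$ from the set of inner vertices on the path of $F_1$ from the leaf $\star$ to the root to the set of trees of $F_2$, of $o\otimes F_s$. Here $F_s$ is obtained from $F_1$ and $F_2$ by removing $\star$ and attaching, successively from the leaf $\star$ towards the root, the branch of each vertex $v$ of this path that does not contain $\star$ to the root of the current tree grown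 from $s(v)$, by a vertex which is identified with $v$; the trees of $F_1$ that do not contain $\star$ are kept. The local orientations are unchanged, and $o$ is $o_1\wedge r\wedge o_2$ modulo $R_1\wedge r\wedge R_2=R$. The operad $\mathrm{Bess}$ is generated by $E_{i,j}$, which is $R$ tensored with the forest on $\{i,j\}$ without inner vertex, and $\Omega_{i,j}$, which is the tree on $\{i,j\}$ with one inner vertex $v$, global orientation $R\wedge v$ and local orientation $\mathrm{root}\wedge i\wedge j$. For forests $F',F$ on $I$, write $F'\le F$ if there is a map $F'\to F$ that is increasing with respect to the orientation towards the root, restricts to the identity on leaves, maps inner vertices to inner vertices injectively, and at each inner vertex sends the two incoming half-edges to the two different incoming half-edges at its image. Such a map is unique if it exists. For $V\subseteq V(F)$, let $\gamma(F,V)$ be the sum of the forests $F'\le F$ such that the image of $V(F')$ is $V$. For an orientation $o'$ of $V\sqcup\{R'\}$, the sum $o'\otimes\gamma(F,V)\in\mathrm{Bess}(I)$ is defined by identifying the inner vertices of each such $F'$, and their half-edges, with those of $F$ in $V$; the local orientations are those of $F$. **Proposition.** There is exactly one morphism of operads $\Delta:\mathrm{Bess}\to\mathrm{Bess}\otimes\mathrm{Bess}$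 with $\Delta(E_{i,j})=E_{i,j}\otimes E_{i,j}$ and $\Delta(\Omega_{i,j})=E_{i,j}\otimes\Omega_{i,j}+\Omega_{i,j}\otimes E_{i,j}$. For every inner-oriented forest $o\otimes F$ on $I$, $$\Delta(o\otimes F)=\sum_{V(F)=V'\sqcup V''}\bigl(o'\otimes\gamma(F,V')\bigr)\otimes\bigl(o''\otimes\gamma(F,V'')\bigr),$$ where the local orientations are unchanged and, for each splitting, $o'$ and $o''$ are orientations of $V'\sqcup\{R'\}$ and $V''\sqcup\{R''\}$ such that $o'\wedge r\wedge o''=o$ modulo $R'\wedge r\wedge R''=R$ (this determines $o'\otimes o''$). -/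

import Mathlib

open scoped Classical TensorProduct

universe u

noncomputable section

namespace Bessel

/-! ## Forests of leaf-labelled rooted binary trees -/

section Clusters

variable {I : Type u}

/-- In a forest on `I`, a leaf or an inner vertex is recorded by the set of leaves above it
(its ancestor leaves): a leaf `i` by `{i}`, an inner vertex by a member of `V`.
The edge leaving a node towards the root is named after that node. -/
def IsNode (V : Finset (Set I)) (A : Set I) : Prop := A ∈ V ∨ ∃ i, A = {i}

/-- `A` and `B` are the two nodes directly above `v`. -/
def IsSplit (V : Finset (Set I)) (v A B : Set I) : Prop :=
  IsNode V A ∧ IsNode V B ∧ Disjoint A B ∧ A ∪ B = v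

end Clusters

/-- A forest on `I`: a set of rooted binary (non planar) trees whose leaves are bijectively
labelled by `I`, given by its inner vertices. -/
@[ext]
structure Forest (I : Type u) where
  verts : Finset (Set I)
  nonempty : ∀ v ∈ verts, v.Nonempty
  laminar : ∀ v ∈ verts, ∀ w ∈ verts, v ⊆ w ∨ w ⊆ v ∨ Disjoint v w
  binary : ∀ v ∈ verts, ∃ A B, IsSplit verts v A B

namespace Forest

variable {I : Type u}

/-- A tree of the forest, given by its set of leaves, i.e. by the node next to its root. -/
def IsTree (F : Forest I) (T : Set I) : Prop :=
  IsNode F.verts T ∧ ∀ N, IsNode F.verts N → T ⊆ N → N = T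

/-- The forest without inner vertex. -/
def discrete (I : Type u) : Forest I where
  verts := ∅
  nonempty := by simp
  laminar := by simp
  binary := by simp

theorem node_nonempty (F : Forest I) {A : Set I} (h : IsNode F.verts A) : A.Nonempty := by
  rcases h with h | ⟨i, rfl⟩
  · exact F.nonempty A h
  · exact Set.singleton_nonempty i

theorem node_laminar (F : Forest I) {A B : Set I} (hA : IsNode F.verts A)
    (hB : IsNode F.verts B) : A ⊆ B ∨ B ⊆ A ∨ Disjoint A B := by
  rcases hA with hA | ⟨i, rfl⟩
  · rcases hB with hB | ⟨j, rfl⟩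
    · exact F.laminar A hA B hB
    · by_cases h : j ∈ A
      · exact Or.inr (Or.inl (by simpa using h))
      · exact Or.inr (Or.inr (by simpa using h))
  · by_cases h : i ∈ B
    · exact Or.inl (by simpa using h)
    · exact Or.inr (Or.inr (by simpa using h))

theorem split_symm {V : Finset (Set I)} {v A B : Set I} (h : IsSplit V v A B) :
    IsSplit V v B A :=
  ⟨h.2.1, h.1, h.2.2.1.symm, by rw [Set.union_comm]; exact h.2.2.2⟩

/-- A node strictly inside an inner vertex lies above one of its two branches. -/
theorem node_sub_branch (F : Forest I) {v A B N : Set I} (h : IsSplit F.verts v A B)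
    (hN : IsNode F.verts N) (hNv : N ⊆ v) (hne : N ≠ v) : N ⊆ A ∨ N ⊆ B := by
  obtain ⟨hA, hB, hd, hu⟩ := h
  obtain ⟨x, hx⟩ := F.node_nonempty hA
  obtain ⟨y, hy⟩ := F.node_nonempty hB
  obtain ⟨z, hz⟩ := F.node_nonempty hN
  rw [Set.disjoint_left] at hd
  rcases F.node_laminar hN hA with h1 | h1 | h1
  · exact Or.inl h1
  · rcases F.node_laminar hN hB with h2 | h2 | h2
    · exact Or.inr h2
    · exact absurd (Set.Subset.antisymm hNv (hu ▸ Set.union_subset h1 h2)) hne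
    · left
      intro t ht
      have := hNv ht
      rw [← hu] at this
      rcases this with h | h
      · exact h
      · exact absurd h (Set.disjoint_left.1 h2 ht)
  · right
    intro t ht
    have := hNv ht
    rw [← hu] at this
    rcases this with h | h
    · exact absurd h (Set.disjoint_left.1 h1 ht)
    · exact h

theorem split_unique (F : Forest I) {v A B C D : Set I} (h : IsSplit F.verts v A B)
    (h' : IsSplit F.verts v C D) : (C = A ∧ D = B) ∨ (C = B ∧ D = A) := by
  have key : ∀ {A B C D : Set I}, IsSplit F.verts v A B → IsSplit F.verts v C D → C ⊆ A →
      C = A ∧ D = B := by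
    intro A B C D h h' hCA
    obtain ⟨hA, hB, hd, hu⟩ := h
    obtain ⟨hC, hD, hd', hu'⟩ := h'
    rw [Set.disjoint_left] at hd hd'
    obtain ⟨y, hy⟩ := F.node_nonempty hB
    have hBD : B ⊆ D := by
      intro t ht
      have : t ∈ C ∪ D := by rw [hu', ← hu]; exact Or.inr ht
      rcases this with h | h
      · exact absurd ht (hd (hCA h))
      · exact h
    have hDne : D ≠ v := by
      rintro rfl
      obtain ⟨x, hx⟩ := F.node_nonempty hC
      exact hd' hx (hu' ▸ Or.inl hx)
    rcases F.node_sub_branch ⟨hA, hB, Set.disjoint_left.2 hd, hu⟩ hD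
      (hu' ▸ Set.subset_union_right) hDne with h1 | h1
    · exact absurd hy (hd (h1 (hBD hy)))
    · have hDB : D = B := Set.Subset.antisymm h1 hBD
      refine ⟨Set.Subset.antisymm hCA ?_, hDB⟩
      intro t ht
      have : t ∈ C ∪ D := by rw [hu', ← hu]; exact Or.inl ht
      rcases this with h | h
      · exact h
      · rw [hDB] at h; exact absurd h (hd ht)
  have hCne : C ≠ v := by
    rintro rfl
    obtain ⟨x, hx⟩ := F.node_nonempty h'.2.1
    exact Set.disjoint_left.1 h'.2.2.1 (h'.2.2.2 ▸ Or.inr hx) hx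
  rcases F.node_sub_branch h h'.1 (h'.2.2.2 ▸ Set.subset_union_left) hCne with h1 | h1
  · exact Or.inl (key h h' h1)
  · exact Or.inr (key (split_symm h) h' h1)

instance [Finite I] : Finite (Forest I) :=
  Finite.of_injective (fun F : Forest I => F.verts) fun _ _ h => Forest.ext h

end Forest

/-! ## Orientations -/

/-- An exterior product, written as a word `x₁ ∧ x₂ ∧ ⋯`, of all the elements of the set
`V ⊔ {R}`; the letter `none` is the auxiliary element `R`.  Every orientation of `V ⊔ {R}` is
`±` such a word. -/
@[ext]
structure GlobalOrientation {I : Type u} (V : Finset (Set I)) where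
  word : List (Option (Set I))
  nodup : word.Nodup
  mem_iff : ∀ x, x ∈ word ↔ x = none ∨ ∃ v ∈ V, x = some v

/-- `h` is a half-edge at the inner vertex `v`: the outgoing one is `none`, the incoming one
that comes from the node `A` is `some A`. -/
def IsHalfEdge {I : Type u} (V : Finset (Set I)) (v : Set I) (h : Option (Set I)) : Prop :=
  h = none ∨ ∃ A B, IsSplit V v A B ∧ h = some A

/-- An inner-oriented forest `o ⊗ ⨂ o_v ⊗ F`: a forest, a global orientation, and at each
inner vertex a local orientation, i.e. an exterior product of the three half-edges there. -/
@[ext]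
structure InnerForest (I : Type u) where
  forest : Forest I
  glob : GlobalOrientation forest.verts
  loc : Set I → List (Option (Set I))
  loc_nodup : ∀ v ∈ forest.verts, (loc v).Nodup
  loc_mem : ∀ v ∈ forest.verts, ∀ h, h ∈ loc v ↔ IsHalfEdge forest.verts v h
  /-- no data outside the inner vertices -/
  loc_off : ∀ v, v ∉ forest.verts → loc v = []

/-- Exchange of two neighbouring factors in an exterior product. -/
def AdjSwap {α : Type*} (l l' : List α) : Prop :=
  ∃ a x y b, l = a ++ x :: y :: b ∧ l' = a ++ y :: x :: b

/-- `x` and `y` differ by the exchange of two neighbouring factors in the global orientation or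
in one local orientation. -/
def Flip {I : Type u} (x y : InnerForest I) : Prop :=
  x.forest = y.forest ∧
    ((AdjSwap x.glob.word y.glob.word ∧ x.loc = y.loc) ∨
      (x.glob.word = y.glob.word ∧ ∃ v, AdjSwap (x.loc v) (y.loc v) ∧
        ∀ w, w ≠ v → x.loc w = y.loc w))

/-- The relations `x = -y` between inner-oriented forests that define exterior products. -/
def flipRel (I : Type u) : Submodule ℚ (InnerForest I →₀ ℚ) :=
  Submodule.span ℚ {z | ∃ x y, Flip x y ∧ z = Finsupp.single x 1 + Finsupp.single y 1}

/-- The space `Bess(I)`: it is spanned by the inner-oriented forests on `I`, and has a basis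
indexed by forests once an orientation of each forest has been chosen. -/
abbrev Bess (I : Type u) : Type u := (InnerForest I →₀ ℚ) ⧸ flipRel I

/-- The element `o ⊗ F` of `Bess(I)`. -/
def Bess.of {I : Type u} (x : InnerForest I) : Bess I :=
  (flipRel I).mkQ (Finsupp.single x 1)

theorem flipRel_le_ker {I : Type u} {M : Type*} [AddCommGroup M] [Module ℚ M]
    (f : InnerForest I → M) (hf : ∀ x y, Flip x y → f x + f y = 0) :
    flipRel I ≤ LinearMap.ker (Finsupp.linearCombination ℚ f) := by
  rw [flipRel, Submodule.span_le]
  rintro _ ⟨x, y, h, rfl⟩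
  simp [hf x y h]

/-- Linear maps out of `Bess(I)`. -/
def Bess.lift {I : Type u} {M : Type*} [AddCommGroup M] [Module ℚ M] (f : InnerForest I → M)
    (hf : ∀ x y, Flip x y → f x + f y = 0) : Bess I →ₗ[ℚ] M :=
  (flipRel I).liftQ (Finsupp.linearCombination ℚ f) (flipRel_le_ker f hf)

@[simp]
theorem Bess.lift_of {I : Type u} {M : Type*} [AddCommGroup M] [Module ℚ M]
    (f : InnerForest I → M) (hf : ∀ x y, Flip x y → f x + f y = 0) (x : InnerForest I) :
    Bess.lift f hf (Bess.of x) = f x := by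
  rw [Bess.lift, Bess.of, Submodule.mkQ_apply, Submodule.liftQ_apply]
  simp

theorem Bess.of_flip {I : Type u} {x y : InnerForest I} (h : Flip x y) :
    Bess.of x + Bess.of y = 0 := by
  rw [Bess.of, Bess.of, ← map_add, Submodule.mkQ_apply, Submodule.Quotient.mk_eq_zero]
  exact Submodule.subset_span ⟨x, y, h, rfl⟩

theorem AdjSwap.map {α β : Type*} (f : α → β) {l l' : List α} (h : AdjSwap l l') :
    AdjSwap (l.map f) (l'.map f) := by
  obtain ⟨a, x, y, b, rfl, rfl⟩ := h
  exact ⟨a.map f, f x, f y, b.map f, by simp, by simp⟩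

/-- The projection of `Bess(I)` on its part of odd degree; the degree of an inner-oriented
forest is the number of its inner vertices. -/
def Bess.oddPart (I : Type u) : Bess I →ₗ[ℚ] Bess I :=
  Bess.lift (fun x => if Odd x.forest.verts.card then Bess.of x else 0) <| by
    intro x y h
    simp only [h.1]
    split_ifs
    · exact Bess.of_flip h
    · simp

/-! ## Transport of local orientations -/

section Push

variable {I K : Type u}

/-- If the vertices `v ∈ S` are renamed `φ v`, and the incoming half-edge `A` at `v` is
renamed `η v A`, the local orientations `l` become `pushLoc φ η S l`. -/
def pushLoc (φ : Set I → Set K) (η : Set I → Set I → Set K) (S : Finset (Set I))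
    (l : Set I → List (Option (Set I))) (w : Set K) : List (Option (Set K)) :=
  if h : ∃ v ∈ S, φ v = w then (l h.choose).map (Option.map (η h.choose)) else []

variable {φ : Set I → Set K} {η : Set I → Set I → Set K} {S : Finset (Set I)}
  {l : Set I → List (Option (Set I))}

theorem pushLoc_apply (hφ : Set.InjOn φ (S : Set (Set I))) {v : Set I} (hv : v ∈ S) :
    pushLoc φ η S l (φ v) = (l v).map (Option.map (η v)) := by
  have h : ∃ v' ∈ S, φ v' = φ v := ⟨v, hv, rfl⟩
  have h2 : h.choose = v := hφ h.choose_spec.1 hv h.choose_spec.2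
  rw [pushLoc, dif_pos h, h2]

theorem pushLoc_off {w : Set K} (h : ∀ v ∈ S, φ v ≠ w) : pushLoc φ η S l w = [] := by
  rw [pushLoc, dif_neg]
  rintro ⟨v, hv, h'⟩
  exact h v hv h'

/-- Renaming sends the three half-edges at `v` to the three half-edges at `φ v`. -/
theorem pushLoc_valid (F : Forest I) (G : Forest K) {v : Set I} (hv : v ∈ F.verts) {w : Set K}
    {e : Set I → Set K} (hs : ∀ A B, IsSplit F.verts v A B → IsSplit G.verts w (e A) (e B))
    {L : List (Option (Set I))} (hn : L.Nodup) (hm : ∀ h, h ∈ L ↔ IsHalfEdge F.verts v h) :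
    (L.map (Option.map e)).Nodup ∧
      ∀ h, h ∈ L.map (Option.map e) ↔ IsHalfEdge G.verts w h := by
  obtain ⟨A, B, hAB⟩ := F.binary v hv
  have hAB' := hs A B hAB
  have hne : e A ≠ e B := by
    intro h
    obtain ⟨x, hx⟩ := G.node_nonempty hAB'.1
    exact Set.disjoint_left.1 hAB'.2.2.1 hx (h ▸ hx)
  have hch : ∀ h, IsHalfEdge F.verts v h → h = none ∨ h = some A ∨ h = some B := by
    rintro h (rfl | ⟨C, D, hCD, rfl⟩)
    · simp
    · rcases F.split_unique hAB hCD with ⟨rfl, -⟩ | ⟨rfl, -⟩ <;> simp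
  constructor
  · refine List.Nodup.map_on ?_ hn
    intro x hx y hy hxy
    rcases hch x ((hm x).1 hx) with rfl | rfl | rfl <;>
      rcases hch y ((hm y).1 hy) with rfl | rfl | rfl <;>
      simp_all [eq_comm]
  · intro h
    rw [List.mem_map]
    constructor
    · rintro ⟨x, hx, rfl⟩
      rcases (hm x).1 hx with rfl | ⟨C, D, hCD, rfl⟩
      · exact Or.inl rfl
      · exact Or.inr ⟨_, _, hs _ _ hCD, rfl⟩
    · rintro (rfl | ⟨C, D, hCD, rfl⟩)
      · exact ⟨none, (hm none).2 (Or.inl rfl), rfl⟩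
      · rcases G.split_unique hAB' hCD with ⟨rfl, -⟩ | ⟨rfl, -⟩
        · exact ⟨some A, (hm _).2 (Or.inr ⟨A, B, hAB, rfl⟩), rfl⟩
        · exact ⟨some B, (hm _).2 (Or.inr ⟨B, A, Forest.split_symm hAB, rfl⟩), rfl⟩

theorem pushLoc_flip (hφ : Set.InjOn φ (S : Set (Set I)))
    {l l' : Set I → List (Option (Set I))} {v : Set I} (hv : v ∈ S)
    (h : AdjSwap (l v) (l' v)) (h' : ∀ w, w ≠ v → l w = l' w) :
    AdjSwap (pushLoc φ η S l (φ v)) (pushLoc φ η S l' (φ v)) ∧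
      ∀ w, w ≠ φ v → pushLoc φ η S l w = pushLoc φ η S l' w := by
  constructor
  · rw [pushLoc_apply hφ hv, pushLoc_apply hφ hv]
    exact h.map _
  · intro w hw
    by_cases hx : ∃ u ∈ S, φ u = w
    · obtain ⟨u, hu, rfl⟩ := hx
      rw [pushLoc_apply hφ hu, pushLoc_apply hφ hu, h']
      rintro rfl
      exact hw rfl
    · push Not at hx
      rw [pushLoc_off hx, pushLoc_off hx]

end Push

/-- In a pair of flipped local orientations the vertex concerned is a vertex of the forest. -/
theorem flip_vertex_mem {I : Type u} (x : InnerForest I) {v : Set I} {L : List (Option (Set I))}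
    (h : AdjSwap (x.loc v) L) : v ∈ x.forest.verts := by
  by_contra hv
  obtain ⟨a, s, t, b, h1, -⟩ := h
  rw [x.loc_off v hv] at h1
  simp at h1

/-- Renaming of the letters of a global orientation. -/
def GlobalOrientation.map {I K : Type u} {V : Finset (Set I)} {W : Finset (Set K)}
    (o : GlobalOrientation V) (φ : Set I → Set K) (hφ : Set.InjOn φ (V : Set (Set I)))
    (hW : W = V.image φ) : GlobalOrientation W where
  word := o.word.map (Option.map φ)
  nodup := by
    refine List.Nodup.map_on ?_ o.nodup
    intro x hx y hy hxy
    rcases (o.mem_iff x).1 hx with rfl | ⟨v, hv, rfl⟩ <;>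
      rcases (o.mem_iff y).1 hy with rfl | ⟨w, hw, rfl⟩
    · rfl
    · simp at hxy
    · simp at hxy
    · simp only [Option.map_some, Option.some.injEq] at hxy ⊢
      exact hφ hv hw hxy
  mem_iff := by
    intro x
    rw [List.mem_map]
    constructor
    · rintro ⟨y, hy, rfl⟩
      rcases (o.mem_iff y).1 hy with rfl | ⟨v, hv, rfl⟩
      · exact Or.inl rfl
      · exact Or.inr ⟨φ v, by rw [hW]; exact Finset.mem_image_of_mem _ hv, rfl⟩
    · rintro (rfl | ⟨w, hw, rfl⟩)
      · exact ⟨none, (o.mem_iff _).2 (Or.inl rfl), rfl⟩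
      · rw [hW, Finset.mem_image] at hw
        obtain ⟨v, hv, rfl⟩ := hw
        exact ⟨some v, (o.mem_iff _).2 (Or.inr ⟨v, hv, rfl⟩), rfl⟩

/-! ## Relabelling of the leaves -/

section Relabel

variable {I K : Type u} (e : I ≃ K)

theorem node_relabel {V : Finset (Set I)} {A : Set I} (h : IsNode V A) :
    IsNode (V.image fun v => e '' v) (e '' A) := by
  rcases h with h | ⟨i, rfl⟩
  · exact Or.inl (Finset.mem_image_of_mem _ h)
  · exact Or.inr ⟨e i, by simp⟩

theorem split_relabel {V : Finset (Set I)} {v A B : Set I} (h : IsSplit V v A B) :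
    IsSplit (V.image fun v => e '' v) (e '' v) (e '' A) (e '' B) :=
  ⟨node_relabel e h.1, node_relabel e h.2.1, (Set.disjoint_image_iff e.injective).2 h.2.2.1,
    by rw [← Set.image_union, h.2.2.2]⟩

/-- Action of a bijection on forests. -/
def Forest.relabel (F : Forest I) : Forest K where
  verts := F.verts.image fun v => e '' v
  nonempty := by
    intro w hw
    obtain ⟨v, hv, rfl⟩ := Finset.mem_image.1 hw
    exact (F.nonempty v hv).image e
  laminar := by
    intro w hw w' hw'
    obtain ⟨v, hv, rfl⟩ := Finset.mem_image.1 hw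
    obtain ⟨v', hv', rfl⟩ := Finset.mem_image.1 hw'
    rw [Set.image_subset_image_iff e.injective, Set.image_subset_image_iff e.injective,
      Set.disjoint_image_iff e.injective]
    exact F.laminar v hv v' hv'
  binary := by
    intro w hw
    obtain ⟨v, hv, rfl⟩ := Finset.mem_image.1 hw
    obtain ⟨A, B, h⟩ := F.binary v hv
    exact ⟨e '' A, e '' B, split_relabel e h⟩

/-- Action of a bijection on inner-oriented forests. -/
def InnerForest.relabel (x : InnerForest I) : InnerForest K where
  forest := x.forest.relabel e
  glob := x.glob.map (fun v => e '' v) e.injective.image_injective.injOn rfl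
  loc := pushLoc (fun v => e '' v) (fun _ A => e '' A) x.forest.verts x.loc
  loc_nodup := by
    intro w hw
    obtain ⟨v, hv, rfl⟩ := Finset.mem_image.1 hw
    rw [pushLoc_apply (φ := fun v => e '' v) e.injective.image_injective.injOn hv]
    exact (pushLoc_valid x.forest (x.forest.relabel e) hv (fun A B h => split_relabel e h)
      (x.loc_nodup v hv) (x.loc_mem v hv)).1
  loc_mem := by
    intro w hw
    obtain ⟨v, hv, rfl⟩ := Finset.mem_image.1 hw
    rw [pushLoc_apply (φ := fun v => e '' v) e.injective.image_injective.injOn hv]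
    exact (pushLoc_valid x.forest (x.forest.relabel e) hv (fun A B h => split_relabel e h)
      (x.loc_nodup v hv) (x.loc_mem v hv)).2
  loc_off := by
    intro w hw
    refine pushLoc_off fun v hv h => hw ?_
    rw [← h]
    exact Finset.mem_image_of_mem _ hv

theorem InnerForest.relabel_flip {x y : InnerForest I} (h : Flip x y) :
    Flip (x.relabel e) (y.relabel e) := by
  obtain ⟨hF, h⟩ := h
  refine ⟨by simp only [InnerForest.relabel, hF], ?_⟩
  rcases h with ⟨h1, h2⟩ | ⟨h1, v, h2, h3⟩
  · exact Or.inl ⟨h1.map _, by simp only [InnerForest.relabel, hF, h2]⟩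
  · refine Or.inr ⟨by simp only [InnerForest.relabel, GlobalOrientation.map, h1], e '' v, ?_⟩
    have := pushLoc_flip (φ := fun v => e '' v) (η := fun _ A => e '' A)
      e.injective.image_injective.injOn (flip_vertex_mem x h2) h2 h3
    simp only [InnerForest.relabel, ← hF]
    exact this

/-- Functoriality of `Bess` on bijections. -/
def Bess.relabel : Bess I →ₗ[ℚ] Bess K :=
  Bess.lift (fun x => Bess.of (x.relabel e)) fun _ _ h =>
    Bess.of_flip (InnerForest.relabel_flip e h)

end Relabel

/-! ## Composition

For a forest `F` on `I ⊔ {⋆}` and a forest `F₂` on `J`, the composition `F ∘_⋆ F₂` plugs `F₂`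
into the leaf `⋆`.  By the Leibniz rule
`Ω_{i,⋆} ∘_⋆ E_{j,k} = E_{j,⋆} ∘_⋆ Ω_{i,k} + E_{k,⋆} ∘_⋆ Ω_{i,j}`, each inner vertex on the
path from `⋆` to the root is attached to one of the trees of `F₂`, and all choices are summed.
The leaf `⋆` is `none` and `I ⊔ J` is `I ⊕ J`. -/

section Graft

variable {I J : Type u}

/-- The inner vertices on the path from the leaf `⋆` to the root. -/
abbrev PathVert (F : Forest (Option I)) : Type u := {v : Set (Option I) // v ∈ F.verts ∧ none ∈ v}

/-- The trees of a forest. -/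
abbrev Tree (F : Forest J) : Type u := {T : Set J // F.IsTree T}

instance (F : Forest (Option I)) : Finite (PathVert F) :=
  Finite.of_injective (fun v : PathVert F => (⟨v.1, v.2.1⟩ : F.verts))
    fun a b h => Subtype.ext (by simpa using h)

instance (F : Forest (Option I)) : Fintype (PathVert F) := Fintype.ofFinite _

instance [Finite J] (F : Forest J) : Fintype (Tree F) := Fintype.ofFinite _

/-- The map that collapses `J` to `⋆`. -/
def collapse : I ⊕ J → Option I := Sum.elim some fun _ => none

/-- The branch above `v` that does not contain the leaf `⋆`. -/
def side (F : Forest (Option I)) (v : Set (Option I)) : Set (Option I) :=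
  {x | ∃ A B, IsSplit F.verts v A B ∧ none ∈ A ∧ x ∈ B}

variable (F : Forest (Option I)) (F₂ : Forest J)

/-- The vertex of the composed forest that comes from `v`, when the vertices on the path of `⋆`
are attached to trees of `F₂` by `s`: above it are the leaves of the tree `s v` and the side
branches of the vertices of the path up to `v` that are attached to the same tree. -/
def grow (s : PathVert F → Tree F₂) (v : PathVert F) : Set (I ⊕ J) :=
  Sum.inr '' (s v).1 ∪ {x | ∃ u : PathVert F, u.1 ⊆ v.1 ∧ s u = s v ∧ collapse x ∈ side F u.1}

/-- The vertex of the composed forest that comes from the vertex `v` of `F`. -/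
def graftVert (s : PathVert F → Tree F₂) (v : Set (Option I)) : Set (I ⊕ J) :=
  if h : v ∈ F.verts ∧ none ∈ v then grow F F₂ s ⟨v, h⟩ else collapse ⁻¹' v

/-- The branch of the composed forest that comes from the branch `A` at the vertex `v`. -/
def graftBranch (s : PathVert F → Tree F₂) (v A : Set (Option I)) : Set (I ⊕ J) :=
  graftVert F F₂ s v ∩ collapse ⁻¹' A

variable {F F₂}

theorem side_eq {v A B : Set (Option I)} (h : IsSplit F.verts v A B) (hA : none ∈ A) :
    side F v = B := by
  ext x
  constructor
  · rintro ⟨A', B', h', hA', hx⟩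
    rcases F.split_unique h h' with ⟨rfl, rfl⟩ | ⟨rfl, rfl⟩
    · exact hx
    · exact absurd hA' (Set.disjoint_left.1 h.2.2.1 hA)
  · intro hx
    exact ⟨A, B, h, hA, hx⟩

theorem path_split (v : PathVert F) :
    ∃ A, IsSplit F.verts v.1 A (side F v.1) ∧ none ∈ A := by
  obtain ⟨A, B, h⟩ := F.binary v.1 v.2.1
  have hn : none ∈ A ∪ B := h.2.2.2 ▸ v.2.2
  rcases hn with hn | hn
  · exact ⟨A, by rw [side_eq h hn]; exact h, hn⟩
  · exact ⟨B, by rw [side_eq (Forest.split_symm h) hn]; exact Forest.split_symm h, hn⟩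

theorem none_notMem_side (v : PathVert F) : none ∉ side F v.1 := by
  obtain ⟨A, h, hA⟩ := path_split v
  exact Set.disjoint_left.1 h.2.2.1 hA

theorem side_subset (v : PathVert F) : side F v.1 ⊆ v.1 := by
  obtain ⟨A, h, hA⟩ := path_split v
  intro x hx
  rw [← h.2.2.2]
  exact Or.inr hx

theorem side_nonempty (v : PathVert F) : ∃ i, some i ∈ side F v.1 := by
  obtain ⟨A, h, hA⟩ := path_split v
  obtain ⟨x, hx⟩ := F.node_nonempty h.2.1
  rcases x with _ | i
  · exact absurd hx (none_notMem_side v)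
  · exact ⟨i, hx⟩

theorem path_total (u v : PathVert F) : u.1 ⊆ v.1 ∨ v.1 ⊆ u.1 := by
  rcases F.laminar u.1 u.2.1 v.1 v.2.1 with h | h | h
  · exact Or.inl h
  · exact Or.inr h
  · exact absurd v.2.2 (Set.disjoint_left.1 h u.2.2)

theorem path_sub_branch {u v : PathVert F} (h : u.1 ⊆ v.1) (hne : u ≠ v)
    {A B : Set (Option I)} (hs : IsSplit F.verts v.1 A B) (hA : none ∈ A) : u.1 ⊆ A := by
  rcases F.node_sub_branch hs (Or.inl u.2.1) h (fun h => hne (Subtype.ext h)) with h | h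
  · exact h
  · exact absurd (h u.2.2) (Set.disjoint_left.1 hs.2.2.1 hA)

theorem side_disjoint {u v : PathVert F} (hne : u ≠ v) :
    Disjoint (side F u.1) (side F v.1) := by
  have key : ∀ {u v : PathVert F}, u ≠ v → u.1 ⊆ v.1 →
      Disjoint (side F u.1) (side F v.1) := by
    intro u v hne h
    obtain ⟨A, hs, hA⟩ := path_split v
    exact hs.2.2.1.mono_left ((side_subset u).trans (path_sub_branch h hne hs hA))
  rcases path_total u v with h | h
  · exact key hne h
  · exact (key hne.symm h).symm

theorem sub_side_of_mem {x : Set (Option I)} (hx : x ∈ F.verts) (hn : none ∉ x)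
    (u : PathVert F) {a : Option I} (ha : a ∈ x) (hau : a ∈ side F u.1) : x ⊆ side F u.1 := by
  obtain ⟨A, hs, hA⟩ := path_split u
  have hxu : x ⊆ u.1 := by
    rcases F.laminar x hx u.1 u.2.1 with h | h | h
    · exact h
    · exact absurd (h u.2.2) hn
    · exact absurd (side_subset u hau) (Set.disjoint_left.1 h ha)
  rcases F.node_sub_branch hs (Or.inl hx) hxu (fun h => hn (h ▸ u.2.2)) with h | h
  · exact absurd hau (Set.disjoint_left.1 hs.2.2.1 (h ha))
  · exact h

theorem tree_disjoint {T T' : Tree F₂} (hne : T ≠ T') : Disjoint T.1 T'.1 := by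
  rcases F₂.node_laminar T.2.1 T'.2.1 with h | h | h
  · exact absurd (Subtype.ext (T.2.2 _ T'.2.1 h)).symm hne
  · exact absurd (Subtype.ext (T'.2.2 _ T.2.1 h)) hne
  · exact h

theorem inr_mem_grow (s : PathVert F → Tree F₂) (v : PathVert F) (j : J) :
    Sum.inr j ∈ grow F F₂ s v ↔ j ∈ (s v).1 := by
  constructor
  · rintro (⟨k, hk, h⟩ | ⟨u, -, -, h⟩)
    · cases h; exact hk
    · exact absurd h (none_notMem_side u)
  · intro h
    exact Or.inl ⟨j, h, rfl⟩

theorem inl_mem_grow (s : PathVert F → Tree F₂) (v : PathVert F) (i : I) :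
    Sum.inl i ∈ grow F F₂ s v ↔
      ∃ u : PathVert F, u.1 ⊆ v.1 ∧ s u = s v ∧ some i ∈ side F u.1 := by
  constructor
  · rintro (⟨k, hk, h⟩ | h)
    · cases h
    · exact h
  · intro h
    exact Or.inr h

theorem graftVert_path (s : PathVert F → Tree F₂) (v : PathVert F) :
    graftVert F F₂ s v.1 = grow F F₂ s v := dif_pos v.2

theorem graftVert_of_notMem (s : PathVert F → Tree F₂) {v : Set (Option I)} (hn : none ∉ v) :
    graftVert F F₂ s v = collapse ⁻¹' v := dif_neg fun h => hn h.2

theorem graftVert_subset (s : PathVert F → Tree F₂) (v : Set (Option I)) :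
    graftVert F F₂ s v ⊆ collapse ⁻¹' v := by
  by_cases h : v ∈ F.verts ∧ none ∈ v
  · rw [graftVert, dif_pos h]
    rintro (i | j) hx
    · obtain ⟨u, hu, -, hi⟩ := (inl_mem_grow s _ i).1 hx
      exact hu (side_subset u hi)
    · exact h.2
  · rw [graftVert, dif_neg h]

variable (F F₂) in
/-- The inner vertices of the composed forest. -/
def graftVerts (s : PathVert F → Tree F₂) : Finset (Set (I ⊕ J)) :=
  F.verts.image (graftVert F F₂ s) ∪ F₂.verts.image fun u => Sum.inr '' u

theorem graft_node_left (s : PathVert F → Tree F₂) {A : Set (Option I)}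
    (h : IsNode F.verts A) (hn : none ∉ A) : IsNode (graftVerts F F₂ s) (collapse ⁻¹' A) := by
  rcases h with h | ⟨x, rfl⟩
  · left
    rw [← graftVert_of_notMem s hn]
    exact Finset.mem_union_left _ (Finset.mem_image_of_mem _ h)
  · right
    rcases x with _ | i
    · exact absurd rfl hn
    · refine ⟨Sum.inl i, ?_⟩
      ext (k | k) <;> simp [collapse]

theorem graft_node_right (s : PathVert F → Tree F₂) {A : Set J} (h : IsNode F₂.verts A) :
    IsNode (graftVerts F F₂ s) (Sum.inr '' A) := by
  rcases h with h | ⟨j, rfl⟩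
  · exact Or.inl (Finset.mem_union_right _ (Finset.mem_image_of_mem _ h))
  · exact Or.inr ⟨Sum.inr j, by simp⟩

theorem graft_split_right (s : PathVert F → Tree F₂) {u A B : Set J}
    (h : IsSplit F₂.verts u A B) :
    IsSplit (graftVerts F F₂ s) (Sum.inr '' u) (Sum.inr '' A) (Sum.inr '' B) :=
  ⟨graft_node_right s h.1, graft_node_right s h.2.1,
    (Set.disjoint_image_iff Sum.inr_injective).2 h.2.2.1,
    by rw [← Set.image_union, h.2.2.2]⟩

theorem graft_node_path (s : PathVert F → Tree F₂) (v : PathVert F) {A B : Set (Option I)}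
    (h : IsSplit F.verts v.1 A B) (hA : none ∈ A) :
    IsNode (graftVerts F F₂ s) (graftBranch F F₂ s v.1 A) := by
  have hB : side F v.1 = B := side_eq h hA
  rw [graftBranch, graftVert_path]
  by_cases hP : ∃ u : PathVert F, u.1 ⊆ v.1 ∧ u ≠ v ∧ s u = s v
  · obtain ⟨u, ⟨hu1, hu2, hu3⟩, hmax⟩ := Set.Finite.exists_maximalFor
      (fun u : PathVert F => u.1) {u : PathVert F | u.1 ⊆ v.1 ∧ u ≠ v ∧ s u = s v}
      (Set.toFinite _) hP
    have huA := path_sub_branch hu1 hu2 h hA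
    have : grow F F₂ s v ∩ collapse ⁻¹' A = grow F F₂ s u := by
      ext (i | j)
      · rw [Set.mem_inter_iff, inl_mem_grow, inl_mem_grow]
        constructor
        · rintro ⟨⟨w, hw1, hw2, hw3⟩, hi⟩
          have hwv : w ≠ v := by
            rintro rfl
            rw [hB] at hw3
            exact Set.disjoint_left.1 h.2.2.1 hi hw3
          refine ⟨w, ?_, hw2.trans hu3.symm, hw3⟩
          rcases path_total w u with h' | h'
          · exact h'
          · exact hmax ⟨hw1, hwv, hw2⟩ h'
        · rintro ⟨w, hw1, hw2, hw3⟩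
          exact ⟨⟨w, hw1.trans hu1, hw2.trans hu3, hw3⟩, huA (hw1 (side_subset w hw3))⟩
      · rw [Set.mem_inter_iff, inr_mem_grow, inr_mem_grow, hu3]
        exact ⟨fun h => h.1, fun h => ⟨h, hA⟩⟩
    rw [this, ← graftVert_path]
    exact Or.inl (Finset.mem_union_left _ (Finset.mem_image_of_mem _ u.2.1))
  · have : grow F F₂ s v ∩ collapse ⁻¹' A = Sum.inr '' (s v).1 := by
      ext (i | j)
      · rw [Set.mem_inter_iff, inl_mem_grow]
        constructor
        · rintro ⟨⟨w, hw1, hw2, hw3⟩, hi⟩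
          by_cases hwv : w = v
          · subst hwv
            rw [hB] at hw3
            exact absurd hw3 (Set.disjoint_left.1 h.2.2.1 hi)
          · exact absurd ⟨w, hw1, hwv, hw2⟩ hP
        · rintro ⟨_, _, h⟩
          cases h
      · rw [Set.mem_inter_iff, inr_mem_grow]
        constructor
        · rintro ⟨h1, -⟩
          exact ⟨j, h1, rfl⟩
        · rintro ⟨k, hk, h'⟩
          cases h'
          exact ⟨hk, hA⟩
    rw [this]
    exact graft_node_right s (s v).2.1

theorem graft_split_left (s : PathVert F → Tree F₂) {v A B : Set (Option I)}
    (hv : v ∈ F.verts) (h : IsSplit F.verts v A B) :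
    IsSplit (graftVerts F F₂ s) (graftVert F F₂ s v) (graftBranch F F₂ s v A)
      (graftBranch F F₂ s v B) := by
  have key : ∀ {A B : Set (Option I)}, IsSplit F.verts v A B →
      IsNode (graftVerts F F₂ s) (graftBranch F F₂ s v A) := by
    intro A B h
    by_cases hA : none ∈ A
    · exact graft_node_path s ⟨v, hv, h.2.2.2 ▸ Or.inl hA⟩ h hA
    · have hAv : A ⊆ v := h.2.2.2 ▸ Set.subset_union_left
      have : graftBranch F F₂ s v A = collapse ⁻¹' A := by
        refine Set.inter_eq_right.2 ?_
        by_cases hn : none ∈ v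
        · have hB : none ∈ B := by
            rw [← h.2.2.2] at hn
            exact hn.resolve_left hA
          have hs : side F v = A := side_eq (Forest.split_symm h) hB
          rw [graftVert, dif_pos ⟨hv, hn⟩]
          intro x hx
          exact Or.inr ⟨⟨v, hv, hn⟩, subset_rfl, rfl, by rw [hs]; exact hx⟩
        · rw [graftVert_of_notMem s hn]
          exact Set.preimage_mono hAv
      rw [this]
      exact graft_node_left s h.1 hA
  refine ⟨key h, key (Forest.split_symm h), ?_, ?_⟩
  · exact (h.2.2.1.preimage collapse).mono Set.inter_subset_right Set.inter_subset_right
  · rw [graftBranch, graftBranch, ← Set.inter_union_distrib_left, ← Set.preimage_union,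
      h.2.2.2]
    exact Set.inter_eq_left.2 (graftVert_subset s v)

theorem graft_inl_mem (s : PathVert F → Tree F₂) {v : Set (Option I)} (hv : v ∈ F.verts) :
    ∃ i, Sum.inl i ∈ graftVert F F₂ s v := by
  by_cases hn : none ∈ v
  · obtain ⟨i, hi⟩ := side_nonempty (⟨v, hv, hn⟩ : PathVert F)
    refine ⟨i, ?_⟩
    rw [graftVert, dif_pos ⟨hv, hn⟩, inl_mem_grow]
    exact ⟨⟨v, hv, hn⟩, subset_rfl, rfl, hi⟩
  · rw [graftVert_of_notMem s hn]
    obtain ⟨x, hx⟩ := F.nonempty v hv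
    rcases x with _ | i
    · exact absurd hx hn
    · exact ⟨i, hx⟩

theorem grow_laminar (s : PathVert F → Tree F₂) (v w : PathVert F) :
    grow F F₂ s v ⊆ grow F F₂ s w ∨ grow F F₂ s w ⊆ grow F F₂ s v ∨
      Disjoint (grow F F₂ s v) (grow F F₂ s w) := by
  by_cases hs : s v = s w
  · have key : ∀ {v w : PathVert F}, s v = s w → v.1 ⊆ w.1 →
        grow F F₂ s v ⊆ grow F F₂ s w := by
      intro v w hs h
      rintro (i | j) hx
      · rw [inl_mem_grow] at hx ⊢
        obtain ⟨u, h1, h2, h3⟩ := hx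
        exact ⟨u, h1.trans h, h2.trans hs, h3⟩
      · rw [inr_mem_grow] at hx ⊢
        rwa [← hs]
    rcases path_total v w with h | h
    · exact Or.inl (key hs h)
    · exact Or.inr (Or.inl (key hs.symm h))
  · refine Or.inr (Or.inr (Set.disjoint_left.2 ?_))
    rintro (i | j) hx hy
    · rw [inl_mem_grow] at hx hy
      obtain ⟨u, -, h2, h3⟩ := hx
      obtain ⟨u', -, h2', h3'⟩ := hy
      have hne : u ≠ u' := by
        rintro rfl
        exact hs (h2.symm.trans h2')
      exact Set.disjoint_left.1 (side_disjoint hne) h3 h3'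
    · rw [inr_mem_grow] at hx hy
      exact Set.disjoint_left.1 (tree_disjoint hs) hx hy

theorem grow_laminar_left (s : PathVert F → Tree F₂) (v : PathVert F) {x : Set (Option I)}
    (hx : x ∈ F.verts) (hn : none ∉ x) :
    collapse ⁻¹' x ⊆ grow F F₂ s v ∨ Disjoint (collapse ⁻¹' x) (grow F F₂ s v) := by
  by_cases h : Disjoint (collapse ⁻¹' x) (grow F F₂ s v)
  · exact Or.inr h
  · left
    rw [Set.not_disjoint_iff] at h
    obtain ⟨i | j, hi, hg⟩ := h
    · rw [inl_mem_grow] at hg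
      obtain ⟨u, h1, h2, h3⟩ := hg
      have hsub := sub_side_of_mem hx hn u hi h3
      intro y hy
      exact Or.inr ⟨u, h1, h2, hsub hy⟩
    · exact absurd hi hn

theorem grow_laminar_right (s : PathVert F → Tree F₂) (v : PathVert F) {u : Set J}
    (hu : u ∈ F₂.verts) :
    Sum.inr '' u ⊆ grow F F₂ s v ∨ Disjoint (Sum.inr '' u) (grow F F₂ s v) := by
  rcases F₂.node_laminar (Or.inl hu) (s v).2.1 with h | h | h
  · left
    rintro _ ⟨j, hj, rfl⟩
    exact (inr_mem_grow s v j).2 (h hj)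
  · left
    rw [(s v).2.2 u (Or.inl hu) h]
    exact Set.subset_union_left
  · right
    rw [Set.disjoint_left]
    rintro _ ⟨j, hj, rfl⟩ hg
    exact Set.disjoint_left.1 h hj ((inr_mem_grow s v j).1 hg)

variable (F F₂) in
/-- The term of the composition `F ∘_⋆ F₂` given by the choice `s`. -/
def graft (s : PathVert F → Tree F₂) : Forest (I ⊕ J) where
  verts := graftVerts F F₂ s
  nonempty := by
    intro w hw
    rcases Finset.mem_union.1 hw with hw | hw
    · obtain ⟨v, hv, rfl⟩ := Finset.mem_image.1 hw
      obtain ⟨i, hi⟩ := graft_inl_mem s hv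
      exact ⟨_, hi⟩
    · obtain ⟨u, hu, rfl⟩ := Finset.mem_image.1 hw
      exact (F₂.nonempty u hu).image _
  laminar := by
    have left : ∀ v ∈ F.verts, ∀ w ∈ F.verts,
        graftVert F F₂ s v ⊆ graftVert F F₂ s w ∨ graftVert F F₂ s w ⊆ graftVert F F₂ s v ∨
          Disjoint (graftVert F F₂ s v) (graftVert F F₂ s w) := by
      intro v hv w hw
      by_cases h1 : none ∈ v <;> by_cases h2 : none ∈ w
      · have := grow_laminar s ⟨v, hv, h1⟩ ⟨w, hw, h2⟩
        rwa [← graftVert_path, ← graftVert_path] at this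
      · have := grow_laminar_left s ⟨v, hv, h1⟩ hw h2
        rw [← graftVert_path, ← graftVert_of_notMem s h2, disjoint_comm] at this
        exact Or.inr this
      · have := grow_laminar_left s ⟨w, hw, h2⟩ hv h1
        rw [← graftVert_path, ← graftVert_of_notMem s h1] at this
        tauto
      · rw [graftVert_of_notMem s h1, graftVert_of_notMem s h2]
        rcases F.laminar v hv w hw with h | h | h
        · exact Or.inl (Set.preimage_mono h)
        · exact Or.inr (Or.inl (Set.preimage_mono h))
        · exact Or.inr (Or.inr (h.preimage _))
    have mixed : ∀ v ∈ F.verts, ∀ u ∈ F₂.verts,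
        Sum.inr '' u ⊆ graftVert F F₂ s v ∨ Disjoint (Sum.inr '' u) (graftVert F F₂ s v) := by
      intro v hv u hu
      by_cases h1 : none ∈ v
      · have := grow_laminar_right s ⟨v, hv, h1⟩ hu
        rwa [← graftVert_path] at this
      · right
        rw [graftVert_of_notMem s h1, Set.disjoint_left]
        rintro _ ⟨j, hj, rfl⟩ h
        exact h1 h
    intro a ha b hb
    rcases Finset.mem_union.1 ha with ha | ha <;> rcases Finset.mem_union.1 hb with hb | hb <;>
      obtain ⟨v, hv, rfl⟩ := Finset.mem_image.1 ha <;>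
      obtain ⟨w, hw, rfl⟩ := Finset.mem_image.1 hb
    · exact left v hv w hw
    · have := mixed v hv w hw
      rw [disjoint_comm] at this
      exact Or.inr this
    · have := mixed w hw v hv
      tauto
    · rw [Set.image_subset_image_iff Sum.inr_injective,
        Set.image_subset_image_iff Sum.inr_injective, Set.disjoint_image_iff Sum.inr_injective]
      exact F₂.laminar v hv w hw
  binary := by
    intro w hw
    rcases Finset.mem_union.1 hw with hw | hw
    · obtain ⟨v, hv, rfl⟩ := Finset.mem_image.1 hw
      obtain ⟨A, B, h⟩ := F.binary v hv
      exact ⟨_, _, graft_split_left s hv h⟩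
    · obtain ⟨u, hu, rfl⟩ := Finset.mem_image.1 hw
      obtain ⟨A, B, h⟩ := F₂.binary u hu
      exact ⟨_, _, graft_split_right s h⟩

theorem graftVert_injOn (s : PathVert F → Tree F₂) :
    Set.InjOn (graftVert F F₂ s) (F.verts : Set (Set (Option I))) := by
  have key : ∀ v w : PathVert F, v.1 ⊆ w.1 → grow F F₂ s v = grow F F₂ s w → v = w := by
    intro v w hvw h
    by_contra hne
    obtain ⟨i, hi⟩ := side_nonempty w
    have : Sum.inl i ∈ grow F F₂ s v := by
      rw [h, inl_mem_grow]
      exact ⟨w, subset_rfl, rfl, hi⟩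
    obtain ⟨u, h1, -, h3⟩ := (inl_mem_grow s v i).1 this
    have huw : u ≠ w := by
      rintro rfl
      exact hne (Subtype.ext (Set.Subset.antisymm hvw h1))
    exact Set.disjoint_left.1 (side_disjoint huw) h3 hi
  have mixed : ∀ (v : PathVert F) (w : Set (Option I)), none ∉ w →
      grow F F₂ s v ≠ collapse ⁻¹' w := by
    intro v w hw h
    obtain ⟨j, hj⟩ := F₂.node_nonempty (s v).2.1
    have : Sum.inr j ∈ grow F F₂ s v := (inr_mem_grow s v j).2 hj
    rw [h] at this
    exact hw this
  intro v hv w hw h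
  by_cases h1 : none ∈ v <;> by_cases h2 : none ∈ w
  · have h' : grow F F₂ s ⟨v, hv, h1⟩ = grow F F₂ s ⟨w, hw, h2⟩ := by
      rwa [← graftVert_path, ← graftVert_path]
    rcases path_total (⟨v, hv, h1⟩ : PathVert F) ⟨w, hw, h2⟩ with h3 | h3
    · exact congrArg Subtype.val (key _ _ h3 h')
    · exact (congrArg Subtype.val (key _ _ h3 h'.symm)).symm
  · rw [graftVert_of_notMem s h2] at h
    exact absurd ((graftVert_path s ⟨v, hv, h1⟩).symm.trans h) (mixed _ w h2)
  · rw [graftVert_of_notMem s h1] at h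
    exact absurd ((graftVert_path s ⟨w, hw, h2⟩).symm.trans h.symm) (mixed _ v h1)
  · rw [graftVert_of_notMem s h1, graftVert_of_notMem s h2] at h
    ext (_ | i)
    · exact ⟨fun h => absurd h h1, fun h => absurd h h2⟩
    · exact Set.ext_iff.1 h (Sum.inl i)

theorem graftVert_ne (s : PathVert F → Tree F₂) {v : Set (Option I)} (hv : v ∈ F.verts)
    (u : Set J) : graftVert F F₂ s v ≠ Sum.inr '' u := by
  intro h
  obtain ⟨i, hi⟩ := graft_inl_mem s hv
  rw [h] at hi
  obtain ⟨_, _, h'⟩ := hi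
  cases h'

/-- The number of factors before `R`. -/
def beforeR {α : Type*} (l : List (Option α)) : ℕ := (l.takeWhile Option.isSome).length

/-- The word with the factor `R` removed. -/
def eraseR {α : Type*} (l : List (Option α)) : List (Option α) := l.filter Option.isSome

/-- The global orientation `o₁ ∧ r ∧ o₂` modulo `R₁ ∧ r ∧ R₂ = R`, up to the sign
`(-1) ^ k` where `k` is the number of factors of `o₂` before `R₂`. -/
def graftGlob (s : PathVert F → Tree F₂) (o₁ : GlobalOrientation F.verts)
    (o₂ : GlobalOrientation F₂.verts) : GlobalOrientation (graft F F₂ s).verts where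
  word := o₁.word.map (Option.map (graftVert F F₂ s)) ++
    (eraseR o₂.word).map (Option.map fun u => Sum.inr '' u)
  nodup := by
    refine List.Nodup.append
      (o₁.map (graftVert F F₂ s) (graftVert_injOn s) rfl).nodup
      ((o₂.map (fun u => Sum.inr '' u) Sum.inr_injective.image_injective.injOn rfl).nodup.sublist
        (List.filter_sublist.map _)) ?_
    intro x hx hy
    rw [List.mem_map] at hx hy
    obtain ⟨a, ha, rfl⟩ := hx
    obtain ⟨b, hb, hab⟩ := hy
    rw [eraseR, List.mem_filter] at hb
    rcases (o₂.mem_iff b).1 hb.1 with rfl | ⟨u, hu, rfl⟩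
    · simp at hb
    · rcases (o₁.mem_iff a).1 ha with rfl | ⟨v, hv, rfl⟩
      · simp at hab
      · simp only [Option.map_some, Option.some.injEq] at hab
        exact graftVert_ne s hv u hab.symm
  mem_iff := by
    intro x
    rw [List.mem_append, List.mem_map, List.mem_map]
    constructor
    · rintro (⟨a, ha, rfl⟩ | ⟨b, hb, rfl⟩)
      · rcases (o₁.mem_iff a).1 ha with rfl | ⟨v, hv, rfl⟩
        · exact Or.inl rfl
        · exact Or.inr ⟨_, Finset.mem_union_left _ (Finset.mem_image_of_mem _ hv), rfl⟩
      · rcases (o₂.mem_iff b).1 (List.mem_filter.1 hb).1 with rfl | ⟨u, hu, rfl⟩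
        · exact Or.inl rfl
        · exact Or.inr ⟨_, Finset.mem_union_right _ (Finset.mem_image_of_mem _ hu), rfl⟩
    · rintro (rfl | ⟨w, hw, rfl⟩)
      · exact Or.inl ⟨none, (o₁.mem_iff _).2 (Or.inl rfl), rfl⟩
      · rcases Finset.mem_union.1 hw with hw | hw
        · obtain ⟨v, hv, rfl⟩ := Finset.mem_image.1 hw
          exact Or.inl ⟨some v, (o₁.mem_iff _).2 (Or.inr ⟨v, hv, rfl⟩), rfl⟩
        · obtain ⟨u, hu, rfl⟩ := Finset.mem_image.1 hw
          refine Or.inr ⟨some u, ?_, rfl⟩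
          rw [eraseR, List.mem_filter]
          exact ⟨(o₂.mem_iff _).2 (Or.inr ⟨u, hu, rfl⟩), rfl⟩

/-- The local orientations of the composed forest are those of the two forests; for each vertex
one of the two words below is empty. -/
def graftLoc (s : PathVert F → Tree F₂) (l₁ : Set (Option I) → List (Option (Set (Option I))))
    (l₂ : Set J → List (Option (Set J))) (w : Set (I ⊕ J)) : List (Option (Set (I ⊕ J))) :=
  pushLoc (graftVert F F₂ s) (graftBranch F F₂ s) F.verts l₁ w ++
    pushLoc (fun u => Sum.inr '' u) (fun _ A => Sum.inr '' A) F₂.verts l₂ w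

theorem graftLoc_left (s : PathVert F → Tree F₂)
    (l₁ : Set (Option I) → List (Option (Set (Option I))))
    (l₂ : Set J → List (Option (Set J))) {v : Set (Option I)} (hv : v ∈ F.verts) :
    graftLoc s l₁ l₂ (graftVert F F₂ s v) =
      (l₁ v).map (Option.map (graftBranch F F₂ s v)) := by
  rw [graftLoc, pushLoc_apply (graftVert_injOn s) hv,
    pushLoc_off fun u _ h => graftVert_ne s hv u h.symm, List.append_nil]

theorem graftLoc_right (s : PathVert F → Tree F₂)
    (l₁ : Set (Option I) → List (Option (Set (Option I))))
    (l₂ : Set J → List (Option (Set J))) {u : Set J} (hu : u ∈ F₂.verts) :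
    graftLoc (F := F) (F₂ := F₂) s l₁ l₂ (Sum.inr '' u) =
      (l₂ u).map (Option.map fun A => Sum.inr '' A) := by
  rw [graftLoc, pushLoc_off fun v hv h => graftVert_ne s hv u h,
    pushLoc_apply (φ := fun u : Set J => (Sum.inr '' u : Set (I ⊕ J)))
      Sum.inr_injective.image_injective.injOn hu, List.nil_append]

/-- The term of the composition of two inner-oriented forests given by the choice `s`
(up to the sign of `graftGlob`). -/
def graftInner (x : InnerForest (Option I)) (y : InnerForest J)
    (s : PathVert x.forest → Tree y.forest) : InnerForest (I ⊕ J) where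
  forest := graft x.forest y.forest s
  glob := graftGlob s x.glob y.glob
  loc := graftLoc s x.loc y.loc
  loc_nodup := by
    intro w hw
    rcases Finset.mem_union.1 hw with hw | hw
    · obtain ⟨v, hv, rfl⟩ := Finset.mem_image.1 hw
      rw [graftLoc_left s _ _ hv]
      exact (pushLoc_valid x.forest (graft x.forest y.forest s) hv
        (fun A B h => graft_split_left s hv h) (x.loc_nodup v hv) (x.loc_mem v hv)).1
    · obtain ⟨u, hu, rfl⟩ := Finset.mem_image.1 hw
      rw [graftLoc_right s _ _ hu]
      exact (pushLoc_valid y.forest (graft x.forest y.forest s) hu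
        (fun A B h => graft_split_right s h) (y.loc_nodup u hu) (y.loc_mem u hu)).1
  loc_mem := by
    intro w hw
    rcases Finset.mem_union.1 hw with hw | hw
    · obtain ⟨v, hv, rfl⟩ := Finset.mem_image.1 hw
      rw [graftLoc_left s _ _ hv]
      exact (pushLoc_valid x.forest (graft x.forest y.forest s) hv
        (fun A B h => graft_split_left s hv h) (x.loc_nodup v hv) (x.loc_mem v hv)).2
    · obtain ⟨u, hu, rfl⟩ := Finset.mem_image.1 hw
      rw [graftLoc_right s _ _ hu]
      exact (pushLoc_valid y.forest (graft x.forest y.forest s) hu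
        (fun A B h => graft_split_right s h) (y.loc_nodup u hu) (y.loc_mem u hu)).2
  loc_off := by
    intro w hw
    rw [graftLoc, pushLoc_off, pushLoc_off, List.append_nil]
    · intro u hu h
      exact hw (Finset.mem_union_right _ (h ▸ Finset.mem_image_of_mem _ hu))
    · intro v hv h
      exact hw (Finset.mem_union_left _ (h ▸ Finset.mem_image_of_mem _ hv))

end Graft

section Comp

theorem swap_erase {α : Type*} {l l' : List (Option α)} (h : AdjSwap l l') (hn : l.Nodup) :
    ((-1 : ℚ) ^ beforeR l = -(-1) ^ beforeR l' ∧ eraseR l = eraseR l') ∨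
      (beforeR l = beforeR l' ∧ AdjSwap (eraseR l) (eraseR l')) := by
  obtain ⟨a, x, y, b, rfl, rfl⟩ := h
  rw [List.nodup_append] at hn
  have h1 : ∀ c c' : List (Option α), none ∈ a → beforeR (a ++ c) = beforeR (a ++ c') := by
    intro c c' ha
    unfold beforeR
    rw [List.takeWhile_append, List.takeWhile_append, if_neg, if_neg] <;>
    · intro hl
      have := (List.takeWhile_prefix (p := Option.isSome) (l := a)).eq_of_length hl
      have := List.takeWhile_eq_self_iff.1 this none ha
      simp at this
  have h2 : ∀ c : List (Option α), none ∉ a → beforeR (a ++ c) = a.length + beforeR c := by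
    intro c ha
    unfold beforeR
    rw [List.takeWhile_append_of_pos, List.length_append]
    rintro (_ | z) hz
    · exact absurd hz ha
    · rfl
  rcases x with _ | x <;> rcases y with _ | y
  · simp at hn
  · left
    have ha : none ∉ a := fun ha => hn.2.2 none ha none (by simp) rfl
    rw [h2 _ ha, h2 _ ha]
    simp [beforeR, eraseR, pow_add]
  · left
    have ha : none ∉ a := fun ha => hn.2.2 none ha none (by simp) rfl
    rw [h2 _ ha, h2 _ ha]
    simp [beforeR, eraseR, pow_add]
  · right
    refine ⟨?_, eraseR a, some x, some y, eraseR b, by simp [eraseR], by simp [eraseR]⟩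
    by_cases ha : none ∈ a
    · exact h1 _ _ ha
    · rw [h2 _ ha, h2 _ ha]
      simp [beforeR]

variable {I J : Type u}

theorem graftInner_flip_left {x x' : InnerForest (Option I)} (h : Flip x x')
    (y : InnerForest J) [Finite J] :
    (∑ s : PathVert x.forest → Tree y.forest, Bess.of (graftInner x y s)) +
      ∑ s : PathVert x'.forest → Tree y.forest, Bess.of (graftInner x' y s) = 0 := by
  obtain ⟨F, g, l, h1, h2, h3⟩ := x
  obtain ⟨F', g', l', h1', h2', h3'⟩ := x'
  have h0 := @flip_vertex_mem _ ⟨F, g, l, h1, h2, h3⟩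
  obtain ⟨hF, h⟩ := h
  simp only at hF h h0 ⊢
  subst hF
  rw [← Finset.sum_add_distrib]
  refine Finset.sum_eq_zero fun s _ => Bess.of_flip ⟨rfl, ?_⟩
  rcases h with ⟨ha, rfl⟩ | ⟨ha, v, hb, hc⟩
  · left
    obtain ⟨a, p, q, b, e1, e2⟩ := ha.map (Option.map (graftVert F y.forest s))
    refine ⟨⟨a, p, q, b ++ (eraseR y.glob.word).map (Option.map fun u => Sum.inr '' u),
      ?_, ?_⟩, rfl⟩
    · simp only [graftInner, graftGlob, e1]; simp
    · simp only [graftInner, graftGlob, e2]; simp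
  · right
    refine ⟨by simp only [graftInner, graftGlob, ha], graftVert F y.forest s v, ?_⟩
    have hv : v ∈ F.verts := h0 hb
    constructor
    · simp only [graftInner]
      rw [graftLoc_left s _ _ hv, graftLoc_left s _ _ hv]
      exact hb.map _
    · intro w hw
      simp only [graftInner, graftLoc]
      rw [(pushLoc_flip (η := graftBranch F y.forest s) (graftVert_injOn s) hv hb hc).2 w hw]

theorem graftInner_flip_right [Finite J] (x : InnerForest (Option I)) {y y' : InnerForest J}
    (h : Flip y y') :
    (-1 : ℚ) ^ beforeR y.glob.word •
        (∑ s : PathVert x.forest → Tree y.forest, Bess.of (graftInner x y s)) +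
      (-1 : ℚ) ^ beforeR y'.glob.word •
        ∑ s : PathVert x.forest → Tree y'.forest, Bess.of (graftInner x y' s) = 0 := by
  obtain ⟨F, g, l, h1, h2, h3⟩ := y
  obtain ⟨F', g', l', h1', h2', h3'⟩ := y'
  have h0 := @flip_vertex_mem _ ⟨F, g, l, h1, h2, h3⟩
  obtain ⟨hF, h⟩ := h
  simp only at hF h h0 ⊢
  subst hF
  have inj : Set.InjOn (fun u : Set J => (Sum.inr '' u : Set (I ⊕ J))) (F.verts : Set (Set J)) :=
    Sum.inr_injective.image_injective.injOn
  rw [Finset.smul_sum, Finset.smul_sum, ← Finset.sum_add_distrib]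
  refine Finset.sum_eq_zero fun s _ => ?_
  rcases h with ⟨ha, rfl⟩ | ⟨ha, v, hb, hc⟩
  · rcases swap_erase ha g.nodup with ⟨e1, e2⟩ | ⟨e1, e2⟩
    · have : graftInner x ⟨F, g, l, h1, h2, h3⟩ s = graftInner x ⟨F, g', l, h1', h2', h3'⟩ s := by
        simp only [graftInner, graftGlob, e2]
      rw [e1, this, neg_smul, neg_add_cancel]
    · rw [e1, ← smul_add, Bess.of_flip, smul_zero]
      refine ⟨rfl, Or.inl ⟨?_, rfl⟩⟩
      obtain ⟨a, p, q, b, e3, e4⟩ :=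
        e2.map (Option.map fun u : Set J => (Sum.inr '' u : Set (I ⊕ J)))
      refine ⟨x.glob.word.map (Option.map (graftVert x.forest F s)) ++ a, p, q, b, ?_, ?_⟩
      · simp only [graftInner, graftGlob, e3]; simp
      · simp only [graftInner, graftGlob, e4]; simp
  · rw [ha, ← smul_add, Bess.of_flip, smul_zero]
    refine ⟨rfl, Or.inr ⟨by simp only [graftInner, graftGlob, ha], Sum.inr '' v, ?_⟩⟩
    have hv : v ∈ F.verts := h0 hb
    constructor
    · simp only [graftInner]
      rw [graftLoc_right s _ _ hv, graftLoc_right s _ _ hv]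
      exact hb.map _
    · intro w hw
      simp only [graftInner, graftLoc]
      rw [(pushLoc_flip (η := fun _ A => Sum.inr '' A) inj hv hb hc).2 w hw]

/-- The partial composition `x ∘_⋆ y` of the operad `Bess`.  On inner-oriented forests it is
the sum over all choices `s` of `(o₁ ∧ r ∧ o₂ modulo R₁ ∧ r ∧ R₂ = R) ⊗ graft F₁ F₂ s`, the
local orientations being unchanged. -/
def Bess.comp (I J : Type u) [Finite J] : Bess (Option I) →ₗ[ℚ] Bess J →ₗ[ℚ] Bess (I ⊕ J) :=
  Bess.lift (fun x => Bess.lift (fun y => (-1 : ℚ) ^ beforeR y.glob.word •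
      ∑ s : PathVert x.forest → Tree y.forest, Bess.of (graftInner x y s))
      fun _ _ h => graftInner_flip_right x h) <| by
    intro x x' h
    refine Submodule.linearMap_qext _ (Finsupp.lhom_ext' fun y => LinearMap.ext_ring ?_)
    simp only [LinearMap.comp_apply, LinearMap.add_apply, LinearMap.zero_apply,
      Finsupp.lsingle_apply]
    rw [← Bess.of, Bess.lift_of, Bess.lift_of, ← smul_add, graftInner_flip_left h y, smul_zero]

/-- The partial composition of the operad `Bess ⊗ Bess`:
`(x ⊗ x') ∘_⋆ (y ⊗ y') = (-1) ^ (deg x' * deg y) (x ∘_⋆ y) ⊗ (x' ∘_⋆ y')`. -/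
def tensorComp (I J : Type u) [Finite J] (X : Bess (Option I) ⊗[ℚ] Bess (Option I))
    (Y : Bess J ⊗[ℚ] Bess J) : Bess (I ⊕ J) ⊗[ℚ] Bess (I ⊕ J) :=
  TensorProduct.map₂ (Bess.comp I J) (Bess.comp I J) X Y -
    (2 : ℚ) • TensorProduct.map₂ (Bess.comp I J) (Bess.comp I J)
      (TensorProduct.map LinearMap.id (Bess.oddPart (Option I)) X)
      (TensorProduct.map (Bess.oddPart J) LinearMap.id Y)

end Comp

/-! ## Generators and coproduct -/

section Generators

/-- The inner-oriented forest `R ⊗ F` where `F` has no inner vertex. -/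
def discreteInner (I : Type u) : InnerForest I where
  forest := Forest.discrete I
  glob := ⟨[none], by simp, by simp [Forest.discrete]⟩
  loc := fun _ => []
  loc_nodup := by simp
  loc_mem := by simp [Forest.discrete]
  loc_off := by simp

/-- The element `R ⊗ F` where `F` has no inner vertex.  It is the unit of the operad if `I` has
one element, and the generator `E_{i,j}` if `I = {i, j}` has two elements. -/
def Bess.discrete (I : Type u) : Bess I := Bess.of (discreteInner I)

variable {I : Type u}

/-- The tree with one inner vertex on `I = {i, j}`. -/
def cherry (i j : I) (hij : i ≠ j) : Forest I where
  verts := {{i, j}}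
  nonempty := by simp
  laminar := by simp
  binary := by
    intro v hv
    rw [Finset.mem_singleton] at hv
    subst hv
    exact ⟨{i}, {j}, Or.inr ⟨i, rfl⟩, Or.inr ⟨j, rfl⟩, by simpa using hij,
      Set.singleton_union⟩

theorem cherry_split (i j : I) (hij : i ≠ j) :
    IsSplit (cherry i j hij).verts {i, j} {i} {j} :=
  ⟨Or.inr ⟨i, rfl⟩, Or.inr ⟨j, rfl⟩, by simpa using hij, Set.singleton_union⟩

/-- The inner-oriented tree with one inner vertex `v` on `{i, j}`, with global orientation
`R ∧ v` and local orientation `root ∧ i ∧ j`. -/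
def cherryInner (i j : I) (hij : i ≠ j) : InnerForest I where
  forest := cherry i j hij
  glob := ⟨[none, some {i, j}], by simp, by simp [cherry]⟩
  loc := fun v => if v = {i, j} then [none, some {i}, some {j}] else []
  loc_nodup := by
    intro v hv
    rw [if_pos (Finset.mem_singleton.1 hv)]
    simpa using hij
  loc_mem := by
    intro v hv h
    rw [Finset.mem_singleton.1 hv, if_pos rfl]
    constructor
    · intro hh
      simp only [List.mem_cons, List.not_mem_nil, or_false] at hh
      rcases hh with rfl | rfl | rfl
      · exact Or.inl rfl
      · exact Or.inr ⟨_, _, cherry_split i j hij, rfl⟩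
      · exact Or.inr ⟨_, _, Forest.split_symm (cherry_split i j hij), rfl⟩
    · rintro (rfl | ⟨A, B, hs, rfl⟩)
      · simp
      · rcases (cherry i j hij).split_unique (cherry_split i j hij) hs with ⟨rfl, -⟩ | ⟨rfl, -⟩ <;>
          simp
  loc_off := by
    intro v hv
    exact if_neg fun h => hv (Finset.mem_singleton.2 h)

/-- The generator `Ω_{i,j}`. -/
def Bess.omega (i j : I) (hij : i ≠ j) : Bess I := Bess.of (cherryInner i j hij)

/-- `Δ` is a morphism of operads from `Bess` to `Bess ⊗ Bess` with
`Δ E_{i,j} = E_{i,j} ⊗ E_{i,j}` and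
`Δ Ω_{i,j} = E_{i,j} ⊗ Ω_{i,j} + Ω_{i,j} ⊗ E_{i,j}`. -/
structure IsCoproduct
    (Δ : ∀ (I : Type u) [Finite I] [Nonempty I], Bess I →ₗ[ℚ] Bess I ⊗[ℚ] Bess I) : Prop where
  relabel : ∀ (I K : Type u) [Finite I] [Nonempty I] [Finite K] [Nonempty K] (e : I ≃ K)
    (x : Bess I), Δ K (Bess.relabel e x) =
      TensorProduct.map (Bess.relabel e) (Bess.relabel e) (Δ I x)
  unit : ∀ (I : Type u) [Finite I] [Nonempty I], Nat.card I = 1 →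
    Δ I (Bess.discrete I) = Bess.discrete I ⊗ₜ Bess.discrete I
  comp : ∀ (I J : Type u) [Finite I] [Finite J] [Nonempty J] (x : Bess (Option I)) (y : Bess J),
    Δ (I ⊕ J) (Bess.comp I J x y) = tensorComp I J (Δ (Option I) x) (Δ J y)
  gen_E : ∀ (I : Type u) [Finite I] [Nonempty I], Nat.card I = 2 →
    Δ I (Bess.discrete I) = Bess.discrete I ⊗ₜ Bess.discrete I
  gen_omega : ∀ (I : Type u) [Finite I] [Nonempty I], Nat.card I = 2 → ∀ (i j : I) (hij : i ≠ j),
    Δ I (Bess.omega i j hij) =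
      Bess.discrete I ⊗ₜ Bess.omega i j hij + Bess.omega i j hij ⊗ₜ Bess.discrete I

end Generators

/-! ## The poset of forests and the sums `γ(F, V)` -/

section Gamma

variable {I : Type u}

/-- A map of forests `F' → F` which is increasing towards the root, the identity on leaves,
and maps inner vertices to inner vertices injectively, the two incoming half-edges at a vertex
going to the two distinct incoming half-edges at its image.  It is given by the images of the
inner vertices.  The leaf `i` lies above `v` if and only if `i ∈ v`, and `v` lies (weakly) above
`w` if and only if `v ⊆ w`. -/
@[ext]
structure Forest.Hom (F' F : Forest I) where
  toFun : F'.verts → F.verts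
  injective : Function.Injective toFun
  increasing : ∀ v w : F'.verts, (v : Set I) ⊆ w → (toFun v : Set I) ⊆ toFun w
  leaves : ∀ (v : F'.verts) (i : I), i ∈ (v : Set I) → i ∈ (toFun v : Set I)
  branches : ∀ (v : F'.verts) (A' B' : Set I), IsSplit F'.verts v A' B' →
    ∃ A B, IsSplit F.verts (toFun v) A B ∧ A' ⊆ A ∧ B' ⊆ B

/-- The order on forests. -/
instance : LE (Forest I) := ⟨fun F' F => Nonempty (Forest.Hom F' F)⟩

variable {F : Forest I}

/-- The image of `v` is the vertex of `F` where the leaves above `v` meet. -/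
theorem Forest.Hom.least {F' : Forest I} (f : Forest.Hom F' F) (v : F'.verts) {w : Set I}
    (hw : w ∈ F.verts) (h : (v : Set I) ⊆ w) : (f.toFun v : Set I) ⊆ w := by
  obtain ⟨A', B', hs'⟩ := F'.binary v v.2
  obtain ⟨A, B, hs, hA, hB⟩ := f.branches v A' B' hs'
  obtain ⟨a, ha⟩ := F'.node_nonempty hs'.1
  obtain ⟨b, hb⟩ := F'.node_nonempty hs'.2.1
  have hav : a ∈ w := h (hs'.2.2.2 ▸ Or.inl ha)
  have hbv : b ∈ w := h (hs'.2.2.2 ▸ Or.inr hb)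
  rcases F.laminar _ (f.toFun v).2 w hw with h1 | h1 | h1
  · exact h1
  · by_cases he : w = (f.toFun v : Set I)
    · exact he.symm.subset
    · rcases F.node_sub_branch hs (Or.inl hw) h1 he with h2 | h2
      · exact absurd (hB hb) (Set.disjoint_left.1 hs.2.2.1 (h2 hbv))
      · exact absurd (h2 hav) (Set.disjoint_left.1 hs.2.2.1 (hA ha))
  · exact absurd hav (Set.disjoint_left.1 h1 (hs.2.2.2 ▸ Or.inl (hA ha)))

/-- There is at most one such map between two given forests. -/
instance (F' : Forest I) : Subsingleton (Forest.Hom F' F) :=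
  ⟨fun f g => Forest.Hom.ext <| funext fun v => Subtype.ext <| Set.Subset.antisymm
    (f.least v (g.toFun v).2 fun i => g.leaves v i)
    (g.least v (f.toFun v).2 fun i => f.leaves v i)⟩

/-- The set `γ(F, V)` of forests `F' ≤ F` whose inner vertices are identified with the elements
of `V`. -/
structure Gamma (F : Forest I) (V : Finset (Set I)) where
  forest : Forest I
  hom : Forest.Hom forest F
  range : ∀ v, v ∈ V ↔ ∃ w, (hom.toFun w : Set I) = v

theorem Gamma.forest_injective (V : Finset (Set I)) :
    Function.Injective (Gamma.forest : Gamma F V → Forest I) := by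
  rintro ⟨F₁, f, _⟩ ⟨F₂, g, _⟩ h
  simp only at h
  subst h
  congr
  exact Subsingleton.elim _ _

instance [Finite I] (V : Finset (Set I)) : Fintype (Gamma F V) :=
  have : Finite (Gamma F V) := Finite.of_injective _ (Gamma.forest_injective V)
  Fintype.ofFinite _

/-- The inner vertex of `F' ∈ γ(F, V)` identified with `v ∈ V`. -/
def Gamma.vert {V : Finset (Set I)} (p : Gamma F V) (v : Set I) : Set I :=
  if h : ∃ w, (p.hom.toFun w : Set I) = v then (h.choose : Set I) else ∅

variable {V : Finset (Set I)} (p : Gamma F V)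

theorem Gamma.vert_hom (w : p.forest.verts) : p.vert (p.hom.toFun w) = w := by
  have h : ∃ w', (p.hom.toFun w' : Set I) = p.hom.toFun w := ⟨w, rfl⟩
  rw [Gamma.vert, dif_pos h]
  exact congrArg Subtype.val (p.hom.injective (Subtype.ext h.choose_spec))

theorem Gamma.subset (p : Gamma F V) : V ⊆ F.verts := by
  intro v hv
  obtain ⟨w, rfl⟩ := (p.range v).1 hv
  exact (p.hom.toFun w).2

theorem Gamma.vert_injOn : Set.InjOn p.vert (V : Set (Set I)) := by
  intro v hv v' hv' h
  obtain ⟨w, rfl⟩ := (p.range v).1 hv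
  obtain ⟨w', rfl⟩ := (p.range v').1 hv'
  rw [p.vert_hom, p.vert_hom] at h
  rw [Subtype.ext h]

theorem Gamma.verts_eq : p.forest.verts = V.image p.vert := by
  ext w
  rw [Finset.mem_image]
  constructor
  · intro hw
    exact ⟨_, (p.range _).2 ⟨⟨w, hw⟩, rfl⟩, p.vert_hom ⟨w, hw⟩⟩
  · rintro ⟨v, hv, rfl⟩
    obtain ⟨w, rfl⟩ := (p.range v).1 hv
    rw [p.vert_hom]
    exact w.2

theorem Gamma.split {v A B : Set I} (hv : v ∈ V) (h : IsSplit F.verts v A B) :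
    IsSplit p.forest.verts (p.vert v) (A ∩ p.vert v) (B ∩ p.vert v) := by
  obtain ⟨w, rfl⟩ := (p.range v).1 hv
  rw [p.vert_hom]
  have key : ∀ {A B A' B' : Set I}, Disjoint A B → A' ∪ B' = (w : Set I) → A' ⊆ A → B' ⊆ B →
      A ∩ (w : Set I) = A' := by
    intro A B A' B' hd hu hA hB
    rw [← hu]
    ext x
    constructor
    · rintro ⟨h1, h2 | h2⟩
      · exact h2
      · exact absurd (hB h2) (Set.disjoint_left.1 hd h1)
    · intro h
      exact ⟨hA h, Or.inl h⟩
  obtain ⟨A', B', hs'⟩ := p.forest.binary w w.2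
  obtain ⟨A₀, B₀, hs, hA, hB⟩ := p.hom.branches w A' B' hs'
  have e1 : A₀ ∩ (w : Set I) = A' := key hs.2.2.1 hs'.2.2.2 hA hB
  have e2 : B₀ ∩ (w : Set I) = B' :=
    key hs.2.2.1.symm (by rw [Set.union_comm]; exact hs'.2.2.2) hB hA
  rcases F.split_unique hs h with ⟨rfl, rfl⟩ | ⟨rfl, rfl⟩
  · rw [e1, e2]
    exact hs'
  · rw [e1, e2]
    exact Forest.split_symm hs'

end Gamma

section Formula

variable {I : Type u}

/-- The inner-oriented forest `o' ⊗ F'` for `F' ∈ γ(F, V)`, where `o'` is an orientation of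
`V ⊔ {R'}` and the local orientations are those of `x = o ⊗ F`: the vertex `v ∈ V` becomes a
vertex of `F'`, and the half-edge of `F` at `v` coming from the branch `A` becomes the half-edge
of `F'` coming from the branch that is contained in `A`. -/
def gammaInner (x : InnerForest I) {V : Finset (Set I)} (o' : GlobalOrientation V)
    (p : Gamma x.forest V) : InnerForest I where
  forest := p.forest
  glob := o'.map p.vert p.vert_injOn p.verts_eq
  loc := pushLoc p.vert (fun v A => A ∩ p.vert v) V x.loc
  loc_nodup := by
    intro w hw
    rw [p.verts_eq] at hw
    obtain ⟨v, hv, rfl⟩ := Finset.mem_image.1 hw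
    rw [pushLoc_apply p.vert_injOn hv]
    exact (pushLoc_valid x.forest p.forest (p.subset hv) (fun A B h => p.split hv h)
      (x.loc_nodup v (p.subset hv)) (x.loc_mem v (p.subset hv))).1
  loc_mem := by
    intro w hw
    rw [p.verts_eq] at hw
    obtain ⟨v, hv, rfl⟩ := Finset.mem_image.1 hw
    rw [pushLoc_apply p.vert_injOn hv]
    exact (pushLoc_valid x.forest p.forest (p.subset hv) (fun A B h => p.split hv h)
      (x.loc_nodup v (p.subset hv)) (x.loc_mem v (p.subset hv))).2
  loc_off := by
    intro w hw
    refine pushLoc_off fun v hv h => hw ?_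
    rw [p.verts_eq, ← h]
    exact Finset.mem_image_of_mem _ hv

/-- The element `o' ⊗ γ(F, V)` of `Bess(I)`. -/
def gammaSum [Finite I] (x : InnerForest I) {V : Finset (Set I)} (o' : GlobalOrientation V) :
    Bess I :=
  ∑ p : Gamma x.forest V, Bess.of (gammaInner x o' p)

/-- The exterior product of the letters of a word. -/
def wedge {α : Type u} (l : List α) : ExteriorAlgebra ℚ (α →₀ ℚ) :=
  (l.map fun a => ExteriorAlgebra.ι ℚ (Finsupp.single a (1 : ℚ))).prod

/-- The auxiliary letters `R'`, `r`, `R''` next to the inner vertices. -/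
inductive Letter (I : Type u) : Type u
  | vert (v : Set I)
  | R'
  | r
  | R''

/-- `o' ∧ r ∧ o'' = o` modulo `R' ∧ r ∧ R'' = R`. -/
def Compatible {V V' V'' : Finset (Set I)} (o' : GlobalOrientation V')
    (o'' : GlobalOrientation V'') (o : GlobalOrientation V) : Prop :=
  wedge (o'.word.map (fun a => a.elim Letter.R' Letter.vert) ++ [Letter.r] ++
      o''.word.map (fun a => a.elim Letter.R'' Letter.vert)) =
    wedge (o.word.flatMap fun a =>
      a.elim [Letter.R', Letter.r, Letter.R''] fun v => [Letter.vert v])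

end Formula

end Bessel

end

/-!
Define `Δ` by the formula. Every forest arises from the forest without inner vertex by repeatedly
joining two trees at a new root, so `Bess I` is generated from that forest by the operators which
join, in all possible ways, a tree contained in `A ⊆ I` with a tree contained in `B ⊆ I`. The new
vertex of a join lies in exactly one part of a splitting of the vertices, and the maps of forests
into a join which hit it are themselves joins of maps of forests; hence `Δ` intertwines a join
operator `j` with the derivation `j ⊗ 1 ± 1 ⊗ j`. Likewise `x ∘ y` turns a join operator applied to
`x` into the one for the preimages of `A` and `B` under the contraction of the leaves of `y` to `⋆`,
the sum over the trees `s(v)` of the new vertex `v` being absorbed in the operator. Therefore `Δ` is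
compatible with the composition, by induction on the joins that make up `x` and then `y`.

For uniqueness, the two branches of a minimal vertex of a forest are leaves, so that contracting it
exhibits the forest, up to sign, as the composition of a smaller forest with some `Ω_{i,j}`, and a
forest without inner vertex is a composition of forests `E_{i,j}`.
-/

noncomputable section

namespace Bessel

/-! ## Signs of words -/

section Signs

variable {α : Type u} {l l' : List α}

theorem AdjSwap.perm (h : AdjSwap l l') : l.Perm l' := by
  obtain ⟨a, x, y, b, rfl, rfl⟩ := h
  exact (List.Perm.swap y x b).append_left a

theorem AdjSwap.append_left (c : List α) (h : AdjSwap l l') : AdjSwap (c ++ l) (c ++ l') := by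
  obtain ⟨a, x, y, b, rfl, rfl⟩ := h
  exact ⟨c ++ a, x, y, b, by simp, by simp⟩

theorem AdjSwap.append_right (c : List α) (h : AdjSwap l l') : AdjSwap (l ++ c) (l' ++ c) := by
  obtain ⟨a, x, y, b, rfl, rfl⟩ := h
  exact ⟨a, x, y, b ++ c, by simp, by simp⟩

theorem exists_sign (h : l.Perm l') :
    ∃ ε : ℚ, ε * ε = 1 ∧ ∀ {M : Type u} [AddCommGroup M] [Module ℚ M] (φ : List α → M),
      (∀ w w', AdjSwap w w' → φ w = -φ w') → φ l = ε • φ l' := by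
  induction h with
  | nil => exact ⟨1, one_mul 1, fun φ _ => (one_smul ℚ _).symm⟩
  | cons x _ ih =>
    obtain ⟨ε, hε, ih⟩ := ih
    exact ⟨ε, hε, fun φ hφ => ih (fun w => φ (x :: w))
      fun w w' hw => hφ _ _ (hw.append_left [x])⟩
  | swap x y l =>
    refine ⟨-1, by norm_num, fun φ hφ => ?_⟩
    rw [neg_one_smul]
    exact hφ _ _ ⟨[], y, x, l, rfl, rfl⟩
  | trans _ _ ih₁ ih₂ =>
    obtain ⟨ε₁, hε₁, ih₁⟩ := ih₁
    obtain ⟨ε₂, hε₂, ih₂⟩ := ih₂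
    refine ⟨ε₁ * ε₂, ?_, fun φ hφ => by rw [ih₁ φ hφ, ih₂ φ hφ, smul_smul]⟩
    rw [mul_mul_mul_comm, hε₁, hε₂, one_mul]

theorem wedge_append (l l' : List α) : wedge (l ++ l') = wedge l * wedge l' := by
  simp [wedge]

theorem wedge_cons (a : α) (l : List α) : wedge (a :: l) = wedge [a] * wedge l :=
  wedge_append [a] l

theorem wedge_pair_swap (x y : α) : wedge [x, y] = -wedge [y, x] := by
  simpa [wedge] using eq_neg_of_add_eq_zero_left
    (ExteriorAlgebra.ι_add_mul_swap (R := ℚ) (Finsupp.single x 1) (Finsupp.single y 1))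

theorem wedge_swap (h : AdjSwap l l') : wedge l = -wedge l' := by
  obtain ⟨a, x, y, b, rfl, rfl⟩ := h
  have wedge_factor : ∀ x y : α, wedge (a ++ x :: y :: b) = wedge a * (wedge [x, y] * wedge b) :=
    fun x y => by rw [← wedge_append, ← wedge_append]; rfl
  rw [wedge_factor, wedge_factor, wedge_pair_swap, neg_mul, mul_neg]

theorem wedge_eq_ιMulti (l : List α) :
    wedge l = ExteriorAlgebra.ιMulti ℚ l.length fun i => Finsupp.single (l.get i) (1 : ℚ) := by
  rw [ExteriorAlgebra.ιMulti_apply, wedge]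
  congr 1
  conv_lhs => rw [← List.ofFn_get l, List.map_ofFn]
  rfl

/-- The alternating form whose value at `n` vectors is the determinant of their coordinates at the
`n` letters of `l`; it detects `wedge l`. -/
def coordDet (l : List α) : (α →₀ ℚ) [⋀^Fin l.length]→ₗ[ℚ] ℚ :=
  Matrix.detRowAlternating.compLinearMap (LinearMap.pi fun i => Finsupp.lapply (l.get i))

theorem coordDet_letters (h : l.Nodup) :
    coordDet l (fun i => Finsupp.single (l.get i) (1 : ℚ)) = 1 := by
  have coord_eq_one : (Matrix.of fun i j => Finsupp.single (l.get i) (1 : ℚ) (l.get j)) = 1 := by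
    ext i j
    simp [Matrix.one_apply, Finsupp.single_apply, h.getElem_inj_iff, Fin.ext_iff]
  exact (congrArg Matrix.det coord_eq_one).trans Matrix.det_one

theorem wedge_ne_zero (h : l.Nodup) : wedge l ≠ 0 := by
  intro wedge_zero
  have lift_wedge := ExteriorAlgebra.liftAlternating_apply_ιMulti
    (fun n => if hn : n = l.length then hn ▸ coordDet l else 0)
    (fun i => Finsupp.single (l.get i) (1 : ℚ))
  rw [← wedge_eq_ιMulti, wedge_zero, map_zero, dif_pos rfl] at lift_wedge
  exact zero_ne_one (lift_wedge.trans (coordDet_letters h))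

theorem eq_of_smul_wedge_eq (h : l.Nodup) {a b : ℚ} (hab : a • wedge l = b • wedge l) : a = b :=
  smul_left_injective ℚ (wedge_ne_zero h) hab

end Signs

/-! ## Independence of the orientation up to sign -/

section Mk

variable {I : Type u} {V : Finset (Set I)} {w w' : List (Option (Set I))}
  {F : Forest I} {l l' : Set I → List (Option (Set I))}

/-- The word `w` is an orientation of `V ⊔ {R}`, where `none` is the letter `R`. -/
def IsWord (V : Finset (Set I)) (w : List (Option (Set I))) : Prop :=
  w.Nodup ∧ ∀ x, x ∈ w ↔ x = none ∨ ∃ v ∈ V, x = some v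

theorem GlobalOrientation.isWord (o : GlobalOrientation V) : IsWord V o.word :=
  ⟨o.nodup, o.mem_iff⟩

theorem IsWord.perm (h : IsWord V w) (h' : IsWord V w') : w.Perm w' :=
  (List.perm_ext_iff_of_nodup h.1 h'.1).2 fun x => by rw [h.2, h'.2]

theorem IsWord.of_perm (h : IsWord V w) (hp : w.Perm w') : IsWord V w' :=
  ⟨hp.nodup_iff.1 h.1, fun x => by rw [← h.2, hp.mem_iff]⟩

theorem isWord_toList (V : Finset (Set I)) : IsWord V (none :: V.toList.map some) :=
  ⟨List.nodup_cons.2 ⟨by simp, V.nodup_toList.map (Option.some_injective _)⟩,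
    fun x => by simp [eq_comm]⟩

/-- The orientation of `V ⊔ {R}` that starts with `R` and lists `V` in an arbitrary order. -/
def GlobalOrientation.std (V : Finset (Set I)) : GlobalOrientation V :=
  ⟨none :: V.toList.map some, (isWord_toList V).1, (isWord_toList V).2⟩

/-- The orientation `v ∧ o` of `U ⊔ {R}`, where `U = insert v V` is propositional so that no cast of
orientations is needed. -/
def GlobalOrientation.cons {U : Finset (Set I)} (o : GlobalOrientation V) (v : Set I)
    (hv : v ∉ V) (hU : U = insert v V) : GlobalOrientation U where
  word := some v :: o.word
  nodup := List.nodup_cons.2 ⟨fun hmem => hv (by simpa [o.mem_iff] using hmem), o.nodup⟩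
  mem_iff := fun a => by
    simp only [hU, List.mem_cons, o.mem_iff, Finset.mem_insert, exists_eq_or_imp]
    tauto

/-- The words `l v` are local orientations for the forest `F`. -/
def IsLoc (F : Forest I) (l : Set I → List (Option (Set I))) : Prop :=
  (∀ v ∈ F.verts, (l v).Nodup) ∧ (∀ v ∈ F.verts, ∀ h, h ∈ l v ↔ IsHalfEdge F.verts v h) ∧
    ∀ v, v ∉ F.verts → l v = []

/-- The element `w ⊗ F` with local orientations `l`, extended by zero to words which are not
orientations, so that antisymmetry can be used letter by letter. -/
def Bess.mk (F : Forest I) (w : List (Option (Set I))) (l : Set I → List (Option (Set I))) :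
    Bess I :=
  if h : IsWord F.verts w ∧ IsLoc F l then
    Bess.of ⟨F, ⟨w, h.1.1, h.1.2⟩, l, h.2.1, h.2.2.1, h.2.2.2⟩ else 0

theorem InnerForest.isLoc (x : InnerForest I) : IsLoc x.forest x.loc :=
  ⟨x.loc_nodup, x.loc_mem, x.loc_off⟩

theorem Bess.of_eq_mk (x : InnerForest I) : Bess.of x = Bess.mk x.forest x.glob.word x.loc := by
  rw [Bess.mk, dif_pos ⟨x.glob.isWord, x.isLoc⟩]

theorem InnerForest.loc_ext {x y : InnerForest I} (hF : x.forest = y.forest)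
    (hl : ∀ v ∈ y.forest.verts, x.loc v = y.loc v) : x.loc = y.loc := by
  funext v
  by_cases hv : v ∈ y.forest.verts
  · exact hl v hv
  · rw [x.loc_off v (hF ▸ hv), y.loc_off v hv]

theorem Bess.of_congr {x y : InnerForest I} (hF : x.forest = y.forest)
    (hw : x.glob.word = y.glob.word) (hl : ∀ v ∈ y.forest.verts, x.loc v = y.loc v) :
    Bess.of x = Bess.of y := by
  rw [Bess.of_eq_mk, Bess.of_eq_mk, hw, InnerForest.loc_ext hF hl, hF]

theorem Bess.of_eq_neg_of_adjSwap {x y : InnerForest I} (hF : x.forest = y.forest)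
    (hw : AdjSwap x.glob.word y.glob.word) (hl : ∀ v ∈ y.forest.verts, x.loc v = y.loc v) :
    Bess.of x = -Bess.of y :=
  eq_neg_iff_add_eq_zero.2 (Bess.of_flip ⟨hF, Or.inl ⟨hw, InnerForest.loc_ext hF hl⟩⟩)

theorem Bess.mk_eq_neg_of_flip
    (valid_iff : IsWord F.verts w ∧ IsLoc F l ↔ IsWord F.verts w' ∧ IsLoc F l')
    (h : (AdjSwap w w' ∧ l = l') ∨
      (w = w' ∧ ∃ v, AdjSwap (l v) (l' v) ∧ ∀ u, u ≠ v → l u = l' u)) :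
    Bess.mk F w l = -Bess.mk F w' l' := by
  by_cases valid : IsWord F.verts w ∧ IsLoc F l
  · rw [Bess.mk, Bess.mk, dif_pos valid, dif_pos (valid_iff.1 valid), eq_neg_iff_add_eq_zero]
    exact Bess.of_flip ⟨rfl, h⟩
  · rw [Bess.mk, Bess.mk, dif_neg valid, dif_neg (mt valid_iff.2 valid), neg_zero]

theorem Bess.mk_swap (F : Forest I) (h : AdjSwap w w') (l : Set I → List (Option (Set I))) :
    Bess.mk F w l = -Bess.mk F w' l :=
  Bess.mk_eq_neg_of_flip
    (and_congr_left fun _ => ⟨fun hw => hw.of_perm h.perm, fun hw => hw.of_perm h.perm.symm⟩)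
    (Or.inl ⟨h, rfl⟩)

section LocalOrientation

variable {v : Set I} {L L' : List (Option (Set I))}

theorem IsLoc.update (h : IsLoc F l) (hv : v ∈ F.verts) (hL : (l v).Perm L) :
    IsLoc F (Function.update l v L) := by
  refine ⟨fun u hu => ?_, fun u hu e => ?_, fun u hu => ?_⟩
  · rcases eq_or_ne u v with rfl | huv
    · simpa only [Function.update_self] using hL.nodup_iff.1 (h.1 u hu)
    · simpa only [Function.update_of_ne huv] using h.1 u hu
  · rcases eq_or_ne u v with rfl | huv
    · simpa only [Function.update_self, ← hL.mem_iff] using h.2.1 u hu e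
    · simpa only [Function.update_of_ne huv] using h.2.1 u hu e
  · have huv : u ≠ v := by rintro rfl; exact hu hv
    simpa only [Function.update_of_ne huv] using h.2.2 u hu

theorem isLoc_update_congr (hv : v ∈ F.verts) (hL : L.Perm L') :
    IsLoc F (Function.update l v L) ↔ IsLoc F (Function.update l v L') := by
  have update_of_perm : ∀ {L L'}, List.Perm L L' → IsLoc F (Function.update l v L) →
      IsLoc F (Function.update l v L') := fun {L L'} hL h => by
    simpa using h.update hv (L := L') (by simpa using hL)
  exact ⟨update_of_perm hL, update_of_perm hL.symm⟩

theorem Bess.mk_update_swap (w : List (Option (Set I))) (l : Set I → List (Option (Set I)))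
    (hv : v ∈ F.verts) (h : AdjSwap L L') :
    Bess.mk F w (Function.update l v L) = -Bess.mk F w (Function.update l v L') :=
  Bess.mk_eq_neg_of_flip (and_congr_right fun _ => isLoc_update_congr hv h.perm)
    (Or.inr ⟨rfl, v, by simpa using h, fun u hu => by
      rw [Function.update_of_ne hu, Function.update_of_ne hu]⟩)

end LocalOrientation

section SameForest

variable {x y : InnerForest I}

theorem InnerForest.loc_perm (h : x.forest = y.forest) {v : Set I} (hv : v ∈ x.forest.verts) :
    (x.loc v).Perm (y.loc v) :=
  (List.perm_ext_iff_of_nodup (x.loc_nodup v hv) (y.loc_nodup v (h ▸ hv))).2 fun a => by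
    rw [x.loc_mem v hv, y.loc_mem v (h ▸ hv), h]

theorem Bess.exists_of_eq_smul_mk_piecewise (h : x.forest = y.forest) (S : Finset (Set I))
    (hS : S ⊆ x.forest.verts) :
    ∃ c : ℚ, Bess.of x = c • Bess.mk x.forest x.glob.word (S.piecewise y.loc x.loc) := by
  induction S using Finset.induction_on with
  | empty => exact ⟨1, by rw [Finset.piecewise_empty, one_smul, Bess.of_eq_mk]⟩
  | insert v S hvS ih =>
    obtain ⟨c, hc⟩ := ih ((Finset.subset_insert v S).trans hS)
    have hv : v ∈ x.forest.verts := hS (Finset.mem_insert_self v S)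
    obtain ⟨ε, -, hε⟩ := exists_sign (InnerForest.loc_perm h hv)
    have change_at_v := hε
      (fun L => Bess.mk x.forest x.glob.word (Function.update (S.piecewise y.loc x.loc) v L))
      fun _ _ => Bess.mk_update_swap _ _ hv
    have unchanged_at_v :
        Function.update (S.piecewise y.loc x.loc) v (x.loc v) = S.piecewise y.loc x.loc :=
      Function.update_eq_self_iff.2 (Finset.piecewise_eq_of_notMem _ _ _ hvS).symm
    rw [unchanged_at_v, ← Finset.piecewise_insert] at change_at_v
    exact ⟨c * ε, by rw [hc, change_at_v, smul_smul]⟩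

theorem Bess.exists_of_eq_smul_of (h : x.forest = y.forest) :
    ∃ c : ℚ, Bess.of x = c • Bess.of y := by
  obtain ⟨c, hc⟩ := Bess.exists_of_eq_smul_mk_piecewise h x.forest.verts subset_rfl
  have loc_eq : x.forest.verts.piecewise y.loc x.loc = y.loc := by
    funext v
    by_cases hv : v ∈ x.forest.verts
    · rw [Finset.piecewise_eq_of_mem _ _ _ hv]
    · rw [Finset.piecewise_eq_of_notMem _ _ _ hv, x.loc_off v hv, y.loc_off v (h ▸ hv)]
  obtain ⟨ε, -, hε⟩ := exists_sign (x.glob.isWord.perm (by rw [h]; exact y.glob.isWord))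
  have change_word := hε (fun w => Bess.mk x.forest w y.loc) fun _ _ hw => Bess.mk_swap _ hw _
  exact ⟨c * ε, by rw [hc, loc_eq, change_word, smul_smul, Bess.of_eq_mk y, h]⟩

end SameForest

theorem Forest.branch_ne (F : Forest I) {v A B : Set I} (h : IsSplit F.verts v A B) : A ≠ B := by
  rintro rfl
  obtain ⟨a, ha⟩ := F.node_nonempty h.1
  exact Set.disjoint_left.1 h.2.2.1 ha ha

theorem Forest.mem_halfEdges_iff (F : Forest I) {v A B : Set I} (h : IsSplit F.verts v A B)
    {e : Option (Set I)} : e ∈ [none, some A, some B] ↔ IsHalfEdge F.verts v e := by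
  simp only [List.mem_cons, List.not_mem_nil, or_false]
  constructor
  · rintro (rfl | rfl | rfl)
    · exact Or.inl rfl
    · exact Or.inr ⟨_, _, h, rfl⟩
    · exact Or.inr ⟨_, _, Forest.split_symm h, rfl⟩
  · rintro (rfl | ⟨C, D, h', rfl⟩)
    · exact Or.inl rfl
    · rcases F.split_unique h h' with ⟨rfl, -⟩ | ⟨rfl, -⟩ <;> simp

theorem Forest.exists_innerForest (F : Forest I) : ∃ x : InnerForest I, x.forest = F := by
  choose A B split using F.binary
  refine ⟨⟨F, GlobalOrientation.std F.verts,
    fun v => if hv : v ∈ F.verts then [none, some (A v hv), some (B v hv)] else [],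
    fun v hv => ?_, fun v hv e => ?_, fun v hv => dif_neg hv⟩, rfl⟩
  · simpa [hv] using F.branch_ne (split v hv)
  · rw [dif_pos hv, F.mem_halfEdges_iff (split v hv)]

@[elab_as_elim]
theorem Bess.induction {P : Bess I → Prop} (of : ∀ x, P (Bess.of x))
    (add : ∀ x y, P x → P y → P (x + y)) (smul : ∀ (c : ℚ) x, P x → P (c • x)) (z : Bess I) :
    P z := by
  obtain ⟨f, rfl⟩ := (flipRel I).mkQ_surjective z
  induction f using Finsupp.induction_linear with
  | zero =>
    have := smul 0 _ (of (discreteInner I))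
    rwa [zero_smul, ← map_zero (flipRel I).mkQ] at this
  | add f g hf hg => rw [map_add]; exact add _ _ hf hg
  | single x c =>
    have := smul c _ (of x)
    rwa [Bess.of, ← map_smul, Finsupp.smul_single, smul_eq_mul, mul_one] at this

theorem Bess.hom_ext {M : Type*} [AddCommGroup M] [Module ℚ M] {f g : Bess I →ₗ[ℚ] M}
    (h : ∀ x, f (Bess.of x) = g (Bess.of x)) : f = g := by
  refine LinearMap.ext fun z => ?_
  induction z using Bess.induction with
  | of x => exact h x
  | add x y hx hy => rw [map_add, map_add, hx, hy]
  | smul c x hx => rw [map_smul, map_smul, hx]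

end Mk

/-! ## Joining two trees of a forest -/

section Join

variable {I : Type u} {F : Forest I} {T T' : Set I}

theorem Forest.IsTree.nonempty (h : F.IsTree T) : T.Nonempty :=
  F.node_nonempty h.1

theorem Forest.IsTree.eq_of_mem (h : F.IsTree T) (h' : F.IsTree T') {a : I} (ha : a ∈ T)
    (ha' : a ∈ T') : T = T' := by
  by_contra hne
  exact Set.disjoint_left.1 (tree_disjoint (T := ⟨T, h⟩) (T' := ⟨T', h'⟩)
    fun e => hne (congrArg Subtype.val e)) ha ha'

theorem Forest.IsTree.node_subset_or_disjoint (h : F.IsTree T) {N : Set I}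
    (hN : IsNode F.verts N) : N ⊆ T ∨ Disjoint N T := by
  rcases F.node_laminar hN h.1 with hNT | hTN | hdisj
  · exact Or.inl hNT
  · exact Or.inl (h.2 N hN hTN).subset
  · exact Or.inr hdisj

theorem Forest.exists_tree (F : Forest I) {N : Set I} (hN : IsNode F.verts N) :
    ∃ T, F.IsTree T ∧ N ⊆ T := by
  by_cases below : (F.verts.filter (N ⊆ ·)).Nonempty
  · obtain ⟨v, hv, hmax⟩ := Finset.exists_maximal below
    rw [Finset.mem_filter] at hv
    refine ⟨v, ⟨Or.inl hv.1, ?_⟩, hv.2⟩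
    rintro M (hM | ⟨i, rfl⟩) hvM
    · exact (hvM.antisymm (hmax (Finset.mem_filter.2 ⟨hM, hv.2.trans hvM⟩) hvM)).symm
    · exact ((F.nonempty v hv.1).subset_singleton_iff.1 hvM).symm
  · refine ⟨N, ⟨hN, ?_⟩, subset_rfl⟩
    rintro M (hM | ⟨i, rfl⟩) hNM
    · exact absurd ⟨M, Finset.mem_filter.2 ⟨hM, hNM⟩⟩ below
    · exact ((F.node_nonempty hN).subset_singleton_iff.1 hNM).symm

/-- `T` and `T'` are two different trees of `F`, so that they can be joined at a new root. -/
structure IsJoin (F : Forest I) (T T' : Set I) : Prop where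
  left : F.IsTree T
  right : F.IsTree T'
  ne : T ≠ T'

theorem IsJoin.symm (h : IsJoin F T T') : IsJoin F T' T :=
  ⟨h.right, h.left, h.ne.symm⟩

theorem IsJoin.disjoint (h : IsJoin F T T') : Disjoint T T' :=
  Set.disjoint_left.2 fun _ ha ha' => h.ne (h.left.eq_of_mem h.right ha ha')

theorem IsJoin.notMem (h : IsJoin F T T') : T ∪ T' ∉ F.verts := fun hmem =>
  h.ne ((h.left.2 _ (Or.inl hmem) Set.subset_union_left).symm.trans
    (h.right.2 _ (Or.inl hmem) Set.subset_union_right))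

theorem IsJoin.ne_of_mem (h : IsJoin F T T') {v : Set I} (hv : v ∈ F.verts) : v ≠ T ∪ T' := by
  rintro rfl
  exact h.notMem hv

theorem IsJoin.node_subset_or_disjoint (h : IsJoin F T T') {N : Set I} (hN : IsNode F.verts N) :
    N ⊆ T ∪ T' ∨ Disjoint N (T ∪ T') := by
  rcases h.left.node_subset_or_disjoint hN with hNT | hdisj
  · exact Or.inl (hNT.trans Set.subset_union_left)
  rcases h.right.node_subset_or_disjoint hN with hNT' | hdisj'
  · exact Or.inl (hNT'.trans Set.subset_union_right)
  · exact Or.inr (Set.disjoint_union_right.2 ⟨hdisj, hdisj'⟩)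

theorem IsNode.mono {V W : Finset (Set I)} (h : V ⊆ W) {A : Set I} (hA : IsNode V A) :
    IsNode W A := hA.imp (fun hA => h hA) id

theorem IsSplit.mono {V W : Finset (Set I)} (h : V ⊆ W) {v A B : Set I} (hs : IsSplit V v A B) :
    IsSplit W v A B := ⟨hs.1.mono h, hs.2.1.mono h, hs.2.2⟩

theorem Forest.isSplit_iff_of_subset {G : Forest I} (hFG : F.verts ⊆ G.verts) {v A B : Set I}
    (hv : v ∈ F.verts) : IsSplit G.verts v A B ↔ IsSplit F.verts v A B := by
  refine ⟨fun hs => ?_, fun hs => hs.mono hFG⟩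
  obtain ⟨C, D, hs'⟩ := F.binary v hv
  rcases G.split_unique (hs'.mono hFG) hs with ⟨rfl, rfl⟩ | ⟨rfl, rfl⟩
  · exact hs'
  · exact Forest.split_symm hs'

theorem IsJoin.split (h : IsJoin F T T') : IsSplit (insert (T ∪ T') F.verts) (T ∪ T') T T' :=
  ⟨h.left.1.mono (Finset.subset_insert _ _), h.right.1.mono (Finset.subset_insert _ _),
    h.disjoint, rfl⟩

/-- The forest obtained by joining the trees `T` and `T'` at a new vertex. -/
def Forest.join (F : Forest I) {T T' : Set I} (h : IsJoin F T T') : Forest I where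
  verts := insert (T ∪ T') F.verts
  nonempty := by
    intro v hv
    rcases Finset.mem_insert.1 hv with rfl | hv
    · exact h.left.nonempty.mono Set.subset_union_left
    · exact F.nonempty v hv
  laminar := by
    intro v hv w hw
    rcases Finset.mem_insert.1 hv with rfl | hv <;> rcases Finset.mem_insert.1 hw with rfl | hw
    · exact Or.inl subset_rfl
    · exact Or.inr ((h.node_subset_or_disjoint (Or.inl hw)).imp_right fun hdisj => hdisj.symm)
    · exact (h.node_subset_or_disjoint (Or.inl hv)).imp_right Or.inr
    · exact F.laminar v hv w hw
  binary := by
    intro v hv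
    rcases Finset.mem_insert.1 hv with rfl | hv
    · exact ⟨T, T', h.split⟩
    · obtain ⟨A, B, hs⟩ := F.binary v hv
      exact ⟨A, B, hs.mono (Finset.subset_insert _ _)⟩

theorem Forest.verts_subset_join (h : IsJoin F T T') : F.verts ⊆ (F.join h).verts :=
  Finset.subset_insert _ _

theorem Forest.mem_join (h : IsJoin F T T') : T ∪ T' ∈ (F.join h).verts :=
  Finset.mem_insert_self _ _

theorem card_join (h : IsJoin F T T') : (F.join h).verts.card = F.verts.card + 1 :=
  Finset.card_insert_of_notMem h.notMem

theorem join_split (h : IsJoin F T T') : IsSplit (F.join h).verts (T ∪ T') T T' :=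
  h.split

/-- The inner-oriented forest obtained by joining the trees `T` and `T'` at a new vertex `v`, with
global orientation `v ∧ o` and local orientation `root ∧ T ∧ T'` at `v`. -/
def InnerForest.join (x : InnerForest I) {T T' : Set I} (h : IsJoin x.forest T T') :
    InnerForest I where
  forest := x.forest.join h
  glob := x.glob.cons (T ∪ T') h.notMem rfl
  loc := Function.update x.loc (T ∪ T') [none, some T, some T']
  loc_nodup := by
    intro v hv
    rcases Finset.mem_insert.1 hv with rfl | hv
    · simpa using h.ne
    · simpa only [Function.update_of_ne (h.ne_of_mem hv)] using x.loc_nodup v hv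
  loc_mem := by
    intro v hv e
    rcases Finset.mem_insert.1 hv with rfl | hv
    · rw [Function.update_self, (x.forest.join h).mem_halfEdges_iff (join_split h)]
    · simp only [Function.update_of_ne (h.ne_of_mem hv), x.loc_mem v hv, IsHalfEdge,
        Forest.isSplit_iff_of_subset (x.forest.verts_subset_join h) hv]
  loc_off := by
    intro v hv
    have hne : v ≠ T ∪ T' := by rintro rfl; exact hv (x.forest.mem_join h)
    rw [Function.update_of_ne hne, x.loc_off v fun hv' => hv (x.forest.verts_subset_join h hv')]

theorem InnerForest.join_loc_self (x : InnerForest I) (h : IsJoin x.forest T T') :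
    (x.join h).loc (T ∪ T') = [none, some T, some T'] :=
  Function.update_self ..

theorem InnerForest.join_loc_of_mem (x : InnerForest I) (h : IsJoin x.forest T T') {v : Set I}
    (hv : v ∈ x.forest.verts) : (x.join h).loc v = x.loc v :=
  Function.update_of_ne (h.ne_of_mem hv) ..

theorem InnerForest.loc_eq_join_loc {x z : InnerForest I} (h : IsJoin x.forest T T')
    (hnew : z.loc (T ∪ T') = [none, some T, some T'])
    (hold : ∀ v ∈ x.forest.verts, z.loc v = x.loc v) :
    ∀ v ∈ (x.join h).forest.verts, z.loc v = (x.join h).loc v := by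
  intro v hv
  rcases Finset.mem_insert.1 hv with rfl | hv
  · rw [hnew, x.join_loc_self]
  · rw [hold v hv, x.join_loc_of_mem h hv]

theorem Bess.of_eq_of_join {x z : InnerForest I} (h : IsJoin x.forest T T')
    (hF : z.forest.verts = insert (T ∪ T') x.forest.verts)
    (hw : z.glob.word = some (T ∪ T') :: x.glob.word)
    (hnew : z.loc (T ∪ T') = [none, some T, some T'])
    (hold : ∀ v ∈ x.forest.verts, z.loc v = x.loc v) : Bess.of z = Bess.of (x.join h) :=
  Bess.of_congr (Forest.ext hF) hw (InnerForest.loc_eq_join_loc h hnew hold)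

theorem Bess.of_eq_neg_of_join {x z : InnerForest I} (h : IsJoin x.forest T T')
    (hF : z.forest.verts = insert (T ∪ T') x.forest.verts)
    (hw : AdjSwap z.glob.word (some (T ∪ T') :: x.glob.word))
    (hnew : z.loc (T ∪ T') = [none, some T, some T'])
    (hold : ∀ v ∈ x.forest.verts, z.loc v = x.loc v) : Bess.of z = -Bess.of (x.join h) :=
  Bess.of_eq_neg_of_adjSwap (Forest.ext hF) hw (InnerForest.loc_eq_join_loc h hnew hold)

theorem Bess.of_join_symm (x : InnerForest I) (h : IsJoin x.forest T T') :
    Bess.of (x.join h.symm) = -Bess.of (x.join h) := by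
  have forest_eq : x.forest.join h.symm = x.forest.join h := Forest.ext (by
    simp only [Forest.join, Set.union_comm])
  rw [Bess.of_eq_mk, Bess.of_eq_mk (x.join h)]
  simp only [InnerForest.join, GlobalOrientation.cons, forest_eq, Set.union_comm T' T]
  exact Bess.mk_update_swap _ _ (x.forest.mem_join h) ⟨[none], _, _, [], rfl, rfl⟩

/-! ## Removing the root vertex of a tree -/

section EraseRoot

variable {v A B : Set I}

theorem Forest.not_subset_singleton (F : Forest I) (hv : v ∈ F.verts) (i : I) : ¬ v ⊆ {i} := by
  intro hvi
  obtain ⟨A, B, hs⟩ := F.binary v hv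
  have branch_eq : ∀ {C}, IsNode F.verts C → C ⊆ v → C = {i} := fun hC hCv =>
    (F.node_nonempty hC).subset_singleton_iff.1 (hCv.trans hvi)
  exact F.branch_ne hs ((branch_eq hs.1 (hs.2.2.2 ▸ Set.subset_union_left)).trans
    (branch_eq hs.2.1 (hs.2.2.2 ▸ Set.subset_union_right)).symm)

theorem IsNode.erase {V : Finset (Set I)} {N : Set I} (hN : IsNode V N) (hne : N ≠ v) :
    IsNode (V.erase v) N :=
  hN.imp_left fun hN => Finset.mem_erase.2 ⟨hne, hN⟩

/-- The forest obtained by removing a root vertex. -/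
def Forest.eraseRoot (F : Forest I) (v : Set I) (hmax : ∀ w ∈ F.verts, v ⊆ w → w ⊆ v) :
    Forest I where
  verts := F.verts.erase v
  nonempty := fun w hw => F.nonempty w (Finset.mem_of_mem_erase hw)
  laminar := fun w hw w' hw' =>
    F.laminar w (Finset.mem_of_mem_erase hw) w' (Finset.mem_of_mem_erase hw')
  binary := by
    intro w hw
    obtain ⟨hwv, hw⟩ := Finset.mem_erase.1 hw
    obtain ⟨C, D, hs⟩ := F.binary w hw
    have v_not_below : ¬ v ⊆ w := fun h => hwv ((hmax w hw h).antisymm h)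
    refine ⟨C, D, hs.1.erase ?_, hs.2.1.erase ?_, hs.2.2⟩
    · rintro rfl
      exact v_not_below (hs.2.2.2 ▸ Set.subset_union_left)
    · rintro rfl
      exact v_not_below (hs.2.2.2 ▸ Set.subset_union_right)

theorem Forest.not_subset_of_isNode_eraseRoot (F : Forest I) (hv : v ∈ F.verts)
    (hmax : ∀ w ∈ F.verts, v ⊆ w → w ⊆ v) {N : Set I}
    (hN : IsNode (F.eraseRoot v hmax).verts N) : ¬ v ⊆ N := by
  rcases hN with hN | ⟨i, rfl⟩
  · obtain ⟨hNv, hN⟩ := Finset.mem_erase.1 hN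
    exact fun h => hNv ((hmax N hN h).antisymm h)
  · exact F.not_subset_singleton hv i

theorem Forest.isTree_eraseRoot (F : Forest I) (hv : v ∈ F.verts)
    (hmax : ∀ w ∈ F.verts, v ⊆ w → w ⊆ v) (hs : IsSplit F.verts v A B) :
    (F.eraseRoot v hmax).IsTree A := by
  obtain ⟨a, ha⟩ := F.node_nonempty hs.1
  obtain ⟨b, hb⟩ := F.node_nonempty hs.2.1
  have hAv : A ≠ v := by
    rintro rfl
    exact Set.disjoint_left.1 hs.2.2.1 (hs.2.2.2 ▸ Or.inr hb) hb
  refine ⟨hs.1.erase hAv, fun N hN hAN => ?_⟩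
  have hvN : ¬ v ⊆ N := F.not_subset_of_isNode_eraseRoot hv hmax hN
  have hNF : IsNode F.verts N := hN.mono (Finset.erase_subset _ _)
  rcases F.node_laminar hNF (Or.inl hv) with hNv | hvN' | hdisj
  · rcases F.node_sub_branch hs hNF hNv (fun e => hvN e.symm.subset) with hNA | hNB
    · exact hNA.antisymm hAN
    · exact absurd (hNB (hAN ha)) (Set.disjoint_left.1 hs.2.2.1 ha)
  · exact absurd hvN' hvN
  · exact absurd (hs.2.2.2 ▸ Or.inl ha : a ∈ v) (Set.disjoint_left.1 hdisj (hAN ha))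

theorem Forest.exists_join_eq_of_maximal (F : Forest I) (hv : v ∈ F.verts)
    (hmax : ∀ w ∈ F.verts, v ⊆ w → w ⊆ v) (hs : IsSplit F.verts v A B) :
    ∃ (F' : Forest I) (h : IsJoin F' A B), F'.join h = F := by
  refine ⟨F.eraseRoot v hmax, ⟨F.isTree_eraseRoot hv hmax hs,
    F.isTree_eraseRoot hv hmax (Forest.split_symm hs), F.branch_ne hs⟩, Forest.ext ?_⟩
  simp only [Forest.join, Forest.eraseRoot, hs.2.2.2]
  exact Finset.insert_erase hv

theorem Forest.exists_join_eq (F : Forest I) (hF : F.verts.Nonempty) :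
    ∃ (F' : Forest I) (A B : Set I) (h : IsJoin F' A B), F'.join h = F := by
  obtain ⟨v, hv, hmax⟩ := Finset.exists_maximal hF
  obtain ⟨A, B, hs⟩ := F.binary v hv
  obtain ⟨F', h⟩ := F.exists_join_eq_of_maximal hv (fun w hw h => hmax hw h) hs
  exact ⟨F', A, B, h⟩

end EraseRoot

/-! ## Join operators -/

/-- The set `A` is a union of trees of `F`. -/
def Saturated (F : Forest I) (A : Set I) : Prop := ∀ v ∈ F.verts, v ⊆ A ∨ Disjoint v A

theorem Saturated.node {A N : Set I} (h : Saturated F A) (hN : IsNode F.verts N) :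
    N ⊆ A ∨ Disjoint N A := by
  rcases hN with hN | ⟨i, rfl⟩
  · exact h N hN
  · simpa only [Set.singleton_subset_iff, Set.disjoint_singleton_left] using em (i ∈ A)

theorem Forest.IsTree.saturated (h : F.IsTree T) : Saturated F T :=
  fun _ hv => h.node_subset_or_disjoint (Or.inl hv)

/-- Along the map `c` of leaves, every vertex of `G` lies over some node of `F`. Both the forests
`F' ≤ F` (with `c = id`) and the grafts on `F` (with `c = collapse`) have this property. -/
def LiesOver {K : Type u} (c : K → I) (G : Forest K) (F : Forest I) : Prop :=
  ∀ w ∈ G.verts, ∃ N, IsNode F.verts N ∧ w ⊆ c ⁻¹' N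

section LiesOver

variable {K : Type u} {c : K → I} {G : Forest K} {A B : Set I}

theorem LiesOver.node (h : LiesOver c G F) {w : Set K} (hw : IsNode G.verts w) :
    ∃ N, IsNode F.verts N ∧ w ⊆ c ⁻¹' N := by
  rcases hw with hw | ⟨k, rfl⟩
  · exact h w hw
  · exact ⟨{c k}, Or.inr ⟨c k, rfl⟩, by simp⟩

theorem LiesOver.saturated (h : LiesOver c G F) (hA : Saturated F A) :
    Saturated G (c ⁻¹' A) := by
  intro w hw
  obtain ⟨N, hN, hwN⟩ := h w hw
  exact (hA.node hN).imp (fun hNA => hwN.trans (Set.preimage_mono hNA))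
    fun hdisj => (hdisj.preimage c).mono_left hwN

theorem LiesOver.exists_tree (h : LiesOver c G F) (hA : Saturated F A) {t : Set K}
    (ht : G.IsTree t) (htA : t ⊆ c ⁻¹' A) : ∃ T, F.IsTree T ∧ T ⊆ A ∧ t ⊆ c ⁻¹' T := by
  obtain ⟨N, hN, htN⟩ := h.node ht.1
  obtain ⟨T, hT, hNT⟩ := F.exists_tree hN
  have htT : t ⊆ c ⁻¹' T := htN.trans (Set.preimage_mono hNT)
  obtain ⟨a, ha⟩ := ht.nonempty
  exact ⟨T, hT, (hA.node hT.1).resolve_right fun hdisj =>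
    Set.disjoint_left.1 hdisj (htT ha) (htA ha), htT⟩

end LiesOver

/-- Pairs of different trees of `F`, the first contained in `A` and the second in `B`. -/
abbrev JoinPair (F : Forest I) (A B : Set I) : Type u :=
  {P : Set I × Set I // IsJoin F P.1 P.2 ∧ P.1 ⊆ A ∧ P.2 ⊆ B}

instance [Finite I] (F : Forest I) (A B : Set I) : Fintype (JoinPair F A B) := Fintype.ofFinite _

theorem JoinPair.eq_of_isJoin (h : IsJoin F T T') (P : JoinPair F T T') :
    P = ⟨(T, T'), h, subset_rfl, subset_rfl⟩ := by
  obtain ⟨⟨S, S'⟩, hSS', hS, hS'⟩ := P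
  obtain rfl : T = S := hSS'.left.2 _ h.left.1 hS
  obtain rfl : T' = S' := hSS'.right.2 _ h.right.1 hS'
  rfl

/-- A pair of trees over a pair of trees of `F` in `A` and `B`, regarded as a pair over `A` and
`B`. -/
def JoinPair.ofSigma {K : Type u} {c : K → I} {G : Forest K} {A B : Set I}
    (Q : Σ P : JoinPair F A B, JoinPair G (c ⁻¹' P.1.1) (c ⁻¹' P.1.2)) :
    JoinPair G (c ⁻¹' A) (c ⁻¹' B) :=
  ⟨Q.2.1, Q.2.2.1, Q.2.2.2.1.trans (Set.preimage_mono Q.1.2.2.1),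
    Q.2.2.2.2.trans (Set.preimage_mono Q.1.2.2.2)⟩

theorem JoinPair.ofSigma_bijective {K : Type u} {c : K → I} {G : Forest K}
    (hG : LiesOver c G F) {A B : Set I} (hA : Saturated F A) (hB : Saturated F B)
    (hAB : Disjoint A B) :
    Function.Bijective (JoinPair.ofSigma (F := F) (c := c) (G := G) (A := A) (B := B)) := by
  constructor
  · rintro ⟨⟨⟨T, T'⟩, hTT', _⟩, ⟨⟨t, t'⟩, htt', htT, htT'⟩⟩
      ⟨⟨⟨S, S'⟩, hSS', _⟩, ⟨⟨s, s'⟩, _, hsS, hsS'⟩⟩ heq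
    obtain ⟨rfl, rfl⟩ := Prod.mk.inj (congrArg Subtype.val heq)
    obtain ⟨a, ha⟩ := htt'.left.nonempty
    obtain ⟨b, hb⟩ := htt'.right.nonempty
    obtain rfl : T = S := hTT'.left.eq_of_mem hSS'.left (htT ha) (hsS ha)
    obtain rfl : T' = S' := hTT'.right.eq_of_mem hSS'.right (htT' hb) (hsS' hb)
    rfl
  · rintro ⟨⟨t, t'⟩, htt', htA, htB⟩
    obtain ⟨T, hT, hTA, htT⟩ := hG.exists_tree hA htt'.left htA
    obtain ⟨T', hT', hTB, htT'⟩ := hG.exists_tree hB htt'.right htB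
    have hne : T ≠ T' := by
      rintro rfl
      obtain ⟨a, ha⟩ := hT.nonempty
      exact Set.disjoint_left.1 hAB (hTA ha) (hTB ha)
    exact ⟨⟨⟨(T, T'), ⟨hT, hT', hne⟩, hTA, hTB⟩, ⟨(t, t'), htt', htT, htT'⟩⟩, rfl⟩

theorem InnerForest.join_flip {g g' : GlobalOrientation F.verts}
    {l l' : Set I → List (Option (Set I))} {nodup nodup' mem mem' off off'}
    (hflip : Flip ⟨F, g, l, nodup, mem, off⟩ ⟨F, g', l', nodup', mem', off'⟩)
    (h : IsJoin F T T') :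
    Flip (InnerForest.join ⟨F, g, l, nodup, mem, off⟩ h)
      (InnerForest.join ⟨F, g', l', nodup', mem', off'⟩ h) := by
  refine ⟨rfl, ?_⟩
  rcases hflip.2 with ⟨glob_swap, loc_eq⟩ | ⟨glob_eq, v, loc_swap, loc_eq⟩
  · exact Or.inl ⟨glob_swap.append_left [_], congrArg (Function.update · _ _) loc_eq⟩
  · have hv : v ∈ F.verts := flip_vertex_mem ⟨F, g, l, nodup, mem, off⟩ loc_swap
    refine Or.inr ⟨congrArg (some (T ∪ T') :: ·) glob_eq, v, ?_, fun w hw => ?_⟩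
    · simpa only [InnerForest.join, Function.update_of_ne (h.ne_of_mem hv)] using loc_swap
    · by_cases hwT : w = T ∪ T'
      · rw [hwT, InnerForest.join_loc_self, InnerForest.join_loc_self]
      · simpa only [InnerForest.join, Function.update_of_ne hwT] using loc_eq w hw

variable [Finite I]

/-- The operator that joins in all possible ways a tree contained in `A` with a tree contained in
`B`. -/
def Bess.joins (A B : Set I) : Bess I →ₗ[ℚ] Bess I :=
  Bess.lift (fun x => ∑ P : JoinPair x.forest A B, Bess.of (x.join P.2.1)) <| by
    rintro ⟨F, g, l, nodup, mem, off⟩ ⟨F', g', l', nodup', mem', off'⟩ hflip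
    obtain rfl : F = F' := hflip.1
    rw [← Finset.sum_add_distrib]
    exact Finset.sum_eq_zero fun P _ => Bess.of_flip (InnerForest.join_flip hflip P.2.1)

theorem Bess.joins_of (A B : Set I) (x : InnerForest I) :
    Bess.joins A B (Bess.of x) = ∑ P : JoinPair x.forest A B, Bess.of (x.join P.2.1) :=
  Bess.lift_of _ _ _

theorem Bess.joins_of_isJoin (x : InnerForest I) (h : IsJoin x.forest T T') :
    Bess.joins T T' (Bess.of x) = Bess.of (x.join h) := by
  rw [Bess.joins_of, Fintype.sum_eq_single ⟨(T, T'), h, subset_rfl, subset_rfl⟩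
    fun P hP => absurd (JoinPair.eq_of_isJoin h P) hP]

theorem Bess.joins_symm (A B : Set I) : Bess.joins B A = -Bess.joins A B := by
  refine Bess.hom_ext fun x => ?_
  rw [LinearMap.neg_apply, Bess.joins_of, Bess.joins_of, ← Finset.sum_neg_distrib]
  let swap (A B : Set I) (P : JoinPair x.forest A B) : JoinPair x.forest B A :=
    ⟨(P.1.2, P.1.1), P.2.1.symm, P.2.2.2, P.2.2.1⟩
  exact Fintype.sum_equiv ⟨swap B A, swap A B, fun _ => rfl, fun _ => rfl⟩ _ _
    fun P => Bess.of_join_symm x P.2.1.symm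

theorem Bess.joins_eq_sum {K : Type u} [Finite K] {c : K → I} {z : InnerForest K}
    (hz : LiesOver c z.forest F) {A B : Set I} (hA : Saturated F A) (hB : Saturated F B)
    (hAB : Disjoint A B) :
    Bess.joins (c ⁻¹' A) (c ⁻¹' B) (Bess.of z) =
      ∑ P : JoinPair F A B, Bess.joins (c ⁻¹' P.1.1) (c ⁻¹' P.1.2) (Bess.of z) := by
  simp only [Bess.joins_of]
  rw [← Fintype.sum_sigma']
  exact (Fintype.sum_bijective _ (JoinPair.ofSigma_bijective hz hA hB hAB) _ _ fun _ => rfl).symm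

@[elab_as_elim]
theorem Bess.join_induction {P : Bess I → Prop} (discrete : P (Bess.discrete I))
    (add : ∀ x y, P x → P y → P (x + y)) (smul : ∀ (c : ℚ) x, P x → P (c • x))
    (join : ∀ (x : InnerForest I) (A B : Set I), IsJoin x.forest A B → P (Bess.of x) →
      P (Bess.joins A B (Bess.of x))) (z : Bess I) : P z := by
  induction z using Bess.induction with
  | add x y hx hy => exact add x y hx hy
  | smul c x hx => exact smul c x hx
  | of x =>
    induction hn : x.forest.verts.card generalizing x with
    | zero =>
      obtain ⟨c, hc⟩ := Bess.exists_of_eq_smul_of (x := x) (y := discreteInner I)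
        (Forest.ext (Finset.card_eq_zero.1 hn))
      rw [hc]
      exact smul c _ discrete
    | succ n ih =>
      obtain ⟨F', A, B, h, hF⟩ := x.forest.exists_join_eq (Finset.card_pos.1 (by omega))
      obtain ⟨y, rfl⟩ := F'.exists_innerForest
      have hy : y.forest.verts.card = n := by
        have hcard := card_join h
        rw [hF] at hcard
        omega
      obtain ⟨c, hc⟩ := Bess.exists_of_eq_smul_of (x := x) (y := y.join h) hF.symm
      rw [hc, ← Bess.joins_of_isJoin]
      exact smul c _ (join y A B h (ih y hy))

end Join

/-! ## Joins and relabelling -/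

section RelabelJoin

variable {I K : Type u} (e : I ≃ K)

theorem isNode_relabel_iff {F : Forest I} {A : Set I} :
    IsNode (F.relabel e).verts (e '' A) ↔ IsNode F.verts A := by
  refine ⟨?_, fun h => node_relabel e h⟩
  rintro (h | ⟨k, hk⟩)
  · obtain ⟨v, hv, h⟩ := Finset.mem_image.1 h
    exact Or.inl (e.injective.image_injective h ▸ hv)
  · refine Or.inr ⟨e.symm k, e.injective.image_injective ?_⟩
    simpa using hk

theorem isTree_relabel_iff {F : Forest I} {A : Set I} :
    (F.relabel e).IsTree (e '' A) ↔ F.IsTree A := by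
  rw [Forest.IsTree, Forest.IsTree, isNode_relabel_iff]
  refine and_congr_right fun _ => ⟨fun h N hN hA => ?_, fun h N hN hA => ?_⟩
  · exact e.injective.image_injective
      (h _ ((isNode_relabel_iff e).2 hN) (Set.image_mono hA))
  · obtain ⟨M, rfl⟩ := Set.image_surjective.2 e.surjective N
    rw [h M ((isNode_relabel_iff e).1 hN) ((Set.image_subset_image_iff e.injective).1 hA)]

theorem isJoin_relabel_iff {F : Forest I} {A B : Set I} :
    IsJoin (F.relabel e) (e '' A) (e '' B) ↔ IsJoin F A B :=
  ⟨fun h => ⟨(isTree_relabel_iff e).1 h.left, (isTree_relabel_iff e).1 h.right,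
      fun hAB => h.ne (hAB ▸ rfl)⟩,
    fun h => ⟨(isTree_relabel_iff e).2 h.left, (isTree_relabel_iff e).2 h.right,
      e.injective.image_injective.ne h.ne⟩⟩

theorem Bess.relabel_of (x : InnerForest I) :
    Bess.relabel e (Bess.of x) = Bess.of (x.relabel e) := Bess.lift_of _ _ _

theorem InnerForest.relabel_loc (x : InnerForest I) {v : Set I} (hv : v ∈ x.forest.verts) :
    (x.relabel e).loc (e '' v) = (x.loc v).map (Option.map (e '' ·)) :=
  pushLoc_apply (φ := fun v => e '' v) (η := fun _ A => e '' A)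
    e.injective.image_injective.injOn hv

theorem Bess.of_relabel_join (x : InnerForest I) {T T' : Set I} (h : IsJoin x.forest T T') :
    Bess.of ((x.join h).relabel e) =
      Bess.of ((x.relabel e).join ((isJoin_relabel_iff e).2 h)) := by
  refine Bess.of_eq_of_join _ ?_ ?_ ?_ fun w hw => ?_
  · simp [InnerForest.relabel, InnerForest.join, Forest.join, Forest.relabel, Finset.image_insert,
      Set.image_union]
  · simp [InnerForest.relabel, InnerForest.join, GlobalOrientation.cons, GlobalOrientation.map,
      Set.image_union]
  · rw [← Set.image_union, (x.join h).relabel_loc e (x.forest.mem_join h), x.join_loc_self]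
    rfl
  · obtain ⟨v, hv, rfl⟩ := Finset.mem_image.1 hw
    rw [(x.join h).relabel_loc e (x.forest.verts_subset_join h hv),
      x.join_loc_of_mem h hv, x.relabel_loc e hv]

/-- Relabelling of pairs of trees. -/
def JoinPair.relabel {F : Forest I} {A B : Set I} (P : JoinPair F A B) :
    JoinPair (F.relabel e) (e '' A) (e '' B) :=
  ⟨(e '' P.1.1, e '' P.1.2), (isJoin_relabel_iff e).2 P.2.1, Set.image_mono P.2.2.1,
    Set.image_mono P.2.2.2⟩

theorem JoinPair.relabel_bijective {F : Forest I} {A B : Set I} :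
    Function.Bijective (JoinPair.relabel e : JoinPair F A B → _) := by
  constructor
  · intro P Q hPQ
    obtain ⟨hleft, hright⟩ := Prod.mk.inj (congrArg Subtype.val hPQ)
    exact Subtype.ext (Prod.ext (e.injective.image_injective hleft)
      (e.injective.image_injective hright))
  · rintro ⟨⟨S, S'⟩, h, hS, hS'⟩
    obtain ⟨T, rfl⟩ := Set.image_surjective.2 e.surjective S
    obtain ⟨T', rfl⟩ := Set.image_surjective.2 e.surjective S'
    exact ⟨⟨(T, T'), (isJoin_relabel_iff e).1 h, (Set.image_subset_image_iff e.injective).1 hS,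
      (Set.image_subset_image_iff e.injective).1 hS'⟩, rfl⟩

theorem Bess.relabel_joins [Finite I] [Finite K] (A B : Set I) (z : Bess I) :
    Bess.relabel e (Bess.joins A B z) = Bess.joins (e '' A) (e '' B) (Bess.relabel e z) := by
  suffices Bess.relabel e ∘ₗ Bess.joins A B = Bess.joins (e '' A) (e '' B) ∘ₗ Bess.relabel e from
    LinearMap.congr_fun this z
  refine Bess.hom_ext fun x => ?_
  rw [LinearMap.comp_apply, LinearMap.comp_apply, Bess.relabel_of, Bess.joins_of, Bess.joins_of,
    map_sum]
  exact Fintype.sum_bijective _ (JoinPair.relabel_bijective e) _ _ fun P => by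
    rw [Bess.relabel_of, Bess.of_relabel_join]; rfl

end RelabelJoin

/-! ## The coproduct given by the formula -/

section Letters

variable {I : Type u}

/-- The word `w' ∧ r ∧ w''`. -/
def splitLetters (w' w'' : List (Option (Set I))) : List (Letter I) :=
  w'.map (fun a => a.elim Letter.R' Letter.vert) ++ [Letter.r] ++
    w''.map (fun a => a.elim Letter.R'' Letter.vert)

/-- The word `w` in which `R` is replaced by `R' ∧ r ∧ R''`. -/
def fullLetters (w : List (Option (Set I))) : List (Letter I) :=
  w.flatMap fun a => a.elim [Letter.R', Letter.r, Letter.R''] fun v => [Letter.vert v]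

theorem splitLetters_swap_left {l l' : List (Option (Set I))} (h : AdjSwap l l')
    (w : List (Option (Set I))) : AdjSwap (splitLetters l w) (splitLetters l' w) :=
  ((h.map _).append_right _).append_right _

theorem splitLetters_swap_right {l l' : List (Option (Set I))} (h : AdjSwap l l')
    (w : List (Option (Set I))) : AdjSwap (splitLetters w l) (splitLetters w l') :=
  (h.map _).append_left _

theorem wedge_vert_swap (v : Set I) :
    wedge [Letter.vert v, Letter.R', Letter.r, Letter.R''] =
      -wedge [Letter.R', Letter.r, Letter.R'', Letter.vert v] := by
  have past_R' : AdjSwap [Letter.vert v, Letter.R', Letter.r, Letter.R'']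
      [Letter.R', Letter.vert v, Letter.r, Letter.R''] := ⟨[], _, _, _, rfl, rfl⟩
  have past_r : AdjSwap [Letter.R', Letter.vert v, Letter.r, Letter.R'']
      [Letter.R', Letter.r, Letter.vert v, Letter.R''] := ⟨[_], _, _, _, rfl, rfl⟩
  have past_R'' : AdjSwap [Letter.R', Letter.r, Letter.vert v, Letter.R'']
      [Letter.R', Letter.r, Letter.R'', Letter.vert v] := ⟨[_, _], _, _, _, rfl, rfl⟩
  rw [wedge_swap past_R', wedge_swap past_r, wedge_swap past_R'', neg_neg]

-- `R` is replaced by three letters, an odd number, so exchanges still change the sign.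
theorem wedge_fullLetters_swap {l l' : List (Option (Set I))} (h : AdjSwap l l')
    (hn : l.Nodup) : wedge (fullLetters l) = -wedge (fullLetters l') := by
  obtain ⟨a, x, y, b, rfl, rfl⟩ := h
  have split : ∀ x y : Option (Set I), fullLetters (a ++ x :: y :: b) =
      fullLetters a ++ (fullLetters [x, y] ++ fullLetters b) := fun x y => by
    simp [fullLetters]
  have swap : wedge (fullLetters [x, y]) = -wedge (fullLetters [y, x]) := by
    rcases x with _ | v <;> rcases y with _ | w
    · exact absurd hn (by simp [List.nodup_append])
    · exact (neg_eq_iff_eq_neg.2 (wedge_vert_swap w)).symm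
    · exact wedge_vert_swap v
    · exact wedge_swap ⟨[], _, _, [], rfl, rfl⟩
  rw [split, split, wedge_append, wedge_append, wedge_append, wedge_append, swap, neg_mul, mul_neg]

theorem nodup_fullLetters {V : Finset (Set I)} {w : List (Option (Set I))} (h : IsWord V w) :
    (fullLetters w).Nodup := by
  rw [fullLetters, List.nodup_flatMap]
  refine ⟨fun a _ => by rcases a with _ | a <;> simp, h.1.imp fun {a b} hab => ?_⟩
  rcases a with _ | a <;> rcases b with _ | b <;> simp_all [List.disjoint_left]

theorem nodup_splitLetters {V' V'' : Finset (Set I)} (hd : Disjoint V' V'')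
    {w' w'' : List (Option (Set I))} (h' : IsWord V' w') (h'' : IsWord V'' w'') :
    (splitLetters w' w'').Nodup := by
  have elim_injective : ∀ R : Letter I, (∀ v, R ≠ Letter.vert v) →
      Function.Injective fun a : Option (Set I) => a.elim R Letter.vert := by
    rintro R hR (_ | v) (_ | w) h
    · rfl
    · exact absurd h (hR w)
    · exact absurd h.symm (hR v)
    · exact congrArg some (Letter.vert.inj h)
  rw [splitLetters, List.append_assoc]
  refine (h'.1.map (elim_injective _ (by simp))).append
    ((List.nodup_singleton _).append (h''.1.map (elim_injective _ (by simp))) ?_) ?_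
  · simp [Option.forall]
  · simp only [List.disjoint_left, List.mem_map, List.mem_append, List.mem_singleton, Option.exists,
      Option.elim_none, Option.elim_some, h'.2, h''.2]
    rintro (v | _ | _ | _)
    · have hv : v ∈ V' → v ∉ V'' := fun hv => Finset.disjoint_left.1 hd hv
      simpa using hv
    all_goals simp

theorem splitLetters_perm {V V' : Finset (Set I)} (hV : V' ⊆ V) {w w' w'' : List (Option (Set I))}
    (h : IsWord V w) (h' : IsWord V' w') (h'' : IsWord (V \ V') w'') :
    (splitLetters w' w'').Perm (fullLetters w) := by
  refine (List.perm_ext_iff_of_nodup (nodup_splitLetters Finset.disjoint_sdiff h' h'')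
    (nodup_fullLetters h)).2 fun a => ?_
  simp only [splitLetters, fullLetters, List.mem_append, List.mem_map, List.mem_flatMap,
    Option.exists, Option.elim_none, Option.elim_some, h.2, h'.2, h''.2, Finset.mem_sdiff,
    List.mem_cons, List.not_mem_nil, or_false]
  rcases a with v | _ | _ | _
  · have : v ∈ V' → v ∈ V := fun hv => hV hv
    simpa using by tauto
  all_goals simp

end Letters

section GammaSum

variable {I : Type u}

theorem gammaInner_loc (x : InnerForest I) {V : Finset (Set I)} (o : GlobalOrientation V)
    (p : Gamma x.forest V) {v w : Set I} (hv : v ∈ V) (hw : p.vert v = w) :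
    (gammaInner x o p).loc w = (x.loc v).map (Option.map (· ∩ w)) :=
  hw ▸ pushLoc_apply (η := fun v A => A ∩ p.vert v) p.vert_injOn hv

theorem exists_splitSign (x : InnerForest I) {V' : Finset (Set I)} (h : V' ⊆ x.forest.verts)
    (o' : GlobalOrientation V') (o'' : GlobalOrientation (x.forest.verts \ V')) :
    ∃ c : ℚ, wedge (splitLetters o'.word o''.word) = c • wedge (fullLetters x.glob.word) := by
  obtain ⟨c, -, hc⟩ := exists_sign (splitLetters_perm h x.glob.isWord o'.isWord o''.isWord)
  exact ⟨c, hc wedge fun _ _ => wedge_swap⟩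

variable [Finite I]

theorem gammaSum_swap (x : InnerForest I) {V : Finset (Set I)} {o₁ o₂ : GlobalOrientation V}
    (h : AdjSwap o₁.word o₂.word) : gammaSum x o₁ = -gammaSum x o₂ := by
  rw [eq_neg_iff_add_eq_zero, gammaSum, gammaSum, ← Finset.sum_add_distrib]
  exact Finset.sum_eq_zero fun p _ => Bess.of_flip ⟨rfl, Or.inl ⟨h.map _, rfl⟩⟩

theorem exists_gammaSum_eq_smul (x : InnerForest I) {V : Finset (Set I)}
    (o₁ o₂ : GlobalOrientation V) :
    ∃ ε : ℚ, ε * ε = 1 ∧ gammaSum x o₁ = ε • gammaSum x o₂ ∧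
      ∀ {M : Type u} [AddCommGroup M] [Module ℚ M] (φ : List (Option (Set I)) → M),
        (∀ l l', AdjSwap l l' → φ l = -φ l') → φ o₁.word = ε • φ o₂.word := by
  obtain ⟨ε, hε, h⟩ := exists_sign (o₁.isWord.perm o₂.isWord)
  refine ⟨ε, hε, ?_, h⟩
  have extended := h (fun w => if hw : IsWord V w then gammaSum x ⟨w, hw.1, hw.2⟩ else 0) ?_
  · simpa only [o₁.isWord, o₂.isWord, dif_pos] using extended
  · intro l l' hl
    by_cases hw : IsWord V l
    · rw [dif_pos hw, dif_pos (hw.of_perm hl.perm)]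
      exact gammaSum_swap x hl
    · rw [dif_neg hw, dif_neg fun h => hw (h.of_perm hl.perm.symm), neg_zero]

/-- The summand of the coproduct of `x` for the splitting of the vertices into `V'` and its
complement, computed with standard orientations and corrected by the resulting sign. -/
def splitTerm (x : InnerForest I) (V' : Finset (Set I)) : Bess I ⊗[ℚ] Bess I :=
  if h : V' ⊆ x.forest.verts then
    (exists_splitSign x h (GlobalOrientation.std V') (GlobalOrientation.std _)).choose •
      gammaSum x (GlobalOrientation.std V') ⊗ₜ
        gammaSum x (GlobalOrientation.std (x.forest.verts \ V'))
  else 0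

theorem splitTerm_eq (x : InnerForest I) {V' : Finset (Set I)} (h : V' ⊆ x.forest.verts)
    (o' : GlobalOrientation V') (o'' : GlobalOrientation (x.forest.verts \ V')) {c : ℚ}
    (hc : wedge (splitLetters o'.word o''.word) = c • wedge (fullLetters x.glob.word)) :
    splitTerm x V' = c • gammaSum x o' ⊗ₜ gammaSum x o'' := by
  rw [splitTerm, dif_pos h]
  have hd := (exists_splitSign x h (GlobalOrientation.std V') (GlobalOrientation.std _)).choose_spec
  set d := (exists_splitSign x h (GlobalOrientation.std V') (GlobalOrientation.std _)).choose
  obtain ⟨ε', sq', gamma', sign'⟩ := exists_gammaSum_eq_smul x (GlobalOrientation.std V') o'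
  obtain ⟨ε'', sq'', gamma'', sign''⟩ :=
    exists_gammaSum_eq_smul x (GlobalOrientation.std (x.forest.verts \ V')) o''
  rw [sign' (fun w => wedge (splitLetters w _)) fun _ _ hl =>
      wedge_swap (splitLetters_swap_left hl _),
    sign'' (fun w => wedge (splitLetters _ w)) fun _ _ hl =>
      wedge_swap (splitLetters_swap_right hl _), hc, smul_smul, smul_smul] at hd
  have d_eq : ε' * (ε'' * c) = d := by
    simpa only [mul_assoc] using eq_of_smul_wedge_eq (nodup_fullLetters x.glob.isWord) hd
  have sign_cancel : ε' * (ε'' * c) * (ε' * ε'') = c := by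
    linear_combination (ε'' * ε'' * c) * sq' + c * sq''
  rw [gamma', gamma'', TensorProduct.smul_tmul_smul, smul_smul, ← d_eq, sign_cancel]

theorem gammaSum_congr {x y : InnerForest I} (hF : x.forest = y.forest) {V : Finset (Set I)}
    (o : GlobalOrientation V) (h : ∀ v ∈ V, x.loc v = y.loc v) : gammaSum x o = gammaSum y o := by
  obtain ⟨F, g, l, _, _, _⟩ := x
  obtain ⟨_, g', l', _, _, _⟩ := y
  obtain rfl : F = _ := hF
  refine Finset.sum_congr rfl fun p _ => Bess.of_congr rfl rfl fun w hw => ?_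
  obtain ⟨v, hv, rfl⟩ := Finset.mem_image.1 (p.verts_eq ▸ hw)
  exact (gammaInner_loc _ o p hv rfl).trans
    ((congrArg _ (h v hv)).trans (gammaInner_loc ⟨F, g', l', _, _, _⟩ o p hv rfl).symm)

theorem gammaSum_flip {x y : InnerForest I} (hF : x.forest = y.forest) {V : Finset (Set I)}
    (o : GlobalOrientation V) {v : Set I} (hv : v ∈ V) (h : AdjSwap (x.loc v) (y.loc v))
    (h' : ∀ w, w ≠ v → x.loc w = y.loc w) : gammaSum x o = -gammaSum y o := by
  obtain ⟨F, g, l, _, _, _⟩ := x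
  obtain ⟨_, g', l', _, _, _⟩ := y
  obtain rfl : F = _ := hF
  rw [eq_neg_iff_add_eq_zero, gammaSum, gammaSum, ← Finset.sum_add_distrib]
  refine Finset.sum_eq_zero fun p _ => Bess.of_flip ⟨rfl, Or.inr ⟨rfl, p.vert v, ?_⟩⟩
  exact pushLoc_flip (η := fun v A => A ∩ p.vert v) p.vert_injOn hv h h'

theorem splitTerm_flip {x y : InnerForest I} (h : Flip x y) {V' : Finset (Set I)}
    (hV : V' ⊆ x.forest.verts) : splitTerm x V' = -splitTerm y V' := by
  obtain ⟨F, g, l, hl₁, hl₂, hl₃⟩ := x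
  obtain ⟨F', g', l', hl₁', hl₂', hl₃'⟩ := y
  obtain ⟨hF, h⟩ := h
  obtain rfl : F = F' := hF
  set x : InnerForest I := ⟨F, g, l, hl₁, hl₂, hl₃⟩
  set y : InnerForest I := ⟨F, g', l', hl₁', hl₂', hl₃'⟩
  have hF : x.forest = y.forest := rfl
  set o' := GlobalOrientation.std V'
  set o'' := GlobalOrientation.std (F.verts \ V')
  obtain ⟨c, hc⟩ := exists_splitSign x hV o' o''
  rw [splitTerm_eq x hV o' o'' hc]
  rcases h with ⟨hglob, hloc⟩ | ⟨hglob, v, hswap, hoff⟩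
  · have hc' : wedge (splitLetters o'.word o''.word) = (-c) • wedge (fullLetters y.glob.word) := by
      rw [hc, wedge_fullLetters_swap hglob x.glob.nodup, smul_neg, neg_smul]
    rw [splitTerm_eq y hV o' o'' hc', TensorProduct.smul_tmul', TensorProduct.smul_tmul', neg_smul,
      TensorProduct.neg_tmul, neg_neg,
      gammaSum_congr hF o' fun v _ => congrFun hloc v,
      gammaSum_congr hF o'' fun v _ => congrFun hloc v]
  · rw [splitTerm_eq y hV o' o'' (hglob ▸ hc)]
    by_cases hv : v ∈ V'
    · rw [gammaSum_flip hF o' hv hswap hoff, gammaSum_congr hF o'' fun w hw =>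
        hoff w fun hwv => (Finset.mem_sdiff.1 hw).2 (hwv ▸ hv), TensorProduct.neg_tmul, smul_neg]
    · have hv'' : v ∈ F.verts \ V' := Finset.mem_sdiff.2 ⟨flip_vertex_mem x hswap, hv⟩
      rw [gammaSum_flip hF o'' hv'' hswap hoff, gammaSum_congr hF o' fun w hw =>
        hoff w fun hwv => hv (hwv ▸ hw), TensorProduct.tmul_neg, smul_neg]

variable (I) in
/-- The coproduct, defined by the formula of the proposition. -/
def coproduct : Bess I →ₗ[ℚ] Bess I ⊗[ℚ] Bess I :=
  Bess.lift (fun x => ∑ V' ∈ x.forest.verts.powerset, splitTerm x V') <| by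
    intro x y h
    rw [← h.1, ← Finset.sum_add_distrib]
    refine Finset.sum_eq_zero fun V' hV => ?_
    rw [splitTerm_flip h (Finset.mem_powerset.1 hV), neg_add_cancel]

theorem coproduct_of (x : InnerForest I) :
    coproduct I (Bess.of x) = ∑ V' ∈ x.forest.verts.powerset, splitTerm x V' :=
  Bess.lift_of _ _ _

theorem coproduct_formula (x : InnerForest I)
    (o' : ∀ V' : Finset (Set I), GlobalOrientation V')
    (o'' : ∀ V' : Finset (Set I), GlobalOrientation (x.forest.verts \ V'))
    (h : ∀ V' ⊆ x.forest.verts, Compatible (o' V') (o'' V') x.glob) :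
    coproduct I (Bess.of x) =
      ∑ V' ∈ x.forest.verts.powerset, gammaSum x (o' V') ⊗ₜ[ℚ] gammaSum x (o'' V') := by
  rw [coproduct_of]
  refine Finset.sum_congr rfl fun V' hV' => ?_
  have hV : V' ⊆ x.forest.verts := Finset.mem_powerset.1 hV'
  rw [splitTerm_eq x hV (o' V') (o'' V') (c := 1) ((h V' hV).trans (one_smul ℚ _).symm), one_smul]

end GammaSum

/-! ## The coproduct of a join -/

section GammaJoin

variable {I : Type u} {F : Forest I} {T T' : Set I}

theorem Gamma.vert_eq {V : Finset (Set I)} (p : Gamma F V) (w : p.forest.verts) {v : Set I}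
    (h : (p.hom.toFun w : Set I) = v) : p.vert v = w := h ▸ p.vert_hom w

theorem Gamma.exists_vert {V : Finset (Set I)} (p : Gamma F V) {v : Set I} (hv : v ∈ V) :
    ∃ w : p.forest.verts, (p.hom.toFun w : Set I) = v ∧ p.vert v = w := by
  obtain ⟨w, hw⟩ := (p.range v).1 hv
  exact ⟨w, hw, p.vert_eq w hw⟩

/-- The composition of a map of forests with the inclusion of a forest into one with more
vertices. -/
def Forest.Hom.mono {F' G : Forest I} (f : Forest.Hom F' F) (hFG : F.verts ⊆ G.verts) :
    Forest.Hom F' G where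
  toFun w := ⟨f.toFun w, hFG (f.toFun w).2⟩
  injective v w e := f.injective (Subtype.ext (Subtype.mk.inj e))
  increasing := f.increasing
  leaves := f.leaves
  branches v A' B' hs := by
    obtain ⟨A, B, hs', hAB⟩ := f.branches v A' B' hs
    exact ⟨A, B, hs'.mono hFG, hAB⟩

/-- The restriction of a map of forests to smaller sets of vertices. -/
def Forest.Hom.restrict {F' G G' : Forest I} (f : Forest.Hom G' G) (hF : F.verts ⊆ G.verts)
    (hF' : F'.verts ⊆ G'.verts)
    (hf : ∀ w : F'.verts, (f.toFun ⟨w, hF' w.2⟩ : Set I) ∈ F.verts) : Forest.Hom F' F where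
  toFun w := ⟨f.toFun ⟨w, hF' w.2⟩, hf w⟩
  injective v w e :=
    Subtype.ext (Subtype.mk.inj (f.injective (Subtype.ext (Subtype.mk.inj e))))
  increasing v w hvw := f.increasing _ _ hvw
  leaves v := f.leaves ⟨v, hF' v.2⟩
  branches v A' B' hs := by
    obtain ⟨A, B, hs', hAB⟩ := f.branches ⟨v, hF' v.2⟩ A' B' (hs.mono hF')
    exact ⟨A, B, (Forest.isSplit_iff_of_subset hF (hf v)).1 hs', hAB⟩

/-- The restriction of an element of `γ(G, U)` to the vertices which correspond to `V`. -/
def Gamma.restrict {G F' : Forest I} {U V : Finset (Set I)} (q : Gamma G U)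
    (hF : F.verts ⊆ G.verts) (hV : V ⊆ F.verts) (hVU : V ⊆ U) (hF' : F'.verts ⊆ q.forest.verts)
    (hmem : ∀ w : q.forest.verts, (w : Set I) ∈ F'.verts ↔ (q.hom.toFun w : Set I) ∈ V) :
    Gamma F V where
  forest := F'
  hom := q.hom.restrict hF hF' fun w => hV ((hmem ⟨w, hF' w.2⟩).1 w.2)
  range v := by
    refine ⟨fun hv => ?_, ?_⟩
    · obtain ⟨w, rfl⟩ := (q.range v).1 (hVU hv)
      exact ⟨⟨w, (hmem w).2 hv⟩, rfl⟩
    · rintro ⟨w, rfl⟩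
      exact (hmem ⟨w, hF' w.2⟩).1 w.2

/-- An element of `γ(F, V)` as an element of `γ` of a join. -/
def Gamma.toJoin (h : IsJoin F T T') {V : Finset (Set I)} (p : Gamma F V) :
    Gamma (F.join h) V where
  forest := p.forest
  hom := p.hom.mono (F.verts_subset_join h)
  range := p.range

theorem Gamma.toJoin_bijective (h : IsJoin F T T') {V : Finset (Set I)} (hV : V ⊆ F.verts) :
    Function.Bijective (Gamma.toJoin h : Gamma F V → Gamma (F.join h) V) := by
  refine ⟨fun p q e => Gamma.forest_injective V ?_, fun q => ?_⟩
  · exact congrArg (fun r : Gamma (F.join h) V => r.forest) e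
  · exact ⟨q.restrict (F.verts_subset_join h) hV subset_rfl subset_rfl fun w =>
      iff_of_true w.2 ((q.range _).2 ⟨w, rfl⟩), Gamma.forest_injective V rfl⟩

theorem GlobalOrientation.map_word_congr {K : Type u} {V : Finset (Set I)}
    (o : GlobalOrientation V) {φ ψ : Set I → Set K} (h : ∀ v ∈ V, φ v = ψ v) :
    o.word.map (Option.map φ) = o.word.map (Option.map ψ) := by
  refine List.map_congr_left fun a ha => ?_
  rcases (o.mem_iff a).1 ha with rfl | ⟨v, hv, rfl⟩
  · rfl
  · rw [Option.map_some, Option.map_some, h v hv]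

theorem gammaSum_join [Finite I] (x : InnerForest I) (h : IsJoin x.forest T T')
    {V : Finset (Set I)} (hV : V ⊆ x.forest.verts) (o : GlobalOrientation V) :
    gammaSum (x.join h) o = gammaSum x o := by
  symm
  refine Fintype.sum_bijective _ (Gamma.toJoin_bijective h hV) _ _ fun p => ?_
  have vert_eq : ∀ v ∈ V, p.vert v = (p.toJoin h).vert v := by
    intro v hv
    obtain ⟨w, hw, hvw⟩ := p.exists_vert hv
    rw [hvw, (p.toJoin h).vert_eq w hw]
  refine Bess.of_congr rfl (o.map_word_congr vert_eq) fun w hw => ?_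
  obtain ⟨v, hv, rfl⟩ := Finset.mem_image.1 ((p.toJoin h).verts_eq ▸ hw)
  refine (gammaInner_loc x o p hv (vert_eq v hv)).trans ?_
  rw [← x.join_loc_of_mem h (hV hv)]
  exact (gammaInner_loc (x.join h) o (p.toJoin h) hv rfl).symm

theorem IsJoin.not_union_subset (h : IsJoin F T T') {w : Set I} (hw : w ∈ F.verts) :
    ¬ T ∪ T' ⊆ w := fun hsub =>
  h.ne ((h.left.2 w (Or.inl hw) (Set.subset_union_left.trans hsub)).symm.trans
    (h.right.2 w (Or.inl hw) (Set.subset_union_right.trans hsub)))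

section Hom

variable {F' : Forest I} {t t' : Set I} (f : Forest.Hom F' F) (h : IsJoin F T T')
  (h' : IsJoin F' t t')

/-- The extension of a map of forests to joins which sends the new vertex to the new vertex. -/
def Forest.Hom.joinFun (w : (F'.join h').verts) : (F.join h).verts :=
  if hw : w.1 ∈ F'.verts then
    ⟨f.toFun ⟨w.1, hw⟩, F.verts_subset_join h (f.toFun ⟨w.1, hw⟩).2⟩ else ⟨T ∪ T', F.mem_join h⟩

theorem Forest.Hom.joinFun_of_mem {w : Set I} (hw : w ∈ F'.verts) :
    (f.joinFun h h' ⟨w, F'.verts_subset_join h' hw⟩ : Set I) = f.toFun ⟨w, hw⟩ := by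
  rw [Forest.Hom.joinFun, dif_pos hw]

theorem Forest.Hom.joinFun_new :
    (f.joinFun h h' ⟨t ∪ t', F'.mem_join h'⟩ : Set I) = T ∪ T' := by
  rw [Forest.Hom.joinFun, dif_neg h'.notMem]

theorem Forest.Hom.joinFun_injective : Function.Injective (f.joinFun h h') := by
  rintro ⟨v, hv⟩ ⟨w, hw⟩ e
  replace e := congrArg Subtype.val e
  rcases Finset.mem_insert.1 hv with rfl | hv <;> rcases Finset.mem_insert.1 hw with rfl | hw
  · rfl
  · rw [f.joinFun_new, f.joinFun_of_mem h h' hw] at e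
    exact absurd e.symm (h.ne_of_mem (f.toFun _).2)
  · rw [f.joinFun_new, f.joinFun_of_mem h h' hv] at e
    exact absurd e (h.ne_of_mem (f.toFun _).2)
  · rw [f.joinFun_of_mem h h' hv, f.joinFun_of_mem h h' hw] at e
    exact Subtype.ext (Subtype.mk.inj (f.injective (Subtype.ext e)))

theorem Forest.Hom.joinFun_increasing (ht : t ⊆ T) (ht' : t' ⊆ T') (v w : (F'.join h').verts)
    (hvw : (v : Set I) ⊆ w) :
    (f.joinFun h h' v : Set I) ⊆ f.joinFun h h' w := by
  obtain ⟨v, hv⟩ := v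
  obtain ⟨w, hw⟩ := w
  rcases Finset.mem_insert.1 hv with rfl | hv <;> rcases Finset.mem_insert.1 hw with rfl | hw
  · rfl
  · exact absurd hvw (h'.not_union_subset hw)
  · rw [f.joinFun_new, f.joinFun_of_mem h h' hv]
    obtain ⟨a, ha⟩ := F'.nonempty v hv
    refine (h.node_subset_or_disjoint (Or.inl (f.toFun ⟨v, hv⟩).2)).resolve_right fun hdisj => ?_
    exact Set.disjoint_left.1 hdisj (f.leaves ⟨v, hv⟩ a ha)
      (Set.union_subset_union ht ht' (hvw ha))
  · rw [f.joinFun_of_mem h h' hv, f.joinFun_of_mem h h' hw]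
    exact f.increasing ⟨v, hv⟩ ⟨w, hw⟩ hvw

/-- The extension of a map of forests to the joins of trees `t ⊆ T` and `t' ⊆ T'`. -/
def Forest.Hom.join (ht : t ⊆ T) (ht' : t' ⊆ T') : Forest.Hom (F'.join h') (F.join h) where
  toFun := f.joinFun h h'
  injective := f.joinFun_injective h h'
  increasing := f.joinFun_increasing h h' ht ht'
  leaves := by
    rintro ⟨v, hv⟩ i hi
    rcases Finset.mem_insert.1 hv with rfl | hv
    · rw [f.joinFun_new]
      exact Set.union_subset_union ht ht' hi
    · rw [f.joinFun_of_mem h h' hv]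
      exact f.leaves ⟨v, hv⟩ i hi
  branches := by
    rintro ⟨v, hv⟩ A' B' hs
    rcases Finset.mem_insert.1 hv with rfl | hv
    · rw [f.joinFun_new]
      rcases (F'.join h').split_unique (join_split h') hs with ⟨rfl, rfl⟩ | ⟨rfl, rfl⟩
      · exact ⟨T, T', join_split h, ht, ht'⟩
      · exact ⟨T', T, Forest.split_symm (join_split h), ht', ht⟩
    · rw [f.joinFun_of_mem h h' hv]
      obtain ⟨A, B, hs', hAB⟩ := f.branches ⟨v, hv⟩ A' B'
        ((Forest.isSplit_iff_of_subset (F'.verts_subset_join h') hv).1 hs)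
      exact ⟨A, B, hs'.mono (F.verts_subset_join h), hAB⟩

end Hom

variable {U V : Finset (Set I)}

/-- An element of `γ(F, V)` and a pair of its trees in `T` and `T'` give an element of `γ` of the
join of `T` and `T'`. -/
def Gamma.join (h : IsJoin F T T') (hU : U = insert (T ∪ T') V)
    (p : Gamma F V) (P : JoinPair p.forest T T') : Gamma (F.join h) U where
  forest := p.forest.join P.2.1
  hom := p.hom.join h P.2.1 P.2.2.1 P.2.2.2
  range := by
    intro v
    rw [hU, Finset.mem_insert, p.range]
    constructor
    · rintro (rfl | ⟨w, rfl⟩)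
      · exact ⟨⟨P.1.1 ∪ P.1.2, p.forest.mem_join P.2.1⟩, p.hom.joinFun_new h P.2.1⟩
      · exact ⟨⟨w, p.forest.verts_subset_join P.2.1 w.2⟩, p.hom.joinFun_of_mem h P.2.1 w.2⟩
    · rintro ⟨⟨w, hw⟩, rfl⟩
      rcases Finset.mem_insert.1 hw with rfl | hw
      · exact Or.inl (p.hom.joinFun_new h P.2.1)
      · exact Or.inr ⟨⟨w, hw⟩, (p.hom.joinFun_of_mem h P.2.1 hw).symm⟩

theorem Gamma.join_vert_new (h : IsJoin F T T') (hU : U = insert (T ∪ T') V) (p : Gamma F V)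
    (P : JoinPair p.forest T T') : (p.join h hU P).vert (T ∪ T') = P.1.1 ∪ P.1.2 :=
  (p.join h hU P).vert_eq ⟨P.1.1 ∪ P.1.2, p.forest.mem_join P.2.1⟩ (p.hom.joinFun_new h P.2.1)

theorem Gamma.join_vert_of_mem (h : IsJoin F T T') (hU : U = insert (T ∪ T') V) (p : Gamma F V)
    (P : JoinPair p.forest T T') {v : Set I} (hv : v ∈ V) :
    (p.join h hU P).vert v = p.vert v := by
  obtain ⟨w, hw, hvw⟩ := p.exists_vert hv
  rw [hvw]
  exact (p.join h hU P).vert_eq ⟨w, p.forest.verts_subset_join P.2.1 w.2⟩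
    ((p.hom.joinFun_of_mem h P.2.1 w.2).trans hw)

theorem inter_union_eq_left {t t' : Set I} (hd : Disjoint T T') (ht : t ⊆ T) (ht' : t' ⊆ T') :
    T ∩ (t ∪ t') = t := by
  rw [Set.inter_union_distrib_left, Set.inter_eq_right.2 ht, (hd.mono_right ht').inter_eq,
    Set.union_empty]

theorem JoinPair.left_eq (h : IsJoin F T T') {F' : Forest I} (P : JoinPair F' T T') :
    T ∩ (P.1.1 ∪ P.1.2) = P.1.1 :=
  inter_union_eq_left h.disjoint P.2.2.1 P.2.2.2

theorem JoinPair.right_eq (h : IsJoin F T T') {F' : Forest I} (P : JoinPair F' T T') :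
    T' ∩ (P.1.1 ∪ P.1.2) = P.1.2 := by
  rw [Set.union_comm, inter_union_eq_left h.disjoint.symm P.2.2.2 P.2.2.1]

theorem Gamma.join_injective (h : IsJoin F T T') (hU : U = insert (T ∪ T') V) :
    Function.Injective fun Q : Σ p : Gamma F V, JoinPair p.forest T T' => Q.1.join h hU Q.2 := by
  rintro ⟨p, P⟩ ⟨q, Q⟩ e
  dsimp only at e
  have root_eq : P.1.1 ∪ P.1.2 = Q.1.1 ∪ Q.1.2 := by
    rw [← p.join_vert_new h hU P, e, q.join_vert_new h hU Q]
  have verts_eq : insert (P.1.1 ∪ P.1.2) p.forest.verts = insert (Q.1.1 ∪ Q.1.2) q.forest.verts :=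
    congrArg (fun r : Gamma (F.join h) U => r.forest.verts) e
  obtain rfl : p = q := by
    refine Gamma.forest_injective V (Forest.ext ?_)
    rw [← Finset.erase_insert P.2.1.notMem, verts_eq, root_eq, Finset.erase_insert Q.2.1.notMem]
  obtain rfl : P = Q := Subtype.ext (Prod.ext (by rw [← P.left_eq h, root_eq, Q.left_eq h])
    (by rw [← P.right_eq h, root_eq, Q.right_eq h]))
  rfl

theorem Gamma.vert_union_maximal (h : IsJoin F T T') (q : Gamma (F.join h) U) (hU : T ∪ T' ∈ U) :
    ∀ w ∈ q.forest.verts, q.vert (T ∪ T') ⊆ w → w ⊆ q.vert (T ∪ T') := by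
  intro w hw hsub
  obtain ⟨m, hm, hvert⟩ := q.exists_vert hU
  have hle : T ∪ T' ⊆ q.hom.toFun ⟨w, hw⟩ := hm ▸ q.hom.increasing m ⟨w, hw⟩ (hvert ▸ hsub)
  have heq : (q.hom.toFun ⟨w, hw⟩ : Set I) = T ∪ T' :=
    (Finset.mem_insert.1 (q.hom.toFun ⟨w, hw⟩).2).resolve_right fun hF =>
      h.not_union_subset hF hle
  exact (q.vert_eq ⟨w, hw⟩ heq).symm.subset

theorem Gamma.join_surjective (h : IsJoin F T T') (hV : V ⊆ F.verts)
    (hU : U = insert (T ∪ T') V) :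
    Function.Surjective fun Q : Σ p : Gamma F V, JoinPair p.forest T T' => Q.1.join h hU Q.2 := by
  intro q
  have hmemU : T ∪ T' ∈ U := hU ▸ Finset.mem_insert_self _ _
  obtain ⟨m, hm, hvert⟩ := q.exists_vert hmemU
  have hs := q.split hmemU (join_split h)
  obtain ⟨F', hjoin, hF'⟩ := q.forest.exists_join_eq_of_maximal (hvert ▸ m.2)
    (q.vert_union_maximal h hmemU) hs
  have union_eq : T ∩ q.vert (T ∪ T') ∪ T' ∩ q.vert (T ∪ T') = q.vert (T ∪ T') := hs.2.2.2
  have verts_eq : q.forest.verts = insert (q.vert (T ∪ T')) F'.verts :=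
    (congrArg Forest.verts hF').symm.trans (congrArg (insert · F'.verts) union_eq)
  have root_notMem : q.vert (T ∪ T') ∉ F'.verts := fun hmem =>
    hjoin.notMem (by rwa [union_eq])
  have mem_iff : ∀ w : q.forest.verts, (w : Set I) ∈ F'.verts ↔ (q.hom.toFun w : Set I) ∈ V := by
    intro w
    by_cases hw : w = m
    · subst hw
      rw [hm, ← hvert]
      exact iff_of_false root_notMem fun hmem => h.notMem (hV hmem)
    · refine iff_of_true ((Finset.mem_insert.1 (verts_eq ▸ w.2)).resolve_left fun e =>
        hw (Subtype.ext (e.trans hvert))) ?_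
      refine (Finset.mem_insert.1 (hU ▸ (q.range _).2 ⟨w, rfl⟩)).resolve_left fun e =>
        hw (q.hom.injective (Subtype.ext (e.trans hm.symm)))
  exact ⟨⟨q.restrict (F.verts_subset_join h) hV (hU ▸ Finset.subset_insert _ _)
      (verts_eq ▸ Finset.subset_insert _ _) mem_iff,
    ⟨(_, _), hjoin, Set.inter_subset_left, Set.inter_subset_left⟩⟩, Gamma.forest_injective U hF'⟩

theorem gammaSum_join_insert [Finite I] (x : InnerForest I) (h : IsJoin x.forest T T')
    (hV : V ⊆ x.forest.verts) (hU : U = insert (T ∪ T') V) (o : GlobalOrientation V)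
    (o₁ : GlobalOrientation U) (ho : o₁.word = some (T ∪ T') :: o.word) :
    gammaSum (x.join h) o₁ = Bess.joins T T' (gammaSum x o) := by
  rw [gammaSum, gammaSum, map_sum]
  simp only [Bess.joins_of]
  rw [← Fintype.sum_sigma']
  symm
  refine Fintype.sum_bijective _ ⟨Gamma.join_injective h hU, Gamma.join_surjective h hV hU⟩ _ _ ?_
  rintro ⟨p, P⟩
  have vert_new := p.join_vert_new h hU P
  have vert_eq : ∀ v ∈ V, (p.join h hU P).vert v = p.vert v := fun v hv =>
    p.join_vert_of_mem h hU P hv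
  symm
  refine Bess.of_eq_of_join P.2.1 rfl ?_ ?_ fun w hw => ?_
  · simp only [gammaInner, GlobalOrientation.map, ho, List.map_cons, Option.map_some]
    exact congrArg₂ List.cons (congrArg some vert_new) (o.map_word_congr vert_eq)
  · refine (gammaInner_loc (x.join h) o₁ (p.join h hU P) (hU ▸ Finset.mem_insert_self _ _)
      vert_new).trans ?_
    rw [x.join_loc_self]
    simp only [List.map_cons, List.map_nil, Option.map_none, Option.map_some, P.left_eq h,
      P.right_eq h]
  · obtain ⟨v, hv, rfl⟩ := Finset.mem_image.1 (p.verts_eq ▸ hw)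
    refine (gammaInner_loc (x.join h) o₁ (p.join h hU P) (hU ▸ Finset.mem_insert_of_mem hv)
      (vert_eq v hv)).trans ?_
    rw [x.join_loc_of_mem h (hV hv)]
    exact (gammaInner_loc x o p hv rfl).symm

end GammaJoin

section Grading

variable {I : Type u}

variable (I) in
/-- The operator `(-1) ^ deg`, which produces the Koszul signs. -/
def Bess.sign : Bess I →ₗ[ℚ] Bess I := LinearMap.id - (2 : ℚ) • Bess.oddPart I

theorem Bess.oddPart_of (x : InnerForest I) : Bess.oddPart I (Bess.of x) =
    if Odd x.forest.verts.card then Bess.of x else 0 := Bess.lift_of _ _ _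

theorem Bess.sign_of (x : InnerForest I) :
    Bess.sign I (Bess.of x) = (-1 : ℚ) ^ x.forest.verts.card • Bess.of x := by
  rw [Bess.sign, LinearMap.sub_apply, LinearMap.smul_apply, Bess.oddPart_of, LinearMap.id_apply]
  split_ifs with h
  · rw [h.neg_one_pow]
    module
  · rw [(Nat.not_odd_iff_even.1 h).neg_one_pow]
    module

theorem Gamma.card {F : Forest I} {V : Finset (Set I)} (p : Gamma F V) :
    p.forest.verts.card = V.card := by
  rw [p.verts_eq, Finset.card_image_of_injOn p.vert_injOn]

theorem wedge_move {α : Type u} (l : List α) (a : α) (l' : List α) :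
    wedge (l ++ a :: l') = (-1 : ℚ) ^ l.length • wedge (a :: (l ++ l')) := by
  induction l with
  | nil => simp
  | cons b l ih =>
    have h : AdjSwap (b :: a :: (l ++ l')) (a :: b :: (l ++ l')) := ⟨[], _, _, _, rfl, rfl⟩
    rw [List.cons_append, wedge_cons, ih, mul_smul_comm, ← wedge_cons, wedge_swap h,
      List.length_cons, pow_succ]
    simp

theorem IsWord.length {V : Finset (Set I)} {w : List (Option (Set I))}
    (h : IsWord V w) : w.length = V.card + 1 := by
  rw [(h.perm (isWord_toList V)).length_eq]
  simp

theorem wedge_fullLetters_join (x : InnerForest I) {T T' : Set I} (h : IsJoin x.forest T T') :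
    wedge (fullLetters (x.join h).glob.word) =
      wedge [Letter.vert (T ∪ T')] * wedge (fullLetters x.glob.word) :=
  wedge_append [Letter.vert (T ∪ T')] _

theorem Gamma.liesOver {F : Forest I} {V : Finset (Set I)} (p : Gamma F V) :
    LiesOver id p.forest F := fun w hw =>
  ⟨p.hom.toFun ⟨w, hw⟩, Or.inl (p.hom.toFun ⟨w, hw⟩).2, p.hom.leaves ⟨w, hw⟩⟩

variable [Finite I]

theorem Bess.sign_gammaSum (x : InnerForest I) {V : Finset (Set I)} (o : GlobalOrientation V) :
    Bess.sign I (gammaSum x o) = (-1 : ℚ) ^ V.card • gammaSum x o := by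
  rw [gammaSum, map_sum, Finset.smul_sum]
  exact Finset.sum_congr rfl fun p _ => by rw [Bess.sign_of]; simp only [gammaInner, p.card]

/-- The action of a join operator as a derivation of degree one on `Bess ⊗ Bess`. -/
def tensorJoins (A B : Set I) : Bess I ⊗[ℚ] Bess I →ₗ[ℚ] Bess I ⊗[ℚ] Bess I :=
  TensorProduct.map (Bess.joins A B) LinearMap.id +
    TensorProduct.map (Bess.sign I) (Bess.joins A B)

theorem tensorJoins_tmul (A B : Set I) (a b : Bess I) :
    tensorJoins A B (a ⊗ₜ b) = Bess.joins A B a ⊗ₜ b + Bess.sign I a ⊗ₜ Bess.joins A B b := rfl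

section Join

variable (x : InnerForest I) {T T' : Set I} (h : IsJoin x.forest T T') {V' : Finset (Set I)}
  (o' : GlobalOrientation V') (o'' : GlobalOrientation (x.forest.verts \ V')) {c : ℚ}

theorem splitTerm_join (hV : V' ⊆ x.forest.verts)
    (hc : wedge (splitLetters o'.word o''.word) = c • wedge (fullLetters x.glob.word)) :
    splitTerm (x.join h) V' = ((-1) ^ V'.card * c : ℚ) •
      gammaSum x o' ⊗ₜ Bess.joins T T' (gammaSum x o'') := by
  have hU : (x.join h).forest.verts \ V' = insert (T ∪ T') (x.forest.verts \ V') :=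
    Finset.insert_sdiff_of_notMem _ fun hmem => h.notMem (hV hmem)
  have hnew : T ∪ T' ∉ x.forest.verts \ V' := fun hmem => h.notMem (Finset.mem_sdiff.1 hmem).1
  have length_eq : (o'.word.map (fun a : Option (Set I) => a.elim Letter.R' Letter.vert) ++
      [Letter.r]).length = V'.card + 2 := by
    rw [List.length_append, List.length_map, o'.isWord.length, List.length_singleton]
  have wedge_eq : wedge (splitLetters o'.word (o''.cons _ hnew hU).word) =
      ((-1) ^ V'.card * c : ℚ) • wedge (fullLetters (x.join h).glob.word) :=
    calc
      _ = (-1 : ℚ) ^ (V'.card + 2) •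
          (wedge [Letter.vert (T ∪ T')] * wedge (splitLetters o'.word o''.word)) := by
        rw [← length_eq, ← wedge_append]
        exact wedge_move _ _ _
      _ = _ := by
        rw [hc, wedge_fullLetters_join, mul_smul_comm, smul_smul, pow_add, neg_one_sq, mul_one]
  rw [splitTerm_eq (x.join h) (hV.trans (x.forest.verts_subset_join h)) o' _ wedge_eq,
    gammaSum_join x h hV, gammaSum_join_insert x h Finset.sdiff_subset hU o'' _ rfl]

theorem splitTerm_join_insert (hV : V' ⊆ x.forest.verts)
    (hc : wedge (splitLetters o'.word o''.word) = c • wedge (fullLetters x.glob.word)) :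
    splitTerm (x.join h) (insert (T ∪ T') V') =
      c • Bess.joins T T' (gammaSum x o') ⊗ₜ gammaSum x o'' := by
  have hU : (x.join h).forest.verts \ insert (T ∪ T') V' = x.forest.verts \ V' := by
    change insert (T ∪ T') x.forest.verts \ insert (T ∪ T') V' = _
    rw [Finset.insert_sdiff_insert, Finset.sdiff_insert_of_notMem h.notMem]
  have hnew : T ∪ T' ∉ V' := fun hmem => h.notMem (hV hmem)
  obtain ⟨q, hword, hq⟩ : ∃ q : GlobalOrientation ((x.join h).forest.verts \ insert (T ∪ T') V'),
      q.word = o''.word ∧ gammaSum (x.join h) q = gammaSum x o'' := by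
    rw [hU]
    exact ⟨o'', rfl, gammaSum_join x h Finset.sdiff_subset o''⟩
  have wedge_eq : wedge (splitLetters (o'.cons _ hnew rfl).word q.word) =
      c • wedge (fullLetters (x.join h).glob.word) := by
    rw [wedge_fullLetters_join, ← mul_smul_comm, ← hc, hword, ← wedge_append]
    rfl
  rw [splitTerm_eq (x.join h) (Finset.insert_subset_insert _ hV) _ q wedge_eq, hq,
    gammaSum_join_insert x h hV rfl o' _ rfl]

theorem coproduct_join :
    coproduct I (Bess.of (x.join h)) = tensorJoins T T' (coproduct I (Bess.of x)) := by
  have sum_split : coproduct I (Bess.of (x.join h)) = ∑ V' ∈ x.forest.verts.powerset,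
      (splitTerm (x.join h) V' + splitTerm (x.join h) (insert (T ∪ T') V')) := by
    rw [coproduct_of, Finset.sum_add_distrib]
    exact Finset.sum_powerset_insert h.notMem _
  rw [sum_split, coproduct_of, map_sum]
  refine Finset.sum_congr rfl fun V' hV => ?_
  rw [Finset.mem_powerset] at hV
  obtain ⟨c, hc⟩ := exists_splitSign x hV (GlobalOrientation.std V') (GlobalOrientation.std _)
  rw [splitTerm_join x h _ _ hV hc, splitTerm_join_insert x h _ _ hV hc, splitTerm_eq x hV _ _ hc,
    map_smul, tensorJoins_tmul, Bess.sign_gammaSum, smul_add, TensorProduct.smul_tmul',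
    TensorProduct.smul_tmul', TensorProduct.smul_tmul', smul_smul, add_comm, mul_comm]

end Join

theorem coproduct_of_induction (x : InnerForest I) {P : Bess I ⊗[ℚ] Bess I → Prop}
    (zero : P 0) (add : ∀ X Y, P X → P Y → P (X + Y)) (smul : ∀ (c : ℚ) X, P X → P (c • X))
    (tmul : ∀ z z' : InnerForest I, LiesOver id z.forest x.forest →
      LiesOver id z'.forest x.forest → P (Bess.of z ⊗ₜ Bess.of z')) :
    P (coproduct I (Bess.of x)) := by
  rw [coproduct_of]
  refine Finset.sum_induction _ P add zero fun V' hV => ?_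
  rw [Finset.mem_powerset] at hV
  obtain ⟨c, hc⟩ := exists_splitSign x hV (GlobalOrientation.std V') (GlobalOrientation.std _)
  rw [splitTerm_eq x hV _ _ hc]
  refine smul _ _ ?_
  rw [gammaSum, gammaSum, TensorProduct.sum_tmul]
  refine Finset.sum_induction _ P add zero fun p _ => ?_
  rw [TensorProduct.tmul_sum]
  exact Finset.sum_induction _ P add zero fun q _ => tmul _ _ p.liesOver q.liesOver

theorem coproduct_joins (x : InnerForest I) {A B : Set I} (hA : Saturated x.forest A)
    (hB : Saturated x.forest B) (hAB : Disjoint A B) :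
    coproduct I (Bess.joins A B (Bess.of x)) = tensorJoins A B (coproduct I (Bess.of x)) := by
  rw [Bess.joins_of, map_sum]
  simp only [coproduct_join]
  have joins_eq : ∀ z : InnerForest I, LiesOver id z.forest x.forest →
      Bess.joins A B (Bess.of z) =
        ∑ P : JoinPair x.forest A B, Bess.joins P.1.1 P.1.2 (Bess.of z) := fun z hz =>
    Bess.joins_eq_sum hz hA hB hAB
  refine coproduct_of_induction x
    (P := fun X => ∑ P : JoinPair x.forest A B, tensorJoins P.1.1 P.1.2 X = tensorJoins A B X)
    ?_ ?_ ?_ ?_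
  · simp
  · intro X Y hX hY
    simp only [map_add, Finset.sum_add_distrib, hX, hY]
  · intro c X hX
    simp only [map_smul, ← Finset.smul_sum, hX]
  · intro z z' hz hz'
    simp only [tensorJoins_tmul, Finset.sum_add_distrib, joins_eq z hz, joins_eq z' hz',
      TensorProduct.sum_tmul, TensorProduct.tmul_sum]

end Grading

/-! ## Composition and joins -/

section GraftJoin

variable {I J : Type u}

theorem Bess.comp_of [Finite J] (x : InnerForest (Option I)) (y : InnerForest J) :
    Bess.comp I J (Bess.of x) (Bess.of y) = (-1 : ℚ) ^ beforeR y.glob.word •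
      ∑ s : PathVert x.forest → Tree y.forest, Bess.of (graftInner x y s) := by
  rw [Bess.comp, Bess.lift_of, Bess.lift_of]

theorem exists_mem_side {F : Forest (Option I)} (v : PathVert F) {i : I} (hi : some i ∈ v.1) :
    ∃ u : PathVert F, u.1 ⊆ v.1 ∧ some i ∈ side F u.1 := by
  obtain ⟨u, ⟨hu, hiu⟩, hmin⟩ := Set.Finite.exists_minimalFor (fun u : PathVert F => u.1)
    {u : PathVert F | u.1 ⊆ v.1 ∧ some i ∈ u.1} (Set.toFinite _) ⟨v, subset_rfl, hi⟩
  refine ⟨u, hu, ?_⟩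
  obtain ⟨A, hs, hA⟩ := path_split u
  rw [← hs.2.2.2] at hiu
  refine hiu.resolve_left fun hiA => ?_
  have hAu : A ⊆ u.1 := hs.2.2.2 ▸ Set.subset_union_left
  rcases hs.1 with hAF | ⟨a, rfl⟩
  · have huA : u.1 ⊆ A := hmin (j := ⟨A, hAF, hA⟩) ⟨hAu.trans hu, hiA⟩ hAu
    obtain ⟨k, hk⟩ := side_nonempty u
    exact Set.disjoint_left.1 hs.2.2.1 (huA (side_subset u hk)) hk
  · exact Option.some_ne_none i (hiA.trans hA.symm)

variable {F : Forest (Option I)} {F₂ : Forest J}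

theorem graft_liesOver (s : PathVert F → Tree F₂) : LiesOver collapse (graft F F₂ s) F := by
  intro w hw
  rcases Finset.mem_union.1 hw with hw | hw
  · obtain ⟨v, hv, rfl⟩ := Finset.mem_image.1 hw
    exact ⟨v, Or.inl hv, graftVert_subset s v⟩
  · obtain ⟨u, -, rfl⟩ := Finset.mem_image.1 hw
    refine ⟨{none}, Or.inr ⟨none, rfl⟩, ?_⟩
    rintro _ ⟨j, -, rfl⟩
    rfl

theorem IsJoin.not_meets_both {K : Type u} {F : Forest K} {T T' : Set K} (h : IsJoin F T T')
    {N : Set K} (hN : IsNode F.verts N) {a b : K} (ha : a ∈ T) (hb : b ∈ T') (haN : a ∈ N) :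
    b ∉ N := fun hbN =>
  (h.left.node_subset_or_disjoint hN).elim
    (fun hNT => Set.disjoint_left.1 h.disjoint (hNT hbN) hb)
    fun hdisj => Set.disjoint_left.1 hdisj haN ha

variable {T T' : Set (Option I)} (h : IsJoin F T T')

/-- The restriction of a choice of trees for the path of `⋆` in a join to the path in `F`. -/
def restrictPath (s : PathVert (F.join h) → Tree F₂) (u : PathVert F) : Tree F₂ :=
  s ⟨u.1, F.verts_subset_join h u.2.1, u.2.2⟩

theorem side_join {u : Set (Option I)} (hu : u ∈ F.verts) : side (F.join h) u = side F u := by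
  simp only [side, Forest.isSplit_iff_of_subset (F.verts_subset_join h) hu]

theorem graftVert_join (s : PathVert (F.join h) → Tree F₂) {u : Set (Option I)}
    (hu : u ∈ F.verts) :
    graftVert (F.join h) F₂ s u = graftVert F F₂ (restrictPath h s) u := by
  by_cases hn : none ∈ u
  · rw [graftVert_path s ⟨u, F.verts_subset_join h hu, hn⟩,
      graftVert_path (restrictPath h s) ⟨u, hu, hn⟩]
    ext (i | j)
    · rw [inl_mem_grow, inl_mem_grow]
      constructor
      · rintro ⟨⟨w, hw, hwn⟩, hwu, hsw, hiw⟩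
        have hwF : w ∈ F.verts := by
          refine (Finset.mem_insert.1 hw).resolve_left ?_
          rintro rfl
          exact h.not_union_subset hu hwu
        exact ⟨⟨w, hwF, hwn⟩, hwu, hsw, by rwa [side_join h hwF] at hiw⟩
      · rintro ⟨⟨w, hw, hwn⟩, hwu, hsw, hiw⟩
        exact ⟨⟨w, F.verts_subset_join h hw, hwn⟩, hwu, hsw, by rwa [side_join h hw]⟩
    · rw [inr_mem_grow, inr_mem_grow]
      rfl
  · rw [graftVert_of_notMem s hn, graftVert_of_notMem _ hn]

theorem graftBranch_join (s : PathVert (F.join h) → Tree F₂) {u : Set (Option I)}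
    (hu : u ∈ F.verts) (A : Set (Option I)) :
    graftBranch (F.join h) F₂ s u A = graftBranch F F₂ (restrictPath h s) u A := by
  rw [graftBranch, graftBranch, graftVert_join h s hu]

theorem graft_join_verts (s : PathVert (F.join h) → Tree F₂) :
    (graft (F.join h) F₂ s).verts = insert (graftVert (F.join h) F₂ s (T ∪ T'))
      (graft F F₂ (restrictPath h s)).verts := by
  have image_eq : F.verts.image (graftVert (F.join h) F₂ s) =
      F.verts.image (graftVert F F₂ (restrictPath h s)) :=
    Finset.image_congr fun u hu => graftVert_join h s hu
  simp only [graft, graftVerts, Forest.join, Finset.image_insert, Finset.insert_union, ← image_eq]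

theorem graft_join_split (s : PathVert (F.join h) → Tree F₂) :
    IsSplit (graft (F.join h) F₂ s).verts (graftVert (F.join h) F₂ s (T ∪ T'))
      (graftBranch (F.join h) F₂ s (T ∪ T') T) (graftBranch (F.join h) F₂ s (T ∪ T') T') :=
  graft_split_left s (F.mem_join h) (join_split h)

theorem graft_join_not_subset (s : PathVert (F.join h) → Tree F₂) {w : Set (I ⊕ J)}
    (hw : w ∈ (graft F F₂ (restrictPath h s)).verts) :
    ¬ graftVert (F.join h) F₂ s (T ∪ T') ⊆ w := by
  intro hsub
  have hs := graft_join_split h s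
  obtain ⟨a, ha⟩ := (graft (F.join h) F₂ s).node_nonempty hs.1
  obtain ⟨b, hb⟩ := (graft (F.join h) F₂ s).node_nonempty hs.2.1
  obtain ⟨N, hN, hwN⟩ := graft_liesOver _ w hw
  exact h.not_meets_both hN ha.2 hb.2 (hwN (hsub ha.1)) (hwN (hsub hb.1))

theorem graft_isJoin (s : PathVert (F.join h) → Tree F₂) :
    IsJoin (graft F F₂ (restrictPath h s)) (graftBranch (F.join h) F₂ s (T ∪ T') T)
      (graftBranch (F.join h) F₂ s (T ∪ T') T') := by
  have hs := graft_join_split h s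
  have new_mem : graftVert (F.join h) F₂ s (T ∪ T') ∈ (graft (F.join h) F₂ s).verts :=
    (graft_join_verts h s).symm ▸ Finset.mem_insert_self _ _
  have new_maximal : ∀ w ∈ (graft (F.join h) F₂ s).verts,
      graftVert (F.join h) F₂ s (T ∪ T') ⊆ w → w ⊆ graftVert (F.join h) F₂ s (T ∪ T') := by
    intro w hw hsub
    rw [graft_join_verts, Finset.mem_insert] at hw
    exact (hw.resolve_right fun hw => graft_join_not_subset h s hw hsub).subset
  obtain ⟨F', hjoin, hF'⟩ :=
    (graft (F.join h) F₂ s).exists_join_eq_of_maximal new_mem new_maximal hs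
  have new_notMem : graftVert (F.join h) F₂ s (T ∪ T') ∉ F'.verts := hs.2.2.2 ▸ hjoin.notMem
  have insert_eq : insert (graftVert (F.join h) F₂ s (T ∪ T')) F'.verts =
      insert (graftVert (F.join h) F₂ s (T ∪ T')) (graft F F₂ (restrictPath h s)).verts :=
    (congrArg (insert · F'.verts) hs.2.2.2.symm).trans
      ((congrArg Forest.verts hF').trans (graft_join_verts h s))
  obtain rfl : F' = graft F F₂ (restrictPath h s) := Forest.ext <| by
    rw [← Finset.erase_insert new_notMem, insert_eq,
      Finset.erase_insert fun hmem => graft_join_not_subset h s hmem subset_rfl]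
  exact hjoin

theorem graft_join_eq (s : PathVert (F.join h) → Tree F₂) :
    graft (F.join h) F₂ s = (graft F F₂ (restrictPath h s)).join (graft_isJoin h s) := by
  refine Forest.ext ((graft_join_verts h s).trans ?_)
  exact congrArg (insert · _) (graft_join_split h s).2.2.2.symm

/-- The pair of trees of a composed forest which are joined by the vertex that comes from the new
vertex of a join. -/
def JoinPair.ofGraft (s : PathVert (F.join h) → Tree F₂) :
    JoinPair (graft F F₂ (restrictPath h s)) (collapse ⁻¹' T) (collapse ⁻¹' T') :=
  ⟨(graftBranch (F.join h) F₂ s (T ∪ T') T, graftBranch (F.join h) F₂ s (T ∪ T') T'),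
    graft_isJoin h s, Set.inter_subset_right, Set.inter_subset_right⟩

theorem ofGraft_injective : Function.Injective fun s : PathVert (F.join h) → Tree F₂ =>
    (⟨restrictPath h s, JoinPair.ofGraft h s⟩ : Σ s : PathVert F → Tree F₂,
      JoinPair (graft F F₂ s) (collapse ⁻¹' T) (collapse ⁻¹' T')) := by
  intro s₁ s₂ e
  have branches_eq : (JoinPair.ofGraft h s₁).1 = (JoinPair.ofGraft h s₂).1 :=
    congrArg (fun Q : Σ s : PathVert F → Tree F₂,
      JoinPair (graft F F₂ s) (collapse ⁻¹' T) (collapse ⁻¹' T') => Q.2.1) e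
  have vert_eq : graftVert (F.join h) F₂ s₁ (T ∪ T') = graftVert (F.join h) F₂ s₂ (T ∪ T') :=
    (graft_join_split h s₁).2.2.2.symm.trans
      ((congrArg (fun Q => Q.1 ∪ Q.2) branches_eq).trans (graft_join_split h s₂).2.2.2)
  funext ⟨u, hu, hun⟩
  rcases Finset.mem_insert.1 hu with rfl | huF
  · rw [graftVert_path s₁ ⟨T ∪ T', hu, hun⟩, graftVert_path s₂ ⟨T ∪ T', hu, hun⟩] at vert_eq
    refine Subtype.ext (Set.ext fun j => ?_)
    rw [← inr_mem_grow, vert_eq, inr_mem_grow]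
  · exact congrFun (congrArg Sigma.fst e) ⟨u, huF, hun⟩

theorem graft_tree_eq (s : PathVert F → Tree F₂) {S : Set (Option I)} (hS : IsNode F.verts S)
    (hn : none ∉ S) {t₁ t₂ : Set (I ⊕ J)} (h₁ : (graft F F₂ s).IsTree t₁)
    (h₂ : (graft F F₂ s).IsTree t₂) (h₁S : t₁ ⊆ collapse ⁻¹' S) (h₂S : t₂ ⊆ collapse ⁻¹' S) :
    t₁ = t₂ := by
  have hnode : IsNode (graft F F₂ s).verts (collapse ⁻¹' S) := graft_node_left s hS hn
  rw [← h₁.2 _ hnode h₁S, h₂.2 _ hnode h₂S]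

theorem exists_inr_mem_tree (s : PathVert F → Tree F₂) (hT : IsNode F.verts T) (hn : none ∈ T)
    {t : Set (I ⊕ J)} (ht : (graft F F₂ s).IsTree t) (htT : t ⊆ collapse ⁻¹' T) :
    ∃ j, Sum.inr j ∈ t := by
  obtain ⟨i | j, hit⟩ := ht.nonempty
  · have hiT : some i ∈ T := htT hit
    have hTF : T ∈ F.verts := by
      refine hT.resolve_right ?_
      rintro ⟨k, rfl⟩
      exact Option.some_ne_none i (hiT.trans hn.symm)
    obtain ⟨u, -, hiu⟩ := exists_mem_side (⟨T, hTF, hn⟩ : PathVert F) hiT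
    have grow_mem : grow F F₂ s u ∈ (graft F F₂ s).verts := by
      rw [← graftVert_path]
      exact Finset.mem_union_left _ (Finset.mem_image_of_mem _ u.2.1)
    have hig : Sum.inl i ∈ grow F F₂ s u := (inl_mem_grow s u i).2 ⟨u, subset_rfl, rfl, hiu⟩
    have grow_subset : grow F F₂ s u ⊆ t :=
      (ht.node_subset_or_disjoint (Or.inl grow_mem)).resolve_right fun hdisj =>
        Set.disjoint_left.1 hdisj hig hit
    obtain ⟨j, hj⟩ := F₂.node_nonempty (s u).2.1
    exact ⟨j, grow_subset ((inr_mem_grow s u j).2 hj)⟩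
  · exact ⟨j, hit⟩

/-- The extension of a choice of trees for the path of `⋆` in `F` to the path in a join, by the
value `τ` at the new vertex. -/
def extendPath (s : PathVert F → Tree F₂) (τ : Tree F₂) (u : PathVert (F.join h)) : Tree F₂ :=
  if hu : u.1 ∈ F.verts then s ⟨u.1, hu, u.2.2⟩ else τ

theorem restrictPath_extendPath (s : PathVert F → Tree F₂) (τ : Tree F₂) :
    restrictPath h (extendPath h s τ) = s :=
  funext fun u => dif_pos u.2.1

theorem inr_mem_graftBranch_extendPath (s : PathVert F → Tree F₂) (τ : Tree F₂) (hn : none ∈ T)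
    {j : J} (hj : j ∈ τ.1) :
    Sum.inr j ∈ graftBranch (F.join h) F₂ (extendPath h s τ) (T ∪ T') T := by
  refine ⟨?_, hn⟩
  rw [graftVert_path _ ⟨T ∪ T', F.mem_join h, Or.inl hn⟩, inr_mem_grow, extendPath,
    dif_neg h.notMem]
  exact hj

theorem ofGraft_surjective [Nonempty J] (hn : none ∉ T') :
    Function.Surjective fun s : PathVert (F.join h) → Tree F₂ =>
      (⟨restrictPath h s, JoinPair.ofGraft h s⟩ : Σ s : PathVert F → Tree F₂,
        JoinPair (graft F F₂ s) (collapse ⁻¹' T) (collapse ⁻¹' T')) := by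
  rintro ⟨s, ⟨⟨t, t'⟩, hjoin, ht, ht'⟩⟩
  dsimp only at hjoin ht ht'
  obtain ⟨j, hj⟩ : ∃ j, none ∈ T → Sum.inr j ∈ t := by
    by_cases hnT : none ∈ T
    · exact (exists_inr_mem_tree s h.left.1 hnT hjoin.left ht).imp fun _ hj _ => hj
    · exact (‹Nonempty J›).elim fun j => ⟨j, fun hmem => absurd hmem hnT⟩
  obtain ⟨τ, hτ, hjτ⟩ := F₂.exists_tree (N := {j}) (Or.inr ⟨j, rfl⟩)
  obtain ⟨s', rfl, hs'⟩ : ∃ s' : PathVert (F.join h) → Tree F₂, restrictPath h s' = s ∧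
      (none ∈ T → Sum.inr j ∈ graftBranch (F.join h) F₂ s' (T ∪ T') T) :=
    ⟨extendPath h s ⟨τ, hτ⟩, restrictPath_extendPath h s _, fun hnT =>
      inr_mem_graftBranch_extendPath h s ⟨τ, hτ⟩ hnT (hjτ rfl)⟩
  have hbranches := graft_isJoin h s'
  have right_eq : graftBranch (F.join h) F₂ s' (T ∪ T') T' = t' :=
    graft_tree_eq _ h.right.1 hn hbranches.right hjoin.right Set.inter_subset_right ht'
  have left_eq : graftBranch (F.join h) F₂ s' (T ∪ T') T = t := by
    by_cases hnT : none ∈ T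
    · exact hbranches.left.eq_of_mem hjoin.left (hs' hnT) (hj hnT)
    · exact graft_tree_eq _ h.left.1 hnT hbranches.left hjoin.left Set.inter_subset_right ht
  refine ⟨s', ?_⟩
  subst left_eq right_eq
  rfl

theorem graftLoc_join (x : InnerForest (Option I)) (h : IsJoin x.forest T T')
    (y : InnerForest J) (s : PathVert (x.forest.join h) → Tree y.forest) {w : Set (I ⊕ J)}
    (hw : w ∈ (graft x.forest y.forest (restrictPath h s)).verts) :
    graftLoc s (x.join h).loc y.loc w = graftLoc (restrictPath h s) x.loc y.loc w := by
  rcases Finset.mem_union.1 hw with hw | hw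
  · obtain ⟨v, hv, rfl⟩ := Finset.mem_image.1 hw
    rw [graftLoc_left _ _ _ hv, ← graftVert_join h s hv,
      graftLoc_left s _ _ (x.forest.verts_subset_join h hv), x.join_loc_of_mem h hv,
      funext (graftBranch_join h s hv)]
  · obtain ⟨u, hu, rfl⟩ := Finset.mem_image.1 hw
    rw [graftLoc_right _ _ _ hu, graftLoc_right _ _ _ hu]

theorem of_graftInner_join (x : InnerForest (Option I)) (h : IsJoin x.forest T T')
    (y : InnerForest J) (s : PathVert (x.forest.join h) → Tree y.forest) :
    Bess.of (graftInner (x.join h) y s) =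
      Bess.of ((graftInner x y (restrictPath h s)).join (graft_isJoin h s)) := by
  have new_eq := (graft_join_split h s).2.2.2
  refine Bess.of_eq_of_join (x := graftInner x y (restrictPath h s)) (graft_isJoin h s)
    (congrArg Forest.verts (graft_join_eq h s)) ?_ ?_ fun w hw => graftLoc_join x h y s hw
  · rw [new_eq]
    exact congrArg (fun l => some _ :: (l ++ _))
      (x.glob.map_word_congr fun v hv => graftVert_join h s hv)
  · rw [new_eq]
    refine (graftLoc_left s (x.join h).loc y.loc (x.forest.mem_join h)).trans ?_
    rw [x.join_loc_self]
    rfl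

variable [Finite I] [Finite J] [Nonempty J]

theorem Bess.comp_join_of_notMem (x : InnerForest (Option I)) (h : IsJoin x.forest T T')
    (hn : none ∉ T') (y : InnerForest J) :
    Bess.comp I J (Bess.of (x.join h)) (Bess.of y) =
      Bess.joins (collapse ⁻¹' T) (collapse ⁻¹' T') (Bess.comp I J (Bess.of x) (Bess.of y)) := by
  rw [Bess.comp_of, Bess.comp_of, map_smul, map_sum]
  simp only [Bess.joins_of]
  congr 1
  rw [← Fintype.sum_sigma']
  exact Fintype.sum_bijective _ ⟨ofGraft_injective h, ofGraft_surjective h hn⟩ _ _ fun s =>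
    of_graftInner_join x h y s

theorem Bess.comp_join (x : InnerForest (Option I)) (h : IsJoin x.forest T T')
    (y : InnerForest J) :
    Bess.comp I J (Bess.of (x.join h)) (Bess.of y) =
      Bess.joins (collapse ⁻¹' T) (collapse ⁻¹' T') (Bess.comp I J (Bess.of x) (Bess.of y)) := by
  by_cases hn : none ∈ T'
  · have hnT : none ∉ T := fun hmem => Set.disjoint_left.1 h.disjoint hmem hn
    rw [← neg_eq_iff_eq_neg.2 (Bess.of_join_symm x h), map_neg, LinearMap.neg_apply,
      Bess.comp_join_of_notMem x h.symm hnT y, Bess.joins_symm, LinearMap.neg_apply, neg_neg]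
  · exact Bess.comp_join_of_notMem x h hn y

theorem Bess.comp_joins (x : InnerForest (Option I)) {A B : Set (Option I)}
    (hA : Saturated x.forest A) (hB : Saturated x.forest B) (hAB : Disjoint A B) (y : Bess J) :
    Bess.comp I J (Bess.joins A B (Bess.of x)) y =
      Bess.joins (collapse ⁻¹' A) (collapse ⁻¹' B) (Bess.comp I J (Bess.of x) y) := by
  suffices Bess.comp I J (Bess.joins A B (Bess.of x)) =
      Bess.joins (collapse ⁻¹' A) (collapse ⁻¹' B) ∘ₗ Bess.comp I J (Bess.of x) from
    LinearMap.congr_fun this y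
  refine Bess.hom_ext fun y => ?_
  rw [LinearMap.comp_apply, Bess.joins_of, map_sum, LinearMap.sum_apply]
  simp only [Bess.comp_join]
  rw [Bess.comp_of]
  simp only [map_smul, map_sum]
  rw [← Finset.smul_sum, Finset.sum_comm]
  congr 1
  refine Finset.sum_congr rfl fun s _ => ?_
  exact (Bess.joins_eq_sum (graft_liesOver s) hA hB hAB).symm

end GraftJoin

section DiscreteComp

variable {I J : Type u}

instance : IsEmpty (PathVert (discreteInner (Option I)).forest) :=
  ⟨fun v => Finset.notMem_empty _ v.2.1⟩

variable {F₂ : Forest J} (s : PathVert (Forest.discrete (Option I)) → Tree F₂)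

theorem graft_discrete_verts :
    (graft (Forest.discrete (Option I)) F₂ s).verts = F₂.verts.image fun u => Sum.inr '' u := by
  change Finset.image _ ∅ ∪ _ = _
  simp

theorem graft_discrete_node {A : Set J} :
    IsNode (graft (Forest.discrete (Option I)) F₂ s).verts (Sum.inr '' A) ↔ IsNode F₂.verts A := by
  refine ⟨?_, fun h => graft_node_right s h⟩
  rintro (h | ⟨a, ha⟩)
  · rw [graft_discrete_verts, Finset.mem_image] at h
    obtain ⟨u, hu, huA⟩ := h
    exact Or.inl (Sum.inr_injective.image_injective huA ▸ hu)
  · obtain ⟨j, -, rfl⟩ : a ∈ Sum.inr '' A := ha ▸ rfl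
    exact Or.inr ⟨j, Sum.inr_injective.image_injective (by simpa using ha)⟩

theorem graft_discrete_tree {A : Set J} :
    (graft (Forest.discrete (Option I)) F₂ s).IsTree (Sum.inr '' A) ↔ F₂.IsTree A := by
  constructor
  · rintro ⟨hnode, hmax⟩
    refine ⟨(graft_discrete_node s).1 hnode, fun N hN hA => ?_⟩
    exact Sum.inr_injective.image_injective
      (hmax _ ((graft_discrete_node s).2 hN) (Set.image_mono hA))
  · rintro ⟨hnode, hmax⟩
    refine ⟨(graft_discrete_node s).2 hnode, fun N hN hA => ?_⟩
    obtain ⟨a, ha⟩ := F₂.node_nonempty hnode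
    obtain ⟨M, rfl⟩ : ∃ M : Set J, Sum.inr '' M = N := by
      rcases hN with hN | ⟨b, rfl⟩
      · rw [graft_discrete_verts, Finset.mem_image] at hN
        exact hN.imp fun _ => And.right
      · exact ⟨{a}, by simpa using hA ⟨a, ha, rfl⟩⟩
    rw [hmax M ((graft_discrete_node s).1 hN)
      ((Set.image_subset_image_iff Sum.inr_injective).1 hA)]

theorem graft_discrete_isJoin {A B : Set J} :
    IsJoin (graft (Forest.discrete (Option I)) F₂ s) (Sum.inr '' A) (Sum.inr '' B) ↔
      IsJoin F₂ A B := by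
  constructor
  · rintro ⟨left, right, ne⟩
    exact ⟨(graft_discrete_tree s).1 left, (graft_discrete_tree s).1 right, fun h => ne (h ▸ rfl)⟩
  · rintro ⟨left, right, ne⟩
    exact ⟨(graft_discrete_tree s).2 left, (graft_discrete_tree s).2 right,
      fun h => ne (Sum.inr_injective.image_injective h)⟩

theorem graft_discrete_saturated {A : Set J} (hA : Saturated F₂ A) :
    Saturated (graft (Forest.discrete (Option I)) F₂ s) (Sum.inr '' A) := by
  intro w hw
  rw [graft_discrete_verts, Finset.mem_image] at hw
  obtain ⟨u, hu, rfl⟩ := hw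
  exact (hA u hu).imp Set.image_mono fun h => (Set.disjoint_image_iff Sum.inr_injective).2 h

variable (I) in
/-- The composition of the forest without inner vertex with an inner-oriented forest. -/
abbrev addLeaves (y : InnerForest J) : InnerForest (I ⊕ J) :=
  graftInner (discreteInner (Option I)) y fun v => isEmptyElim v

theorem Bess.discrete_comp_of [Finite J] (y : InnerForest J) :
    Bess.comp I J (Bess.discrete (Option I)) (Bess.of y) =
      (-1 : ℚ) ^ beforeR y.glob.word • Bess.of (addLeaves I y) := by
  rw [Bess.discrete, Bess.comp_of]
  congr 1
  exact Fintype.sum_subsingleton _ _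

theorem addLeaves_verts (y : InnerForest J) :
    (addLeaves I y).forest.verts = y.forest.verts.image fun u => Sum.inr '' u :=
  graft_discrete_verts _

theorem addLeaves_word (y : InnerForest J) : (addLeaves I y).glob.word =
    none :: (eraseR y.glob.word).map (Option.map fun u => Sum.inr '' u) := by
  simp [addLeaves, graftInner, graftGlob, discreteInner, eraseR]

theorem addLeaves_loc (y : InnerForest J) {u : Set J} (hu : u ∈ y.forest.verts) :
    (addLeaves I y).loc (Sum.inr '' u) = (y.loc u).map (Option.map fun A => Sum.inr '' A) :=
  graftLoc_right _ _ y.loc hu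

theorem of_addLeaves_join (y : InnerForest J) {T T' : Set J} (h : IsJoin y.forest T T') :
    Bess.of (addLeaves I (y.join h)) = -Bess.of ((addLeaves I y).join
      ((graft_discrete_isJoin (I := I) _).2 h)) := by
  have image_union : (Sum.inr '' (T ∪ T') : Set (I ⊕ J)) = Sum.inr '' T ∪ Sum.inr '' T' :=
    Set.image_union _ _ _
  refine Bess.of_eq_neg_of_join _ ?_ ?_ ?_ fun w hw => ?_
  · simp only [addLeaves_verts, InnerForest.join, Forest.join, Finset.image_insert, image_union]
  · refine ⟨[], none, some (Sum.inr '' T ∪ Sum.inr '' T'),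
      (eraseR y.glob.word).map (Option.map fun u => Sum.inr '' u), ?_, ?_⟩
    · simp [addLeaves_word, InnerForest.join, GlobalOrientation.cons, eraseR, image_union]
    · rw [addLeaves_word, List.nil_append]
  · rw [← image_union, addLeaves_loc _ (y.forest.mem_join h), y.join_loc_self]
    rfl
  · rw [addLeaves_verts, Finset.mem_image] at hw
    obtain ⟨u, hu, rfl⟩ := hw
    rw [addLeaves_loc _ (y.forest.verts_subset_join h hu), addLeaves_loc _ hu,
      y.join_loc_of_mem h hu]

variable (I) in
/-- A pair of trees of a forest on `J` to be joined, seen in the forest with the leaves `I`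
added. -/
def JoinPair.addLeaves (y : InnerForest J) {A B : Set J} (P : JoinPair y.forest A B) :
    JoinPair (addLeaves I y).forest (Sum.inr '' A) (Sum.inr '' B) :=
  ⟨(Sum.inr '' P.1.1, Sum.inr '' P.1.2), (graft_discrete_isJoin _).2 P.2.1,
    Set.image_mono P.2.2.1, Set.image_mono P.2.2.2⟩

theorem JoinPair.addLeaves_bijective (y : InnerForest J) (A B : Set J) :
    Function.Bijective (JoinPair.addLeaves I y (A := A) (B := B)) := by
  constructor
  · rintro ⟨⟨S, S'⟩, h⟩ ⟨⟨T, T'⟩, h'⟩ he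
    simp only [JoinPair.addLeaves, Subtype.mk.injEq, Prod.mk.injEq] at he ⊢
    exact ⟨Sum.inr_injective.image_injective he.1, Sum.inr_injective.image_injective he.2⟩
  · rintro ⟨⟨S, S'⟩, h, hS, hS'⟩
    obtain ⟨T, hT, rfl⟩ := Set.subset_image_iff.1 hS
    obtain ⟨T', hT', rfl⟩ := Set.subset_image_iff.1 hS'
    exact ⟨⟨(T, T'), (graft_discrete_isJoin _).1 h, hT, hT'⟩, rfl⟩

theorem Bess.discrete_comp_joins [Finite I] [Finite J] (A B : Set J) (z : Bess J) :
    Bess.comp I J (Bess.discrete (Option I)) (Bess.joins A B z) =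
      Bess.joins (Sum.inr '' A) (Sum.inr '' B) (Bess.comp I J (Bess.discrete (Option I)) z) := by
  suffices Bess.comp I J (Bess.discrete (Option I)) ∘ₗ Bess.joins A B =
      Bess.joins (Sum.inr '' A) (Sum.inr '' B) ∘ₗ Bess.comp I J (Bess.discrete (Option I)) from
    LinearMap.congr_fun this z
  refine Bess.hom_ext fun y => ?_
  rw [LinearMap.comp_apply, LinearMap.comp_apply, Bess.joins_of, map_sum,
    Bess.discrete_comp_of, map_smul, Bess.joins_of, Finset.smul_sum]
  refine Fintype.sum_bijective _ (JoinPair.addLeaves_bijective y A B) _ _ fun P => ?_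
  have beforeR_join : beforeR (y.join P.2.1).glob.word = beforeR y.glob.word + 1 := by
    simp [beforeR, InnerForest.join, GlobalOrientation.cons]
  rw [Bess.discrete_comp_of, of_addLeaves_join, beforeR_join, pow_succ, mul_neg_one, neg_smul_neg]
  rfl

end DiscreteComp

/-! ## The coproduct is a morphism of operads -/

section Operad

variable {I J K : Type u}

@[elab_as_elim]
theorem tensor_induction {P : Bess I ⊗[ℚ] Bess K → Prop} (add : ∀ X Y, P X → P Y → P (X + Y))
    (smul : ∀ (c : ℚ) X, P X → P (c • X))
    (tmul : ∀ (x : InnerForest I) (y : InnerForest K), P (Bess.of x ⊗ₜ Bess.of y))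
    (X : Bess I ⊗[ℚ] Bess K) : P X := by
  induction X using TensorProduct.induction_on with
  | zero =>
    simpa only [zero_smul] using smul 0 _ (tmul (discreteInner I) (discreteInner K))
  | add X Y hX hY => exact add X Y hX hY
  | tmul a b =>
    induction a using Bess.induction with
    | add a a' h h' => rw [TensorProduct.add_tmul]; exact add _ _ h h'
    | smul c a h => rw [← TensorProduct.smul_tmul']; exact smul _ _ h
    | of x =>
      induction b using Bess.induction with
      | add a a' h h' => rw [TensorProduct.tmul_add]; exact add _ _ h h'
      | smul c a h => rw [TensorProduct.tmul_smul]; exact smul _ _ h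
      | of y => exact tmul x y

instance (F : Forest I) : Unique (Gamma F ∅) where
  default :=
    { forest := Forest.discrete I
      hom :=
        { toFun := fun w => absurd w.2 (Finset.notMem_empty _)
          injective := fun w => absurd w.2 (Finset.notMem_empty _)
          increasing := fun w => absurd w.2 (Finset.notMem_empty _)
          leaves := fun w => absurd w.2 (Finset.notMem_empty _)
          branches := fun w => absurd w.2 (Finset.notMem_empty _) }
      range := fun v => ⟨fun h => absurd h (Finset.notMem_empty v),
        fun ⟨w, _⟩ => absurd w.2 (Finset.notMem_empty _)⟩ }
  uniq p := Gamma.forest_injective ∅ <| Forest.ext <| by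
    rw [p.verts_eq, Finset.image_empty]
    rfl

theorem gammaSum_of_eq_empty [Finite I] (x : InnerForest I) {V : Finset (Set I)} (hV : V = ∅)
    (o : GlobalOrientation V) : gammaSum x o = Bess.discrete I := by
  subst hV
  have word_eq : o.word = [none] := List.perm_singleton.1 <|
    (List.perm_ext_iff_of_nodup o.nodup (List.nodup_singleton _)).2 (by simp [o.mem_iff])
  rw [gammaSum, Fintype.sum_unique]
  refine Bess.of_congr rfl ?_ fun w hw => absurd hw (Finset.notMem_empty w)
  simp [gammaInner, GlobalOrientation.map, word_eq, discreteInner]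

theorem discrete_isTree (i : I) : (Forest.discrete I).IsTree {i} := by
  refine ⟨Or.inr ⟨i, rfl⟩, ?_⟩
  rintro N (hN | ⟨j, rfl⟩) h
  · exact absurd hN (Finset.notMem_empty _)
  · rw [Set.singleton_subset_singleton] at h
    rw [h]

theorem discrete_isJoin {i j : I} (hij : i ≠ j) : IsJoin (Forest.discrete I) {i} {j} :=
  ⟨discrete_isTree i, discrete_isTree j, fun h => hij (Set.singleton_injective h)⟩

theorem Bess.sign_discrete : Bess.sign I (Bess.discrete I) = Bess.discrete I := by
  rw [Bess.discrete, Bess.sign_of]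
  simp [discreteInner, Forest.discrete]

theorem coproduct_discrete [Finite I] :
    coproduct I (Bess.discrete I) = Bess.discrete I ⊗ₜ Bess.discrete I := by
  have splitTerm_empty := splitTerm_eq (c := 1) (discreteInner I) (Finset.empty_subset _)
    ⟨[none], by simp, by simp⟩ ⟨[none], by simp, by simp [discreteInner, Forest.discrete]⟩
    (by rw [one_smul]; rfl)
  rw [one_smul] at splitTerm_empty
  conv_lhs => rw [Bess.discrete, coproduct_of]
  exact (Finset.sum_singleton _ _).trans (splitTerm_empty.trans (congrArg₂ (· ⊗ₜ[ℚ] ·)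
    (gammaSum_of_eq_empty _ rfl _) (gammaSum_of_eq_empty _ Finset.sdiff_empty _)))

theorem Bess.omega_eq_neg_joins [Finite I] {i j : I} (hij : i ≠ j) :
    Bess.omega i j hij = -Bess.joins {i} {j} (Bess.discrete I) := by
  rw [Bess.discrete, Bess.joins_of_isJoin (discreteInner I) (discrete_isJoin hij)]
  refine Bess.of_eq_neg_of_join _ ?_ ⟨[], none, some ({i} ∪ {j}), [], ?_, rfl⟩ ?_
    fun v hv => absurd hv (Finset.notMem_empty v)
  · rw [Set.singleton_union]
    rfl
  · rw [Set.singleton_union]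
    rfl
  · rw [Set.singleton_union]
    exact if_pos rfl

theorem coproduct_omega [Finite I] {i j : I} (hij : i ≠ j) :
    coproduct I (Bess.omega i j hij) =
      Bess.discrete I ⊗ₜ Bess.omega i j hij + Bess.omega i j hij ⊗ₜ Bess.discrete I := by
  have coproduct_joins_discrete : coproduct I (Bess.joins {i} {j} (Bess.discrete I)) =
      tensorJoins {i} {j} (coproduct I (Bess.discrete I)) :=
    coproduct_joins (discreteInner I) (discrete_isTree i).saturated
      (discrete_isTree j).saturated (discrete_isJoin hij).disjoint
  rw [Bess.omega_eq_neg_joins, map_neg, coproduct_joins_discrete, coproduct_discrete,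
    tensorJoins_tmul, Bess.sign_discrete, TensorProduct.tmul_neg, TensorProduct.neg_tmul, neg_add,
    add_comm]

theorem relabel_saturated (e : I ≃ K) {F : Forest I} {A : Set I} (hA : Saturated F A) :
    Saturated (F.relabel e) (e '' A) := by
  intro w hw
  obtain ⟨v, hv, rfl⟩ := Finset.mem_image.1 hw
  exact (hA v hv).imp Set.image_mono fun h => (Set.disjoint_image_iff e.injective).2 h

theorem Bess.sign_relabel (e : I ≃ K) (z : Bess I) :
    Bess.sign K (Bess.relabel e z) = Bess.relabel e (Bess.sign I z) := by
  suffices Bess.sign K ∘ₗ Bess.relabel e = Bess.relabel e ∘ₗ Bess.sign I from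
    LinearMap.congr_fun this z
  refine Bess.hom_ext fun x => ?_
  rw [LinearMap.comp_apply, LinearMap.comp_apply, Bess.relabel_of, Bess.sign_of, Bess.sign_of,
    map_smul, Bess.relabel_of]
  congr 2
  exact Finset.card_image_of_injective _ e.injective.image_injective

theorem Bess.relabel_discrete (e : I ≃ K) :
    Bess.relabel e (Bess.discrete I) = Bess.discrete K := by
  rw [Bess.discrete, Bess.relabel_of]
  exact Bess.of_congr (Forest.ext (Finset.image_empty _)) rfl fun w hw =>
    absurd hw (Finset.notMem_empty w)

theorem tensorMap_relabel_tensorJoins [Finite I] [Finite K] (e : I ≃ K) (A B : Set I)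
    (X : Bess I ⊗[ℚ] Bess I) :
    TensorProduct.map (Bess.relabel e) (Bess.relabel e) (tensorJoins A B X) =
      tensorJoins (e '' A) (e '' B) (TensorProduct.map (Bess.relabel e) (Bess.relabel e) X) := by
  induction X using TensorProduct.induction_on with
  | zero => simp only [map_zero]
  | add X Y hX hY => simp only [map_add, hX, hY]
  | tmul a b =>
    simp only [tensorJoins_tmul, map_add, TensorProduct.map_tmul, Bess.relabel_joins,
      Bess.sign_relabel]

theorem coproduct_relabel [Finite I] [Finite K] (e : I ≃ K) (z : Bess I) :
    coproduct K (Bess.relabel e z) =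
      TensorProduct.map (Bess.relabel e) (Bess.relabel e) (coproduct I z) := by
  induction z using Bess.join_induction with
  | discrete =>
    rw [Bess.relabel_discrete, coproduct_discrete, coproduct_discrete, TensorProduct.map_tmul,
      Bess.relabel_discrete]
  | add x y hx hy => simp only [map_add, hx, hy]
  | smul c x hx => simp only [map_smul, hx]
  | join x A B h ih =>
    rw [coproduct_joins x h.left.saturated h.right.saturated h.disjoint,
      tensorMap_relabel_tensorJoins, ← ih, Bess.relabel_joins, Bess.relabel_of]
    exact coproduct_joins _ (relabel_saturated e h.left.saturated)
      (relabel_saturated e h.right.saturated) ((Set.disjoint_image_iff e.injective).2 h.disjoint)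

theorem graft_card {F : Forest (Option I)} {F₂ : Forest J} (s : PathVert F → Tree F₂) :
    (graft F F₂ s).verts.card = F.verts.card + F₂.verts.card := by
  change (F.verts.image (graftVert F F₂ s) ∪ F₂.verts.image fun u => Sum.inr '' u).card = _
  rw [Finset.card_union_of_disjoint, Finset.card_image_of_injOn (graftVert_injOn s),
    Finset.card_image_of_injective _ Sum.inr_injective.image_injective]
  rw [Finset.disjoint_left]
  intro w hw hw'
  obtain ⟨v, hv, rfl⟩ := Finset.mem_image.1 hw
  obtain ⟨u, -, hu⟩ := Finset.mem_image.1 hw'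
  exact graftVert_ne s hv u hu.symm

theorem Bess.sign_comp [Finite J] (x : InnerForest (Option I)) (y : InnerForest J) :
    Bess.sign (I ⊕ J) (Bess.comp I J (Bess.of x) (Bess.of y)) =
      (-1 : ℚ) ^ (x.forest.verts.card + y.forest.verts.card) •
        Bess.comp I J (Bess.of x) (Bess.of y) := by
  rw [Bess.comp_of, map_smul, map_sum, smul_comm]
  congr 1
  rw [Finset.smul_sum]
  refine Finset.sum_congr rfl fun s _ => ?_
  rw [Bess.sign_of]
  congr 2
  exact graft_card s

theorem Bess.sign_joins [Finite I] (A B : Set I) (x : InnerForest I) :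
    Bess.sign I (Bess.joins A B (Bess.of x)) =
      (-1 : ℚ) ^ (x.forest.verts.card + 1) • Bess.joins A B (Bess.of x) := by
  rw [Bess.joins_of, map_sum, Finset.smul_sum]
  refine Finset.sum_congr rfl fun P _ => ?_
  rw [Bess.sign_of]
  congr 2
  exact card_join P.2.1

theorem Bess.two_smul_oddPart {z : Bess I} {k : ℕ} (h : Bess.sign I z = (-1 : ℚ) ^ k • z) :
    (2 : ℚ) • Bess.oddPart I z = z - (-1 : ℚ) ^ k • z := by
  rw [← h, Bess.sign, LinearMap.sub_apply, LinearMap.smul_apply, LinearMap.id_apply,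
    sub_sub_cancel]

theorem tensorComp_add_left [Finite J] (X X' : Bess (Option I) ⊗[ℚ] Bess (Option I))
    (Y : Bess J ⊗[ℚ] Bess J) :
    tensorComp I J (X + X') Y = tensorComp I J X Y + tensorComp I J X' Y := by
  simp only [tensorComp, map_add, LinearMap.add_apply, smul_add]
  abel

theorem tensorComp_smul_left [Finite J] (c : ℚ) (X : Bess (Option I) ⊗[ℚ] Bess (Option I))
    (Y : Bess J ⊗[ℚ] Bess J) : tensorComp I J (c • X) Y = c • tensorComp I J X Y := by
  simp only [tensorComp, map_smul, LinearMap.smul_apply, smul_sub, smul_comm c (2 : ℚ)]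

theorem tensorComp_add_right [Finite J] (X : Bess (Option I) ⊗[ℚ] Bess (Option I))
    (Y Y' : Bess J ⊗[ℚ] Bess J) :
    tensorComp I J X (Y + Y') = tensorComp I J X Y + tensorComp I J X Y' := by
  simp only [tensorComp, map_add, smul_add]
  abel

theorem tensorComp_smul_right [Finite J] (c : ℚ) (X : Bess (Option I) ⊗[ℚ] Bess (Option I))
    (Y : Bess J ⊗[ℚ] Bess J) : tensorComp I J X (c • Y) = c • tensorComp I J X Y := by
  simp only [tensorComp, map_smul, smul_sub, smul_comm c (2 : ℚ)]

theorem tensorComp_tmul [Finite J] {a a' : Bess (Option I)} {k : ℕ}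
    (h : Bess.sign (Option I) a' = (-1 : ℚ) ^ k • a') (y : InnerForest J) (b' : Bess J) :
    tensorComp I J (a ⊗ₜ a') (Bess.of y ⊗ₜ b') = (-1 : ℚ) ^ (k * y.forest.verts.card) •
      Bess.comp I J a (Bess.of y) ⊗ₜ Bess.comp I J a' b' := by
  have tensorComp_eq : tensorComp I J (a ⊗ₜ a') (Bess.of y ⊗ₜ b') =
      Bess.comp I J a (Bess.of y) ⊗ₜ Bess.comp I J a' b' -
        Bess.comp I J a (Bess.oddPart J (Bess.of y)) ⊗ₜ
          Bess.comp I J ((2 : ℚ) • Bess.oddPart (Option I) a') b' := by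
    simp only [tensorComp, TensorProduct.map_tmul, TensorProduct.map₂_apply_tmul,
      LinearMap.id_apply, map_smul, LinearMap.smul_apply, TensorProduct.tmul_smul]
  rw [tensorComp_eq, Bess.oddPart_of, Bess.two_smul_oddPart h]
  split_ifs with hy
  · rcases Nat.even_or_odd k with hk | hk
    · rw [hk.neg_one_pow, (hk.mul_right _).neg_one_pow]
      simp
    · rw [hk.neg_one_pow, (hk.mul hy).neg_one_pow,
        show a' - (-1 : ℚ) • a' = (2 : ℚ) • a' by module, map_smul, LinearMap.smul_apply,
        TensorProduct.tmul_smul]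
      module
  · rw [((Nat.not_odd_iff_even.1 hy).mul_left _).neg_one_pow]
    simp

theorem tensorComp_discrete [Finite J] (b b' : Bess J) :
    tensorComp I J (Bess.discrete (Option I) ⊗ₜ Bess.discrete (Option I)) (b ⊗ₜ b') =
      Bess.comp I J (Bess.discrete (Option I)) b ⊗ₜ
        Bess.comp I J (Bess.discrete (Option I)) b' := by
  induction b using Bess.induction with
  | of y =>
    rw [tensorComp_tmul (k := 0)]
    · simp
    · rw [Bess.sign_discrete]
      simp
  | add x y hx hy =>
    rw [TensorProduct.add_tmul, tensorComp_add_right, hx, hy, map_add, TensorProduct.add_tmul]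
  | smul c x hx =>
    rw [← TensorProduct.smul_tmul', tensorComp_smul_right, hx, map_smul, TensorProduct.smul_tmul']

theorem Bess.sign_discrete_comp [Finite J] (b : Bess J) :
    Bess.sign (I ⊕ J) (Bess.comp I J (Bess.discrete (Option I)) b) =
      Bess.comp I J (Bess.discrete (Option I)) (Bess.sign J b) := by
  suffices Bess.sign (I ⊕ J) ∘ₗ Bess.comp I J (Bess.discrete (Option I)) =
      Bess.comp I J (Bess.discrete (Option I)) ∘ₗ Bess.sign J from LinearMap.congr_fun this b
  refine Bess.hom_ext fun y => ?_
  rw [LinearMap.comp_apply, LinearMap.comp_apply, Bess.discrete, Bess.sign_comp, Bess.sign_of,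
    map_smul]
  simp [discreteInner, Forest.discrete]

theorem tensorComp_discrete_tensorJoins [Finite I] [Finite J] (A B : Set J)
    (Y : Bess J ⊗[ℚ] Bess J) :
    tensorComp I J (Bess.discrete (Option I) ⊗ₜ Bess.discrete (Option I)) (tensorJoins A B Y) =
      tensorJoins (Sum.inr '' A) (Sum.inr '' B)
        (tensorComp I J (Bess.discrete (Option I) ⊗ₜ Bess.discrete (Option I)) Y) := by
  induction Y using tensor_induction with
  | add X Y hX hY => simp only [map_add, tensorComp_add_right, hX, hY]
  | smul c X hX => simp only [map_smul, tensorComp_smul_right, hX]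
  | tmul y y' =>
    simp only [tensorJoins_tmul, tensorComp_add_right, tensorComp_discrete,
      Bess.discrete_comp_joins, Bess.sign_discrete_comp]

theorem tensorComp_tensorJoins [Finite I] [Finite J] [Nonempty J]
    (z z' : InnerForest (Option I)) {A B : Set (Option I)} (hA : Saturated z.forest A)
    (hB : Saturated z.forest B) (hA' : Saturated z'.forest A) (hB' : Saturated z'.forest B)
    (hAB : Disjoint A B) (Y : Bess J ⊗[ℚ] Bess J) :
    tensorComp I J (tensorJoins A B (Bess.of z ⊗ₜ Bess.of z')) Y =
      tensorJoins (collapse ⁻¹' A) (collapse ⁻¹' B)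
        (tensorComp I J (Bess.of z ⊗ₜ Bess.of z') Y) := by
  induction Y using tensor_induction with
  | add X Y hX hY => simp only [map_add, tensorComp_add_right, hX, hY]
  | smul c X hX => simp only [map_smul, tensorComp_smul_right, hX]
  | tmul y y' =>
    rw [tensorJoins_tmul, tensorComp_add_left, tensorComp_tmul (Bess.sign_of z'),
      tensorComp_tmul (Bess.sign_joins A B z'), tensorComp_tmul (Bess.sign_of z'), map_smul,
      tensorJoins_tmul, Bess.comp_joins z hA hB hAB, Bess.comp_joins z' hA' hB' hAB,
      Bess.sign_comp, Bess.sign_of, map_smul, LinearMap.smul_apply, smul_add,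
      ← TensorProduct.smul_tmul', ← TensorProduct.smul_tmul', smul_smul, smul_smul]
    congr 2
    ring

theorem coproduct_joins_comp [Finite I] [Finite J] (x : InnerForest (Option I))
    {A B : Set (Option I)} (hA : Saturated x.forest A) (hB : Saturated x.forest B)
    (hAB : Disjoint A B) (y : Bess J) :
    coproduct (I ⊕ J) (Bess.joins (collapse ⁻¹' A) (collapse ⁻¹' B)
        (Bess.comp I J (Bess.of x) y)) =
      tensorJoins (collapse ⁻¹' A) (collapse ⁻¹' B)
        (coproduct (I ⊕ J) (Bess.comp I J (Bess.of x) y)) := by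
  induction y using Bess.induction with
  | add x y hx hy => simp only [map_add, hx, hy]
  | smul c x hx => simp only [map_smul, hx]
  | of y =>
    rw [Bess.comp_of]
    simp only [map_smul, map_sum]
    congr 1
    refine Finset.sum_congr rfl fun s _ => ?_
    exact coproduct_joins _ ((graft_liesOver s).saturated hA) ((graft_liesOver s).saturated hB)
      (hAB.preimage _)

theorem Bess.discrete_comp_discrete [Finite J] :
    Bess.comp I J (Bess.discrete (Option I)) (Bess.discrete J) = Bess.discrete (I ⊕ J) := by
  have comp_eq : Bess.comp I J (Bess.discrete (Option I)) (Bess.discrete J) =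
      Bess.of (addLeaves I (discreteInner J)) := by
    refine (Bess.discrete_comp_of (discreteInner J)).trans ?_
    simp [discreteInner, beforeR]
  rw [comp_eq]
  exact Bess.of_congr (Forest.ext (addLeaves_verts _)) (addLeaves_word _) fun w hw =>
    absurd hw (Finset.notMem_empty w)

theorem coproduct_discrete_comp [Finite I] [Finite J] (y : Bess J) :
    coproduct (I ⊕ J) (Bess.comp I J (Bess.discrete (Option I)) y) =
      tensorComp I J (Bess.discrete (Option I) ⊗ₜ Bess.discrete (Option I)) (coproduct J y) := by
  induction y using Bess.join_induction with
  | add x x' hx hx' => simp only [map_add, hx, hx', tensorComp_add_right]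
  | smul c x hx => simp only [map_smul, hx, tensorComp_smul_right]
  | discrete =>
    rw [coproduct_discrete, tensorComp_discrete, Bess.discrete_comp_discrete, coproduct_discrete]
  | join y A B h ih =>
    rw [coproduct_joins y h.left.saturated h.right.saturated h.disjoint,
      tensorComp_discrete_tensorJoins, ← ih, Bess.discrete_comp_joins, Bess.discrete_comp_of]
    simp only [map_smul]
    rw [coproduct_joins _ (graft_discrete_saturated _ h.left.saturated)
      (graft_discrete_saturated _ h.right.saturated)
      ((Set.disjoint_image_iff Sum.inr_injective).2 h.disjoint)]

theorem tensorComp_tensorJoins_coproduct [Finite I] [Finite J] [Nonempty J]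
    (x : InnerForest (Option I)) {A B : Set (Option I)} (hA : Saturated x.forest A)
    (hB : Saturated x.forest B) (hAB : Disjoint A B) (Y : Bess J ⊗[ℚ] Bess J) :
    tensorComp I J (tensorJoins A B (coproduct (Option I) (Bess.of x))) Y =
      tensorJoins (collapse ⁻¹' A) (collapse ⁻¹' B)
        (tensorComp I J (coproduct (Option I) (Bess.of x)) Y) := by
  refine coproduct_of_induction x (P := fun X => tensorComp I J (tensorJoins A B X) Y =
    tensorJoins (collapse ⁻¹' A) (collapse ⁻¹' B) (tensorComp I J X Y)) ?_ ?_ ?_ ?_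
  · simp [tensorComp]
  · intro X X' hX hX'
    simp only [map_add, tensorComp_add_left, hX, hX']
  · intro c X hX
    simp only [map_smul, tensorComp_smul_left, hX]
  · intro z z' hz hz'
    exact tensorComp_tensorJoins z z' (hz.saturated hA) (hz.saturated hB) (hz'.saturated hA)
      (hz'.saturated hB) hAB Y

theorem coproduct_comp [Finite I] [Finite J] [Nonempty J] (x : Bess (Option I)) (y : Bess J) :
    coproduct (I ⊕ J) (Bess.comp I J x y) =
      tensorComp I J (coproduct (Option I) x) (coproduct J y) := by
  induction x using Bess.join_induction with
  | add x x' hx hx' => simp only [map_add, LinearMap.add_apply, hx, hx', tensorComp_add_left]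
  | smul c x hx => simp only [map_smul, LinearMap.smul_apply, hx, tensorComp_smul_left]
  | discrete => rw [coproduct_discrete, coproduct_discrete_comp]
  | join x A B h ih =>
    have hA := h.left.saturated
    have hB := h.right.saturated
    rw [Bess.comp_joins x hA hB h.disjoint, coproduct_joins_comp x hA hB h.disjoint, ih,
      coproduct_joins x hA hB h.disjoint, tensorComp_tensorJoins_coproduct x hA hB h.disjoint]

end Operad

theorem isCoproduct_coproduct :
    IsCoproduct fun (I : Type u) [Finite I] [Nonempty I] => coproduct I where
  relabel _ _ _ _ _ _ e x := coproduct_relabel e x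
  unit _ _ _ _ := coproduct_discrete
  comp _ _ _ _ _ x y := coproduct_comp x y
  gen_E _ _ _ _ := coproduct_discrete
  gen_omega _ _ _ _ _ _ hij := coproduct_omega hij

/-! ## Uniqueness of the coproduct -/

section Contract

variable {I : Type u}

/-- The map of leaves which contracts `v` to the single leaf `⋆`. -/
def contractLeaf (v : Set I) (a : I) : Option ↥(vᶜ) :=
  if ha : a ∈ v then none else some ⟨a, ha⟩

theorem contractLeaf_of_mem {v : Set I} {a : I} (ha : a ∈ v) : contractLeaf v a = none :=
  dif_pos ha

theorem contractLeaf_of_notMem {v : Set I} {a : I} (ha : a ∉ v) :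
    contractLeaf v a = some ⟨a, ha⟩ :=
  dif_neg ha

theorem eq_or_mem_of_contractLeaf_eq {v : Set I} {a b : I}
    (hab : contractLeaf v a = contractLeaf v b) : a = b ∨ a ∈ v ∧ b ∈ v := by
  by_cases ha : a ∈ v <;> by_cases hb : b ∈ v <;>
    simp_all [contractLeaf_of_mem, contractLeaf_of_notMem]

theorem image_contractLeaf_self {v : Set I} (hv : v.Nonempty) : contractLeaf v '' v = {none} := by
  rw [Set.image_congr fun a ha => contractLeaf_of_mem ha, hv.image_const]

theorem preimage_image_contractLeaf {v w : Set I} (h : v ⊆ w ∨ Disjoint v w) :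
    contractLeaf v ⁻¹' (contractLeaf v '' w) = w := by
  refine Set.Subset.antisymm ?_ (Set.subset_preimage_image _ w)
  rintro a ⟨b, hb, hab⟩
  rcases eq_or_mem_of_contractLeaf_eq hab with rfl | ⟨hbv, hav⟩
  · exact hb
  · exact h.elim (fun hsub => hsub hav) fun hdisj => absurd hb (Set.disjoint_left.1 hdisj hbv)

theorem disjoint_image_contractLeaf {v A B : Set I} (hA : v ⊆ A ∨ Disjoint v A)
    (hAB : Disjoint A B) : Disjoint (contractLeaf v '' A) (contractLeaf v '' B) := by
  rwa [Set.disjoint_image_right, preimage_image_contractLeaf hA]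

variable (F : Forest I) {v : Set I}

theorem Forest.subset_or_disjoint_of_minimal (hmin : Minimal (· ∈ F.verts) v) {w : Set I}
    (hw : w ∈ F.verts.erase v) : v ⊆ w ∨ Disjoint v w := by
  rw [Finset.mem_erase] at hw
  rcases F.laminar v hmin.prop w hw.2 with hsub | hsub | hdisj
  · exact Or.inl hsub
  · exact absurd (hmin.eq_of_subset hw.2 hsub) hw.1
  · exact Or.inr hdisj

theorem Forest.isNode_image_contractLeaf {N : Set I} (hN : IsNode F.verts N) :
    IsNode ((F.verts.erase v).image fun w => contractLeaf v '' w) (contractLeaf v '' N) := by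
  rcases hN with hN | ⟨i, rfl⟩
  · by_cases hNv : N = v
    · subst hNv
      exact Or.inr ⟨none, image_contractLeaf_self (F.nonempty N hN)⟩
    · exact Or.inl (Finset.mem_image_of_mem _ (Finset.mem_erase.2 ⟨hNv, hN⟩))
  · exact Or.inr ⟨contractLeaf v i, Set.image_singleton⟩

theorem Forest.disjoint_image_contractLeaf_of_isSplit (hmin : Minimal (· ∈ F.verts) v)
    {w A B : Set I} (hw : w ∈ F.verts.erase v) (hs : IsSplit F.verts w A B) :
    Disjoint (contractLeaf v '' A) (contractLeaf v '' B) := by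
  rcases F.subset_or_disjoint_of_minimal hmin hw with hsub | hdisj
  · rcases F.node_sub_branch hs (Or.inl hmin.prop) hsub (Finset.ne_of_mem_erase hw).symm with
      hA | hB
    · exact disjoint_image_contractLeaf (Or.inl hA) hs.2.2.1
    · exact (disjoint_image_contractLeaf (Or.inl hB) hs.2.2.1.symm).symm
  · have hA : A ⊆ w := hs.2.2.2 ▸ Set.subset_union_left
    exact disjoint_image_contractLeaf (Or.inr (hdisj.mono_right hA)) hs.2.2.1

/-- Contraction of the minimal vertex `v` to the leaf `⋆`. -/
def Forest.contract (hmin : Minimal (· ∈ F.verts) v) : Forest (Option ↥(vᶜ)) where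
  verts := (F.verts.erase v).image fun w => contractLeaf v '' w
  nonempty := by
    intro U hU
    obtain ⟨w, hw, rfl⟩ := Finset.mem_image.1 hU
    exact (F.nonempty w (Finset.mem_of_mem_erase hw)).image _
  laminar := by
    intro U hU U' hU'
    obtain ⟨w, hw, rfl⟩ := Finset.mem_image.1 hU
    obtain ⟨w', hw', rfl⟩ := Finset.mem_image.1 hU'
    exact (F.laminar w (Finset.mem_of_mem_erase hw) w' (Finset.mem_of_mem_erase hw')).imp
      Set.image_mono (Or.imp Set.image_mono
        (disjoint_image_contractLeaf (F.subset_or_disjoint_of_minimal hmin hw)))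
  binary := by
    intro U hU
    obtain ⟨w, hw, rfl⟩ := Finset.mem_image.1 hU
    obtain ⟨A, B, hs⟩ := F.binary w (Finset.mem_of_mem_erase hw)
    refine ⟨contractLeaf v '' A, contractLeaf v '' B, F.isNode_image_contractLeaf hs.1,
      F.isNode_image_contractLeaf hs.2.1, F.disjoint_image_contractLeaf_of_isSplit hmin hw hs, ?_⟩
    rw [← Set.image_union, hs.2.2.2]

theorem Forest.exists_eq_singleton_of_minimal (hmin : Minimal (· ∈ F.verts) v) {A B : Set I}
    (hs : IsSplit F.verts v A B) : ∃ i, A = {i} := by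
  refine hs.1.resolve_left fun hA => ?_
  obtain ⟨b, hb⟩ := F.node_nonempty hs.2.1
  have hvA : v ⊆ A :=
    (hmin.eq_of_subset hA (hs.2.2.2 ▸ Set.subset_union_left)).superset
  exact Set.disjoint_left.1 hs.2.2.1 (hvA (hs.2.2.2 ▸ Or.inr hb)) hb

theorem Forest.exists_pair_eq_univ_of_minimal (hmin : Minimal (· ∈ F.verts) v) :
    ∃ i j : v, i ≠ j ∧ ({i, j} : Set v) = Set.univ := by
  obtain ⟨A, B, hs⟩ := F.binary v hmin.prop
  obtain ⟨i, rfl⟩ := F.exists_eq_singleton_of_minimal hmin hs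
  obtain ⟨j, rfl⟩ := F.exists_eq_singleton_of_minimal hmin (Forest.split_symm hs)
  obtain rfl : {i} ∪ {j} = v := hs.2.2.2
  refine ⟨⟨i, Or.inl rfl⟩, ⟨j, Or.inr rfl⟩, fun hij => ?_, Set.eq_univ_of_forall ?_⟩
  · exact Set.disjoint_left.1 hs.2.2.1 rfl (Subtype.mk.inj hij)
  · rintro ⟨a, ha⟩
    exact ha.imp (fun h => Subtype.ext h) fun h => Subtype.ext h

end Contract

section CompOmega

variable {I J : Type u}

theorem graftVert_of_tree {F : Forest (Option I)} {F₂ : Forest J} (s : PathVert F → Tree F₂)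
    (hF₂ : ∀ T : Tree F₂, T.1 = Set.univ) {v : Set (Option I)} (hv : v ∈ F.verts) :
    graftVert F F₂ s v = collapse ⁻¹' v := by
  by_cases hn : none ∈ v
  · refine Set.Subset.antisymm (graftVert_subset s v) ?_
    rw [graftVert_path s ⟨v, hv, hn⟩]
    rintro (i | j) hx
    · obtain ⟨u, hu, hi⟩ := exists_mem_side (⟨v, hv, hn⟩ : PathVert F) hx
      exact (inl_mem_grow s _ i).2 ⟨u, hu, Subtype.ext ((hF₂ _).trans (hF₂ _).symm), hi⟩
    · rw [inr_mem_grow, hF₂]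
      trivial
  · exact graftVert_of_notMem s hn

variable {i j : J} (hij : i ≠ j)

theorem cherry_tree (hJ : ({i, j} : Set J) = Set.univ) (T : Tree (cherry i j hij)) :
    T.1 = Set.univ := by
  rw [← hJ]
  exact (T.2.2 {i, j} (Or.inl (Finset.mem_singleton_self _)) (hJ ▸ Set.subset_univ _)).symm

theorem graft_cherry_verts (hJ : ({i, j} : Set J) = Set.univ) {F : Forest (Option I)}
    (s : PathVert F → Tree (cherry i j hij)) :
    (graft F (cherry i j hij) s).verts =
      insert (Set.range Sum.inr) (F.verts.image fun w => collapse ⁻¹' w) := by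
  change Finset.image _ F.verts ∪ Finset.image _ {_} = _
  rw [Finset.image_congr fun w hw => graftVert_of_tree s (cherry_tree hij hJ) hw,
    Finset.image_singleton, hJ, Set.image_univ, Finset.union_comm, Finset.insert_eq]

theorem Bess.exists_comp_omega_eq_of [Finite J] (hJ : ({i, j} : Set J) = Set.univ)
    (a : InnerForest (Option I)) : ∃ s : PathVert a.forest → Tree (cherryInner i j hij).forest,
      Bess.comp I J (Bess.of a) (Bess.omega i j hij) =
        Bess.of (graftInner a (cherryInner i j hij) s) := by
  have : Subsingleton (Tree (cherryInner i j hij).forest) :=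
    ⟨fun T T' => Subtype.ext ((cherry_tree hij hJ T).trans (cherry_tree hij hJ T').symm)⟩
  obtain ⟨T, hT, -⟩ := (cherry i j hij).exists_tree (N := {i}) (Or.inr ⟨i, rfl⟩)
  refine ⟨fun _ => ⟨T, hT⟩, ?_⟩
  rw [Bess.omega, Bess.comp_of, Fintype.sum_subsingleton _ fun _ => ⟨T, hT⟩]
  simp [cherryInner, beforeR]

/-- The decomposition of the leaves in the complement of `v` and `v`. -/
def splitLeaves (v : Set I) : ↥(vᶜ) ⊕ ↥v ≃ I := (Equiv.sumComm _ _).trans (Equiv.Set.sumCompl v)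

theorem splitLeaves_inl (v : Set I) (i : ↥(vᶜ)) : splitLeaves v (Sum.inl i) = i := by
  simp [splitLeaves]

theorem splitLeaves_inr (v : Set I) (j : v) : splitLeaves v (Sum.inr j) = j := by
  simp [splitLeaves]

theorem contractLeaf_splitLeaves (v : Set I) (z : ↥(vᶜ) ⊕ ↥v) :
    contractLeaf v (splitLeaves v z) = collapse z := by
  rcases z with i | j
  · rw [splitLeaves_inl, contractLeaf_of_notMem i.2]
    rfl
  · rw [splitLeaves_inr, contractLeaf_of_mem j.2]
    rfl

theorem splitLeaves_image_preimage_collapse {v : Set I} (U : Set (Option ↥(vᶜ))) :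
    splitLeaves v '' (collapse ⁻¹' U) = contractLeaf v ⁻¹' U := by
  rw [← funext (contractLeaf_splitLeaves v)]
  exact (splitLeaves v).image_preimage (contractLeaf v ⁻¹' U)

theorem splitLeaves_image_range_inr (v : Set I) : splitLeaves v '' Set.range Sum.inr = v := by
  rw [← Set.range_comp]
  exact (congrArg Set.range (funext (splitLeaves_inr v))).trans Subtype.range_coe

theorem Forest.relabel_graft_contract (F : Forest I) {v : Set I}
    (hmin : Minimal (· ∈ F.verts) v) {i j : v} (hij : i ≠ j) (hv : ({i, j} : Set v) = Set.univ)
    (s : PathVert (F.contract hmin) → Tree (cherry i j hij)) :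
    (graft (F.contract hmin) (cherry i j hij) s).relabel (splitLeaves v) = F := by
  have image_eq : (F.verts.erase v).image
      (fun w => contractLeaf v ⁻¹' (contractLeaf v '' w)) = F.verts.erase v :=
    (Finset.image_congr fun w hw => preimage_image_contractLeaf
      (F.subset_or_disjoint_of_minimal hmin hw)).trans Finset.image_id
  refine Forest.ext ?_
  change Finset.image _ (graft _ _ s).verts = _
  rw [graft_cherry_verts hij hv, Finset.image_insert, splitLeaves_image_range_inr, Forest.contract,
    Finset.image_image, Finset.image_image]
  simp only [Function.comp_def, splitLeaves_image_preimage_collapse]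
  rw [image_eq, Finset.insert_erase hmin.prop]

theorem Bess.exists_of_eq_smul_comp_omega [Finite I] (x : InnerForest I)
    (hx : x.forest.verts.Nonempty) :
    ∃ (v : Set I) (i j : v) (hij : i ≠ j) (a : InnerForest (Option ↥(vᶜ))) (c : ℚ),
      ({i, j} : Set v) = Set.univ ∧ Bess.of x = c •
        Bess.relabel (splitLeaves v) (Bess.comp ↥(vᶜ) ↥v (Bess.of a) (Bess.omega i j hij)) := by
  obtain ⟨v, hmin⟩ := Finset.exists_minimal hx
  obtain ⟨i, j, hij, hv⟩ := x.forest.exists_pair_eq_univ_of_minimal hmin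
  obtain ⟨a, ha⟩ := (x.forest.contract hmin).exists_innerForest
  obtain ⟨s, comp_eq⟩ := Bess.exists_comp_omega_eq_of hij hv a
  have forest_eq :
      ((graftInner a (cherryInner i j hij) s).relabel (splitLeaves v)).forest = x.forest := by
    obtain ⟨F, _, _, _, _, _⟩ := a
    subst ha
    exact x.forest.relabel_graft_contract hmin hij hv s
  obtain ⟨c, hc⟩ := Bess.exists_of_eq_smul_of forest_eq.symm
  exact ⟨v, i, j, hij, a, c, hv, by rw [comp_eq, Bess.relabel_of, hc]⟩

end CompOmega

section Unique

variable {I : Type u} [Finite I]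

theorem card_option_compl_lt {v : Set I} (hv : Nat.card v = 2) :
    Nat.card (Option ↥(vᶜ)) < Nat.card I := by
  rw [← Nat.card_congr (splitLeaves v), Nat.card_sum, hv, Finite.card_option]
  exact Nat.lt_succ_self _

variable {Δ Δ₁ Δ₂ : ∀ (I : Type u) [Finite I] [Nonempty I], Bess I →ₗ[ℚ] Bess I ⊗[ℚ] Bess I}

theorem IsCoproduct.map_discrete (h : IsCoproduct Δ) (I : Type u) [Finite I] [Nonempty I] :
    Δ I (Bess.discrete I) = Bess.discrete I ⊗ₜ Bess.discrete I := by
  induction hn : Nat.card I using Nat.strong_induction_on generalizing I with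
  | _ n ih =>
  subst hn
  rcases subsingleton_or_nontrivial I with hI | hI
  · exact h.unit I (Nat.card_eq_one_iff_unique.2 ⟨hI, inferInstance⟩)
  · obtain ⟨i, j, hij⟩ := exists_pair_ne I
    have card_pair : Nat.card ({i, j} : Set I) = 2 := Set.ncard_pair hij
    have : Nonempty ({i, j} : Set I) := ⟨⟨i, Or.inl rfl⟩⟩
    rw [← Bess.relabel_discrete (splitLeaves {i, j}), ← Bess.discrete_comp_discrete, h.relabel,
      h.comp, ih _ (card_option_compl_lt card_pair) _ rfl, h.gen_E _ card_pair,
      tensorComp_discrete, TensorProduct.map_tmul]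

theorem IsCoproduct.unique (h₁ : IsCoproduct Δ₁) (h₂ : IsCoproduct Δ₂) (I : Type u) [Finite I]
    [Nonempty I] : Δ₁ I = Δ₂ I := by
  induction hn : Nat.card I using Nat.strong_induction_on generalizing I with
  | _ n ih =>
  subst hn
  refine Bess.hom_ext fun x => ?_
  by_cases hx : x.forest.verts.Nonempty
  · obtain ⟨v, i, j, hij, a, c, hv, x_eq⟩ := Bess.exists_of_eq_smul_comp_omega x hx
    have card_v : Nat.card v = 2 := by
      rw [← Nat.card_univ, ← hv]
      exact Set.ncard_pair hij
    have : Nonempty v := ⟨i⟩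
    rw [x_eq, map_smul, map_smul, h₁.relabel, h₂.relabel, h₁.comp, h₂.comp,
      ih _ (card_option_compl_lt card_v) _ rfl, h₁.gen_omega v card_v, h₂.gen_omega v card_v]
  · obtain ⟨c, hc⟩ := Bess.exists_of_eq_smul_of (x := x) (y := discreteInner I)
      (Forest.ext (Finset.not_nonempty_iff_eq_empty.1 hx))
    rw [hc, map_smul, map_smul]
    exact congrArg (c • ·) ((h₁.map_discrete I).trans (h₂.map_discrete I).symm)

end Unique

end Bessel

end

theorem mainTheorem2 :
    (∃! Δ : ∀ (I : Type u) [Finite I] [Nonempty I],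
        Bessel.Bess I →ₗ[ℚ] Bessel.Bess I ⊗[ℚ] Bessel.Bess I, Bessel.IsCoproduct Δ) ∧
    ∀ Δ : ∀ (I : Type u) [Finite I] [Nonempty I],
        Bessel.Bess I →ₗ[ℚ] Bessel.Bess I ⊗[ℚ] Bessel.Bess I,
      Bessel.IsCoproduct Δ →
      ∀ (I : Type u) [Finite I] [Nonempty I] (x : Bessel.InnerForest I)
        (o' : ∀ V' : Finset (Set I), Bessel.GlobalOrientation V')
        (o'' : ∀ V' : Finset (Set I), Bessel.GlobalOrientation (x.forest.verts \ V')),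
        (∀ V' ⊆ x.forest.verts, Bessel.Compatible (o' V') (o'' V') x.glob) →
        Δ I (Bessel.Bess.of x) =
          ∑ V' ∈ x.forest.verts.powerset,
            Bessel.gammaSum x (o' V') ⊗ₜ[ℚ] Bessel.gammaSum x (o'' V') := by
  refine ⟨⟨_, Bessel.isCoproduct_coproduct, fun Δ h => ?_⟩, fun Δ h I _ _ x o' o'' ho => ?_⟩
  · funext I _ _
    exact h.unique Bessel.isCoproduct_coproduct I
  · rw [h.unique Bessel.isCoproduct_coproduct I]
    exact Bessel.coproduct_formula x o' o'' ho
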